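/- **Setting.** Consider a $(2+1)$-dimensional stationary black hole with metric $$ds^2=-N^2(r)\,dt^2+g_{rr}(r)\,dr^2+g_{\theta\theta}(r)\,\big(d\theta+N^\theta(r)\,dt\big)^2,\qquad r>r_+,$$ where $N,g_{rr},g_{\theta\theta},N^\theta$ are smooth and $N,g_{rr},g_{\theta\theta}>0$ on $(r_+,\infty)$, with a regular non-degenerate Killing horizon at $r=r_+$ of angular velocity $\Omega_H$ and surface gravity $\kappa_+>0$: as $r\to r_+^+$, $N\to0$, $g_{\theta\theta}$ tends to a positive limit, $N^\theta+\Omega_H=O(N^2)$, and $g_{rr}^{-1/2}\,\frac{d}{dr}\sqrt{N^2-g_{\theta\theta}(N^\theta+\Omega_H)^2}\to\kappa_+$. Let $r_M>r_+$ be such that $\partial_t+\Omega_H\partial_\theta$ is timelike, i.e. $g_{\theta\theta}(N^\theta+\Omega_H)^2<N^2$, for $r\in(r_+,r_M]$; a mirror stands at $r=r_M$. The complex Riemannian section has coordinates $(\tau,r,\tilde\theta)$, with $\tau$ of period $2\pi/\kappa_+$ and $\tilde\theta$ of period $2\pi$, and metric $$ds^2_{\mathbb C}=N^2d\tau^2+g_{rr}dr^2+g_{\theta\theta}\big(d\tilde\theta-i(N^\theta+\Omega_H)\,d\tau\big)^2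 .$$ **Black hole modes.** Let $m\ge0$. For $n,k\in\mathbb Z$ let $G_{nk}(r,r')$, $r,r'\in(r_+,r_M)$, be the solution of $$(\nabla^2-m^2)\big[e^{i\kappa_+n(\tau-\tau')+ik(\tilde\theta-\tilde\theta')}G_{nk}(r,r')\big]=-e^{i\kappa_+n(\tau-\tau')+ik(\tilde\theta-\tilde\theta')}\,\frac{\delta(r-r')}{\sqrt g}$$ (with $\nabla^2$ and $g=|\det g^{\mathbb C}|$ those of $ds^2_{\mathbb C}$) which is bounded as $r\to r_+$ and tends to $0$ as $r\to r_M$; the summands of the Hartle–Hawking Green's function are $$G^{BH}_{nk}(x,x')=\frac{\kappa_+}{4\pi^2}e^{i\kappa_+n(\tau-\tau')+ik(\tilde\theta-\tilde\theta')}G_{nk}(r,r').$$ **Minkowski modes.** Let $T_M>0$, $\Omega_M\in\mathbb R$, $m_M>0$. For rotating Minkowski spacetime, with complex section $d\tau^2+d\rho^2+\rho^2(d\tilde\theta-i\Omega_M d\tau)^2$, $\rho>0$, let $q_{nk}$ be a square root with $\operatorname{Re}q_{nk}\ge0$ of $(2\pi T_Mn+ik\Omega_M)^2+m_M^2$ (either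 root where this number is negative, which is possible only for $n=0$). Let $G^{\mathbb M}_{nk}(\rho,\rho')$ be the solution of the analogous mode equation, with mass $m_M$ and frequency $2\pi T_Mn$, which is bounded as $\rho\to0$ and satisfies $\sqrt\rho\,(\partial_\rho+q_{nk})G^{\mathbb M}_{nk}(\rho,\rho')\to0$ as $\rho\to\infty$; put $$G^{\mathbb M}_{nk}(x,x')=\frac{T_M}{2\pi}e^{2\pi iT_Mn(\tau-\tau')+ik(\tilde\theta-\tilde\theta')}G^{\mathbb M}_{nk}(\rho,\rho').$$ **Theorem.** Fix $r\in(r_+,r_M)$ and choose $$\gamma=N(r),\quad T_M=\frac{\kappa_+}{2\pi},\quad \Omega_M=N^\theta(r)+\Omega_H,\quad \rho=\gamma^{-1}\sqrt{g_{\theta\theta}(r)} .$$ Then all the radial Green's functions $G_{nk}$ and $G^{\mathbb M}_{nk}$ above exist and are unique, and with the principal roots $$\chi_{nk}=\sqrt{g_{\theta\theta}(r)\big(\kappa_+n+ik(N^\theta(r)+\Omega_H)\big)^2+N(r)^2k^2},\qquad \chi^{\mathbb M}_{nk}=\sqrt{\rho^2(2\pi T_Mn+ik\Omega_M)^2+k^2}$$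 the following hold. 1. At coincidence, as $n^2+k^2\to\infty$, $$G^{BH}_{nk}(x,x)=\frac{\kappa_+}{4\pi^2}\frac1{2\chi_{nk}}+O(\chi_{nk}^{-3}),\qquad G^{\mathbb M}_{nk}(x,x)=\frac{T_M}{2\pi}\frac1{2\chi^{\mathbb M}_{nk}}+O\big((\chi^{\mathbb M}_{nk})^{-3}\big).$$ 2. The leading terms of $G^{BH}_{nk}(x,x)$ and $\gamma^{-1}G^{\mathbb M}_{nk}(x,x)$ are equal for all $(n,k)\ne(0,0)$, and $\sum_{(n,k)\neq(0,0)}|\chi_{nk}|^{-3}<\infty$. 3. For every angular separation $\tilde\theta\in\mathbb R$, with the points $x=(0,r,0)$, $x'=(0,r,\tilde\theta)$ in the black hole section and $x=(0,\rho,0)$, $x'=(0,\rho,\tilde\theta)$ in the Minkowski section, the double sum $$\sum_{(n,k)\in\mathbb Z^2}\Big[G^{BH}_{nk}(x,x')-\gamma^{-1}G^{\mathbb M}_{nk}(x,x')\Big]$$ converges absolutely, and as $\tilde\theta\to0^+$ it tends to its finite value at $\tilde\theta=0$. -/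

import Mathlib

open Filter Topology Set Asymptotics

noncomputable section

/-! Coordinates are `x = ![τ, r, θ]`. A complex metric is a field of complex symmetric matrices
on (an open set of) this real coordinate space. -/

/-- The metric `N² dτ² + g_rr dr² + g_θθ (dθ - i w dτ)²` of a complex Riemannian section. -/
def sectionMetric (N grr gθθ w : ℝ → ℝ) (x : Fin 3 → ℝ) : Matrix (Fin 3) (Fin 3) ℂ :=
  !![((N (x 1) : ℂ) ^ 2 + gθθ (x 1) * (-Complex.I * w (x 1)) ^ 2), 0,
        (gθθ (x 1) : ℂ) * (-Complex.I * w (x 1));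
     0, (grr (x 1) : ℂ), 0;
     (gθθ (x 1) : ℂ) * (-Complex.I * w (x 1)), 0, (gθθ (x 1) : ℂ)]

/-- `√|det g|`. -/
def volDensity (g : (Fin 3 → ℝ) → Matrix (Fin 3) (Fin 3) ℂ) (x : Fin 3 → ℝ) : ℝ :=
  Real.sqrt ‖(g x).det‖

/-- Coordinate partial derivative `∂_μ Φ`. -/
def partialD (μ : Fin 3) (Φ : (Fin 3 → ℝ) → ℂ) (x : Fin 3 → ℝ) : ℂ :=
  deriv (fun t : ℝ => Φ (Function.update x μ t)) (x μ)

/-- The Klein-Gordon operator `(∇² - m²) Φ`, where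
`∇² Φ = |g|^{-1/2} ∂_μ (|g|^{1/2} g^{μν} ∂_ν Φ)`. -/
def kleinGordon (g : (Fin 3 → ℝ) → Matrix (Fin 3) (Fin 3) ℂ) (m : ℝ)
    (Φ : (Fin 3 → ℝ) → ℂ) (x : Fin 3 → ℝ) : ℂ :=
  ((volDensity g x : ℝ) : ℂ)⁻¹ *
      ∑ μ, partialD μ (fun y => (volDensity g y : ℂ) * ∑ ν, (g y)⁻¹ μ ν * partialD ν Φ y) x
    - (m : ℂ) ^ 2 * Φ x

/-- `e^{i ω (τ - τ')} e^{i k (θ - θ')} G(r, r')`. -/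
def modeKernel (ω : ℝ) (k : ℤ) (G : ℝ → ℝ → ℂ) (x x' : Fin 3 → ℝ) : ℂ :=
  Complex.exp (Complex.I * ω * (x 0 - x' 0)) * Complex.exp (Complex.I * k * (x 2 - x' 2)) *
    G (x 1) (x' 1)

/-- `G` solves, for radii in the open interval `S`, the `(ω, k)` Fourier component
`(∇² - m²) [e^{i ω (τ - τ')} e^{i k (θ - θ')} G(r, r')]
    = - e^{i ω (τ - τ')} e^{i k (θ - θ')} δ(r - r') / √g`
of the Green's function equation: it is continuous across `r = r'`, solves the homogeneous
equation off `r = r'`, and `√g g^{rr} ∂_r G` jumps by `-1` there. -/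
structure IsModeGreen (g : (Fin 3 → ℝ) → Matrix (Fin 3) (Fin 3) ℂ) (S : Set ℝ) (m ω : ℝ) (k : ℤ)
    (G : ℝ → ℝ → ℂ) : Prop where
  continuousOn : ∀ r' ∈ S, ContinuousOn (fun r => G r r') S
  contDiffOn : ∀ r' ∈ S, ContDiffOn ℝ 2 (fun r => G r r') (S \ {r'})
  equation : ∀ x x' : Fin 3 → ℝ, x 1 ∈ S → x' 1 ∈ S → x 1 ≠ x' 1 →
    kleinGordon g m (fun y => modeKernel ω k G y x') x = 0
  jump : ∀ x' : Fin 3 → ℝ, x' 1 ∈ S → ∃ a b : ℂ,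
    Tendsto (deriv (fun r => G r (x' 1))) (𝓝[<] (x' 1)) (𝓝 a) ∧
    Tendsto (deriv (fun r => G r (x' 1))) (𝓝[>] (x' 1)) (𝓝 b) ∧
    (volDensity g x' : ℂ) * (g x')⁻¹ 1 1 * (b - a) = -1

/-- A `(2+1)`-dimensional stationary black hole
`-N² dt² + g_rr dr² + g_θθ (dθ + N^θ dt)²` with exterior region `r > r_+` and a non-degenerate
Killing horizon at `r = r_+` of angular velocity `Ω_H` and surface gravity `κ_+`. -/
structure StationaryBlackHole where
  lapse : ℝ → ℝ
  grr : ℝ → ℝ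
  gθθ : ℝ → ℝ
  shift : ℝ → ℝ
  rPlus : ℝ
  ΩH : ℝ
  κ : ℝ
  contDiff_lapse : ContDiffOn ℝ (⊤ : ℕ∞) lapse (Ioi rPlus)
  contDiff_grr : ContDiffOn ℝ (⊤ : ℕ∞) grr (Ioi rPlus)
  contDiff_gθθ : ContDiffOn ℝ (⊤ : ℕ∞) gθθ (Ioi rPlus)
  contDiff_shift : ContDiffOn ℝ (⊤ : ℕ∞) shift (Ioi rPlus)
  lapse_pos : ∀ r, rPlus < r → 0 < lapse r
  grr_pos : ∀ r, rPlus < r → 0 < grr r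
  gθθ_pos : ∀ r, rPlus < r → 0 < gθθ r
  /-- The horizon. -/
  lapse_tendsto : Tendsto lapse (𝓝[>] rPlus) (𝓝 0)
  /-- The horizon is a circle of finite non-zero length. -/
  gθθ_tendsto : ∃ h : ℝ, 0 < h ∧ Tendsto gθθ (𝓝[>] rPlus) (𝓝 h)
  /-- The horizon rotates rigidly with angular velocity `Ω_H`; the off-diagonal component
  `g_θθ (N^θ + Ω_H)` of the metric in corotating coordinates vanishes at the horizon to the same
  order as `N²`, as it must for the metric to be regular there. -/
  shift_isBigO : (fun r => shift r + ΩH) =O[𝓝[>] rPlus] (fun r => lapse r ^ 2)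
  κ_pos : 0 < κ
  /-- `κ_+` is the limit of the proper radial derivative of the norm
  `√(N² - g_θθ (N^θ + Ω_H)²)` of the horizon generator `∂_t + Ω_H ∂_θ`. -/
  surface_gravity : Tendsto
    (fun r => deriv (fun s => Real.sqrt (lapse s ^ 2 - gθθ s * (shift s + ΩH) ^ 2)) r /
      Real.sqrt (grr r)) (𝓝[>] rPlus) (𝓝 κ)

namespace StationaryBlackHole

/-- A mirror radius: the horizon generator `∂_t + Ω_H ∂_θ` is timelike from the horizon up to and
including the mirror. -/
def IsMirror (B : StationaryBlackHole) (rM : ℝ) : Prop :=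
  B.rPlus < rM ∧ ∀ r ∈ Ioc B.rPlus rM, B.gθθ r * (B.shift r + B.ΩH) ^ 2 < B.lapse r ^ 2

/-- The metric of the complex Riemannian section, in corotating coordinates. -/
def metric (B : StationaryBlackHole) : (Fin 3 → ℝ) → Matrix (Fin 3) (Fin 3) ℂ :=
  sectionMetric B.lapse B.grr B.gθθ (fun r => B.shift r + B.ΩH)

/-- The radial part `G_nk(r, r')` of the Hartle-Hawking Green's function: regular at the horizon,
Dirichlet at the mirror. (Of two independent radial solutions, one vanishes or has a finite limit
at the horizon and the other is unbounded, so regularity is boundedness.) -/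
structure IsRadialGreen (B : StationaryBlackHole) (rM m : ℝ) (n k : ℤ) (G : ℝ → ℝ → ℂ) : Prop where
  green : IsModeGreen B.metric (Ioo B.rPlus rM) m (B.κ * n) k G
  regular : ∀ r' ∈ Ioo B.rPlus rM, ∃ C : ℝ, ∀ᶠ r in 𝓝[>] B.rPlus, ‖G r r'‖ ≤ C
  dirichlet : ∀ r' ∈ Ioo B.rPlus rM, Tendsto (fun r => G r r') (𝓝[<] rM) (𝓝 0)

/-- The summand `G^BH_nk(x, x')`. -/
def summand (B : StationaryBlackHole) (G : ℤ → ℤ → ℝ → ℝ → ℂ) (n k : ℤ) (x x' : Fin 3 → ℝ) : ℂ :=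
  (B.κ / (4 * Real.pi ^ 2) : ℝ) * modeKernel (B.κ * n) k (G n k) x x'

end StationaryBlackHole

/-- The complex Riemannian section `dτ² + dρ² + ρ² (dθ - i Ω dτ)²` of Minkowski spacetime in
coordinates rotating with angular velocity `Ω`. -/
def minkowskiMetric (Ω : ℝ) : (Fin 3 → ℝ) → Matrix (Fin 3) (Fin 3) ℂ :=
  sectionMetric (fun _ => 1) (fun _ => 1) (fun ρ => ρ ^ 2) (fun _ => Ω)

/-- `q n k` is a square root with non-negative real part of `(2π T n + i k Ω)² + m²`. It is unique
unless this number is negative real (possible only for `n = 0`), where both roots are allowed. -/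
def IsMomentum (T Ω m : ℝ) (q : ℤ → ℤ → ℂ) : Prop :=
  ∀ n k : ℤ, q n k ^ 2 = ((2 * Real.pi * T * n : ℝ) + Complex.I * k * Ω) ^ 2 + (m : ℂ) ^ 2 ∧
    0 ≤ (q n k).re

/-- The radial part `G^M_nk(ρ, ρ')` of the Green's function of a field of mass `m` and temperature
`T` in rotating Minkowski spacetime: regular on the axis `ρ = 0` and behaving at infinity as
`e^{-q ρ} / √ρ`, which is decay for `Re q > 0` and Sommerfeld's radiation condition
for `Re q = 0`. -/
structure IsMinkowskiRadialGreen (T Ω m : ℝ) (q : ℤ → ℤ → ℂ) (n k : ℤ) (G : ℝ → ℝ → ℂ) : Prop where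
  green : IsModeGreen (minkowskiMetric Ω) (Ioi 0) m (2 * Real.pi * T * n) k G
  regular : ∀ ρ' ∈ Ioi (0 : ℝ), ∃ C : ℝ, ∀ᶠ ρ in 𝓝[>] (0 : ℝ), ‖G ρ ρ'‖ ≤ C
  radiation : ∀ ρ' ∈ Ioi (0 : ℝ), Tendsto
    (fun ρ : ℝ => (Real.sqrt ρ : ℂ) * (deriv (fun s => G s ρ') ρ + q n k * G ρ ρ')) atTop (𝓝 0)

/-- The summand `G^M_nk(x, x')`. -/
def minkowskiSummand (T : ℝ) (G : ℤ → ℤ → ℝ → ℝ → ℂ) (n k : ℤ) (x x' : Fin 3 → ℝ) : ℂ :=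
  (T / (2 * Real.pi) : ℝ) * modeKernel (2 * Real.pi * T * n) k (G n k) x x'

/-- `χ = √(h (ω + i k w)² + N² k²)`, principal root. -/
def chi (N h w ω : ℝ) (k : ℤ) : ℂ :=
  ((h : ℂ) * (ω + Complex.I * k * w) ^ 2 + (N : ℂ) ^ 2 * (k : ℂ) ^ 2) ^ (1 / 2 : ℂ)

/-- `χ_nk(r)` of the black hole. -/
def StationaryBlackHole.chi (B : StationaryBlackHole) (r : ℝ) (p : ℤ × ℤ) : ℂ :=
  _root_.chi (B.lapse r) (B.gθθ r) (B.shift r + B.ΩH) (B.κ * p.1) p.2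

/-- `χ^M_nk(ρ)` of rotating Minkowski spacetime. -/
def minkowskiChi (T Ω ρ : ℝ) (p : ℤ × ℤ) : ℂ :=
  chi 1 (ρ ^ 2) Ω (2 * Real.pi * T * p.1) p.2

end

/-! Separation of variables turns both mode equations into `p (p u')' = V u` with `p = √g g^{rr}`
and `V = χ² + m² N² g_θθ` (`IsSection.kleinGordon_modeKernel`). The radial Green's function is
`u(r_<) x(r_>) / W`, so at coincidence it is `1 / (y_u - y_x)`, where `y = p u' / u` denotes the
logarithmic derivative of either solution. Now `y` solves the Riccati equation `p y' = V - y²`. For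
a solution of non-decreasing modulus this equation is strongly damped, and `y` is driven to `√V - V₁
/ (4 V)` up to `O(1/λ)`, with `λ = √(n² + k²)` and `V₁ = p V'`
(`exists_norm_logDeriv_sub_wkbRate_le`). For the solution of non-increasing modulus the correction
has the opposite effect and cancels in `y_u - y_x`. Hence the diagonal is `1 / (2 √V) + O(λ⁻³)`, and
replacing `√V` by `χ` costs only the same order (`exists_norm_green_diag_sub_le`,
`IsSection.exists_norm_greenKernel_sub_le`).

The chosen parameters give `χ = γ χ^M` exactly and equal prefactors, so the leading terms cancel.
The remainder is `O(χ⁻³)`, which is summable over `ℤ²`. An angular separation multiplies each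
coincident difference by a phase `e^{-ikθ}`, so the Weierstrass test gives absolute convergence and
continuity in `θ`.

Since `V` is complex, growth and decay are read off the flux `ū p u'`: its real part controls the
derivative of `|u|²`, and it is non-decreasing where `Re V ≥ 0`, that is where the corotating
Killing field is timelike. Regular solutions are obtained as limits of Neumann problems by
compactness. They are the only bounded ones, because `∫ dr / p` diverges at the horizon and on the
axis. For the black hole the whole interval up to the mirror has `Re V ≥ 0`, which settles
existence, uniqueness and monotonicity.

In rotating Minkowski space `Re V` may become negative beyond the light cylinder. For `Re q > 0` the
flux in direction `q̄` is still monotone and yields a decaying solution. For imaginary `q ≠ 0` the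
Liouville transform `√ρ u` has asymptotic plane waves, and the incoming one can be removed; `q = 0`
is explicit. A bounded radiating solution vanishes (`IsRadialSol.eq_zero_of_bounded_of_radiating`),
which gives uniqueness and a nonzero Wronskian. It remains to see that the radiating solution has
non-positive real flux inside the light cylinder for all but finitely many modes
(`exists_minkowski_flux_nonpos`). If it had positive flux at `β`, the local asymptotics at a
slightly larger radius would fix its logarithmic derivative, and this contradicts the sign or the
conservation of the current `Im (x̄ p x')`. -/

/-! ### Linear ordinary differential equations on a half-line -/

/-- The terms of the Peano-Baker series of `x' = A x`, `x t₀ = x₀`. -/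
noncomputable def peanoBaker {E : Type*} [NormedAddCommGroup E] [NormedSpace ℝ E]
    (A : ℝ → E →L[ℝ] E) (t₀ : ℝ) (x₀ : E) : ℕ → ℝ → E
  | 0, _ => x₀
  | n + 1, t => ∫ s in t₀..t, A s (peanoBaker A t₀ x₀ n s)

section PeanoBaker

variable {E : Type*} [NormedAddCommGroup E] [NormedSpace ℝ E]
  {A : ℝ → E →L[ℝ] E} {a t₀ : ℝ}

lemma hasDerivAt_integral_of_continuousOn_Ioi [CompleteSpace E] {f : ℝ → E} (hf : ContinuousOn f (Ioi a))
    (h₀ : a < t₀) {t : ℝ} (ht : a < t) :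
    HasDerivAt (fun t => ∫ s in t₀..t, f s) (f t) t := by
  have hsub : uIcc t₀ t ⊆ Ioi a := fun s hs => lt_of_lt_of_le (lt_min h₀ ht) hs.1
  refine intervalIntegral.integral_hasDerivAt_right
    ((hf.mono hsub).intervalIntegrable) ?_ (hf.continuousAt (Ioi_mem_nhds ht))
  exact hf.stronglyMeasurableAtFilter isOpen_Ioi t ht

lemma continuousOn_peanoBaker [CompleteSpace E] (hA : ContinuousOn A (Ioi a)) (h₀ : a < t₀) (x₀ : E) (n : ℕ) :
    ContinuousOn (peanoBaker A t₀ x₀ n) (Ioi a) := by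
  induction n with
  | zero => exact continuousOn_const
  | succ n ih =>
    intro t ht
    exact (hasDerivAt_integral_of_continuousOn_Ioi (hA.clm_apply ih) h₀
      ht).continuousAt.continuousWithinAt

lemma hasDerivAt_peanoBaker_succ [CompleteSpace E] (hA : ContinuousOn A (Ioi a)) (h₀ : a < t₀) (x₀ : E) (n : ℕ)
    {t : ℝ} (ht : a < t) :
    HasDerivAt (peanoBaker A t₀ x₀ (n + 1)) (A t (peanoBaker A t₀ x₀ n t)) t :=
  hasDerivAt_integral_of_continuousOn_Ioi
    (hA.clm_apply (continuousOn_peanoBaker hA h₀ x₀ n)) h₀ ht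

/-- The `n`-fold iterated integral runs over a simplex of volume `|t - t₀| ^ n / n!`, so the series
is dominated by that of an exponential, uniformly on compact intervals. -/
lemma norm_peanoBaker_le {α β K : ℝ} (h₀ : t₀ ∈ Icc α β) (hK : ∀ t ∈ Icc α β, ‖A t‖ ≤ K)
    (x₀ : E) (n : ℕ) {t : ℝ} (ht : t ∈ Icc α β) :
    ‖peanoBaker A t₀ x₀ n t‖ ≤ ‖x₀‖ * ((K * |t - t₀|) ^ n / n.factorial) := by
  have hK0 : 0 ≤ K := (norm_nonneg _).trans (hK t ht)
  induction n generalizing t with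
  | zero => simp [peanoBaker]
  | succ n ih =>
    have hsub : uIoc t₀ t ⊆ Icc α β := fun s hs =>
      uIcc_subset_Icc h₀ ht (uIoc_subset_uIcc hs)
    have hb : ∀ s ∈ uIoc t₀ t, ‖A s (peanoBaker A t₀ x₀ n s)‖ ≤
        (‖x₀‖ * K ^ (n + 1) / n.factorial) * |s - t₀| ^ n := by
      intro s hs
      calc ‖A s (peanoBaker A t₀ x₀ n s)‖ ≤ ‖A s‖ * ‖peanoBaker A t₀ x₀ n s‖ :=
            (A s).le_opNorm _
        _ ≤ K * (‖x₀‖ * ((K * |s - t₀|) ^ n / n.factorial)) :=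
            mul_le_mul (hK s (hsub hs)) (ih (hsub hs)) (norm_nonneg _) hK0
        _ = _ := by rw [mul_pow]; ring
    have := intervalIntegral.norm_integral_le_abs_of_norm_le (a := t₀) (b := t)
      (μ := MeasureTheory.volume)
      (MeasureTheory.ae_restrict_of_forall_mem measurableSet_uIoc hb)
      ((by fun_prop : Continuous fun s : ℝ =>
        (‖x₀‖ * K ^ (n + 1) / n.factorial) * |s - t₀| ^ n).intervalIntegrable _ _)
    refine this.trans (le_of_eq ?_)
    rw [intervalIntegral.integral_const_mul, abs_mul, intervalIntegral.abs_intervalIntegral_eq,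
      integral_pow_abs_sub_uIoc, abs_of_nonneg (by positivity), abs_of_nonneg (by positivity),
      mul_pow, Nat.factorial_succ]
    push_cast
    field_simp

/-- A linear equation with continuous coefficients on a half-line has global solutions. -/
theorem exists_linear_ode_solution [CompleteSpace E] (hA : ContinuousOn A (Ioi a)) (h₀ : a < t₀) (x₀ : E) :
    ∃ x : ℝ → E, x t₀ = x₀ ∧ ∀ t, a < t → HasDerivAt x (A t (x t)) t := by
  -- A compact window inside the half-line that contains both `t` and `t₀` in its interior, so that
  -- a single `K` bounds every iterate near `t`.
  have hbound : ∀ t, a < t → ∃ α β K : ℝ, a < α ∧ t ∈ Ioo α β ∧ t₀ ∈ Ioo α β ∧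
      ∀ s ∈ Icc α β, ‖A s‖ ≤ K := by
    intro t ht
    refine ⟨(a + min t t₀) / 2, max t t₀ + 1, ?_⟩
    have h1 : a < min t t₀ := lt_min ht h₀
    have h2 := min_le_left t t₀
    have h3 := min_le_right t t₀
    have h4 := le_max_left t t₀
    have h5 := le_max_right t t₀
    have hc : ContinuousOn A (Icc ((a + min t t₀) / 2) (max t t₀ + 1)) :=
      hA.mono fun s hs => by have := hs.1; simp only [mem_Ioi]; linarith
    obtain ⟨K, hK⟩ := isCompact_Icc.exists_bound_of_continuousOn hc
    exact ⟨K, by linarith, ⟨by linarith, by linarith⟩, ⟨by linarith, by linarith⟩, hK⟩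
  have hsum : ∀ t, a < t → Summable fun n => peanoBaker A t₀ x₀ n t := by
    intro t ht
    obtain ⟨α, β, K, -, htm, h0m, hK⟩ := hbound t ht
    exact Summable.of_norm_bounded ((Real.summable_pow_div_factorial _).mul_left _)
      fun n => norm_peanoBaker_le (Ioo_subset_Icc_self h0m) hK x₀ n (Ioo_subset_Icc_self htm)
  refine ⟨fun t => ∑' n, peanoBaker A t₀ x₀ n t, ?_, ?_⟩
  · change ∑' n, peanoBaker A t₀ x₀ n t₀ = x₀
    rw [(hsum t₀ h₀).tsum_eq_zero_add]
    simp [peanoBaker]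
  · intro t ht
    obtain ⟨α, β, K, haα, htm, h0m, hK⟩ := hbound t ht
    have hK0 : 0 ≤ K := (norm_nonneg _).trans (hK t (Ioo_subset_Icc_self htm))
    -- The derivative of term `n + 1` is `A` applied to term `n`; the constant term `x₀` is split
    -- off and added back afterwards.
    have hd := hasDerivAt_tsum_of_isPreconnected
      (u := fun n => K * (‖x₀‖ * ((K * (β - α)) ^ n / n.factorial)))
      (g := fun n => peanoBaker A t₀ x₀ (n + 1))
      (g' := fun n s => A s (peanoBaker A t₀ x₀ n s)) (t := Ioo α β) (y₀ := t) (y := t)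
      (((Real.summable_pow_div_factorial _).mul_left _).mul_left _) isOpen_Ioo
      isPreconnected_Ioo
      (fun n s hs => hasDerivAt_peanoBaker_succ hA h₀ x₀ n (haα.trans hs.1))
      (fun n s hs => by
        have hs' := Ioo_subset_Icc_self hs
        have : |s - t₀| ≤ β - α := by
          rw [abs_le]; constructor <;> linarith [hs.1, hs.2, h0m.1, h0m.2]
        calc ‖A s (peanoBaker A t₀ x₀ n s)‖ ≤ ‖A s‖ * ‖peanoBaker A t₀ x₀ n s‖ :=
            (A s).le_opNorm _
          _ ≤ K * (‖x₀‖ * ((K * |s - t₀|) ^ n / n.factorial)) :=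
            mul_le_mul (hK s hs') (norm_peanoBaker_le (Ioo_subset_Icc_self h0m) hK x₀ n hs')
              (norm_nonneg _) hK0
          _ ≤ _ := by gcongr)
      htm ((summable_nat_add_iff 1).2 (hsum t ht)) htm
    have heq : (fun s => ∑' n, peanoBaker A t₀ x₀ n s) =ᶠ[𝓝 t]
        fun s => x₀ + ∑' n, peanoBaker A t₀ x₀ (n + 1) s := by
      filter_upwards [Ioi_mem_nhds ht] with s hs
      rw [(hsum s hs).tsum_eq_zero_add]
      rfl
    have := (hd.const_add x₀).congr_of_eventuallyEq heq
    rwa [← ContinuousLinearMap.map_tsum _ (hsum t ht)] at this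

end PeanoBaker

/-! ### Calculus helpers -/

lemma mul_sub_le_of_le_hasDerivAt {f f' : ℝ → ℝ} {a b c : ℝ} (hab : a ≤ b)
    (hd : ∀ x ∈ Icc a b, HasDerivAt f (f' x) x) (hc : ∀ x ∈ Icc a b, c ≤ f' x) :
    c * (b - a) ≤ f b - f a := by
  rcases hab.eq_or_lt with rfl | hlt
  · simp
  obtain ⟨x, hx, hfx⟩ := exists_hasDerivAt_eq_slope f f' hlt
    (fun x hx => (hd x hx).continuousAt.continuousWithinAt)
    (fun x hx => hd x (Ioo_subset_Icc_self hx))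
  have := hc x (Ioo_subset_Icc_self hx)
  rwa [hfx, le_div_iff₀ (sub_pos.2 hlt)] at this

lemma le_of_hasDerivAt_nonneg {f f' : ℝ → ℝ} {a b : ℝ} (hab : a ≤ b)
    (hd : ∀ x ∈ Icc a b, HasDerivAt f (f' x) x) (hc : ∀ x ∈ Icc a b, 0 ≤ f' x) :
    f a ≤ f b := by
  have := mul_sub_le_of_le_hasDerivAt hab hd hc
  linarith

lemma le_of_hasDerivAt_nonpos {f f' : ℝ → ℝ} {a b : ℝ} (hab : a ≤ b)
    (hd : ∀ x ∈ Icc a b, HasDerivAt f (f' x) x) (hc : ∀ x ∈ Icc a b, f' x ≤ 0) :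
    f b ≤ f a := by
  have := le_of_hasDerivAt_nonneg (f := fun x => -f x) hab (fun x hx => (hd x hx).neg)
    (fun x hx => neg_nonneg.2 (hc x hx))
  linarith

lemma HasDerivAt.complex_re {f : ℝ → ℂ} {f' : ℂ} {x : ℝ} (h : HasDerivAt f f' x) :
    HasDerivAt (fun t => (f t).re) f'.re x :=
  Complex.reCLM.hasFDerivAt.comp_hasDerivAt x h

lemma HasDerivAt.complex_im {f : ℝ → ℂ} {f' : ℂ} {x : ℝ} (h : HasDerivAt f f' x) :
    HasDerivAt (fun t => (f t).im) f'.im x :=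
  Complex.imCLM.hasFDerivAt.comp_hasDerivAt x h

lemma HasDerivAt.complex_conj {f : ℝ → ℂ} {f' : ℂ} {x : ℝ} (h : HasDerivAt f f' x) :
    HasDerivAt (fun t => (starRingEnd ℂ) (f t)) ((starRingEnd ℂ) f') x := h.star

lemma HasDerivAt.complex_normSq {f : ℝ → ℂ} {f' : ℂ} {x : ℝ} (h : HasDerivAt f f' x) :
    HasDerivAt (fun t => Complex.normSq (f t)) (2 * ((starRingEnd ℂ) (f x) * f').re) x := by
  have h1 := (h.complex_re.mul h.complex_re).add (h.complex_im.mul h.complex_im)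
  refine (h1.congr_deriv ?_).congr_of_eventuallyEq (Eventually.of_forall fun t => ?_)
  · simp [Complex.mul_re]; ring
  · simp [Complex.normSq_apply]

/-! ### Radial equations -/

/-- `(u, v)` solves the first order system `p u' = v`, `p v' = V u` equivalent to the radial
equation `p (p u')' = V u`. -/
structure IsRadialSol (p : ℝ → ℝ) (V : ℝ → ℂ) (S : Set ℝ) (u v : ℝ → ℂ) : Prop where
  fst : ∀ r ∈ S, HasDerivAt u (v r / p r) r
  snd : ∀ r ∈ S, HasDerivAt v (V r * u r / p r) r

/-- The complex flux `ū p u'` of a solution. -/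
noncomputable def flux (u v : ℝ → ℂ) (r : ℝ) : ℂ := (starRingEnd ℂ) (u r) * v r

namespace IsRadialSol

variable {p : ℝ → ℝ} {V : ℝ → ℂ} {S T : Set ℝ} {u v u₁ v₁ u₂ v₂ : ℝ → ℂ} {a b : ℝ}

lemma mono (h : IsRadialSol p V S u v) (hT : T ⊆ S) : IsRadialSol p V T u v :=
  ⟨fun r hr => h.fst r (hT hr), fun r hr => h.snd r (hT hr)⟩

lemma comb (h₁ : IsRadialSol p V S u₁ v₁) (h₂ : IsRadialSol p V S u₂ v₂) (c₁ c₂ : ℂ) :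
    IsRadialSol p V S (fun r => c₁ * u₁ r + c₂ * u₂ r) (fun r => c₁ * v₁ r + c₂ * v₂ r) :=
  ⟨fun r hr => (((h₁.fst r hr).const_mul c₁).add ((h₂.fst r hr).const_mul c₂)).congr_deriv
      (by ring),
    fun r hr => (((h₁.snd r hr).const_mul c₁).add ((h₂.snd r hr).const_mul c₂)).congr_deriv
      (by ring)⟩

lemma continuousOn_fst (h : IsRadialSol p V S u v) : ContinuousOn u S :=
  fun r hr => (h.fst r hr).continuousAt.continuousWithinAt

/-- Reflection `r ↦ -r` of the radial coordinate. -/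
lemma reflect (h : IsRadialSol p V S u v) :
    IsRadialSol (fun r => p (-r)) (fun r => V (-r)) (Neg.neg ⁻¹' S) (fun r => u (-r))
      (fun r => -v (-r)) := by
  constructor
  · intro r hr
    refine ((h.fst (-r) hr).scomp r (hasDerivAt_neg r)).congr_deriv ?_
    simp [neg_div]
  · intro r hr
    refine ((h.snd (-r) hr).scomp r (hasDerivAt_neg r)).neg.congr_deriv ?_
    simp

lemma hasDerivAt_wronskian (h₁ : IsRadialSol p V S u₁ v₁) (h₂ : IsRadialSol p V S u₂ v₂) {r : ℝ}
    (hr : r ∈ S) : HasDerivAt (fun r => u₁ r * v₂ r - u₂ r * v₁ r) 0 r :=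
  (((h₁.fst r hr).mul (h₂.snd r hr)).sub ((h₂.fst r hr).mul (h₁.snd r hr))).congr_deriv
    (by ring)

lemma wronskian_const (h₁ : IsRadialSol p V S u₁ v₁) (h₂ : IsRadialSol p V S u₂ v₂)
    (hS : IsOpen S) (hS' : IsPreconnected S) {r s : ℝ} (hr : r ∈ S) (hs : s ∈ S) :
    u₁ r * v₂ r - u₂ r * v₁ r = u₁ s * v₂ s - u₂ s * v₁ s :=
  hS.is_const_of_deriv_eq_zero (f := fun r => u₁ r * v₂ r - u₂ r * v₁ r) hS'
    (fun _ hx => (h₁.hasDerivAt_wronskian h₂ hx).differentiableAt.differentiableWithinAt)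
    (fun _ hx => (h₁.hasDerivAt_wronskian h₂ hx).deriv) hr hs

lemma hasDerivAt_normSq (h : IsRadialSol p V S u v) {r : ℝ} (hr : r ∈ S) :
    HasDerivAt (fun r => Complex.normSq (u r)) (2 * (flux u v r).re / p r) r := by
  refine (h.fst r hr).complex_normSq.congr_deriv ?_
  rw [← mul_div_assoc, Complex.div_ofReal_re, flux]
  ring

/-- The identity behind all monotonicity arguments: `p (ū v)' = |v|² + V |u|²`, so sign conditions
on `V` become monotonicity of the flux. -/
lemma hasDerivAt_flux (h : IsRadialSol p V S u v) {r : ℝ} (hr : r ∈ S) :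
    HasDerivAt (flux u v)
      ((Complex.normSq (v r) + V r * Complex.normSq (u r)) / p r) r := by
  refine ((h.fst r hr).complex_conj.mul (h.snd r hr)).congr_deriv ?_
  rw [Complex.normSq_eq_conj_mul_self, Complex.normSq_eq_conj_mul_self]
  simp only [map_div₀, Complex.conj_ofReal]
  ring

lemma hasDerivAt_re_mul_flux (h : IsRadialSol p V S u v) (c : ℂ) {r : ℝ} (hr : r ∈ S) :
    HasDerivAt (fun r => (c * flux u v r).re)
      ((c.re * Complex.normSq (v r) + (c * V r).re * Complex.normSq (u r)) / p r) r := by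
  refine ((h.hasDerivAt_flux hr).const_mul c).complex_re.congr_deriv ?_
  rw [← mul_div_assoc, Complex.div_ofReal_re]
  simp [Complex.mul_re]
  ring

/-- The flux in direction `c` is monotone where `c V` has non-negative real part. -/
lemma re_mul_flux_le (h : IsRadialSol p V S u v) {c : ℂ} (hc : 0 ≤ c.re) {r s : ℝ} (hrs : r ≤ s)
    (hS : Icc r s ⊆ S) (hp : ∀ x ∈ Icc r s, 0 < p x) (hV : ∀ x ∈ Icc r s, 0 ≤ (c * V x).re) :
    (c * flux u v r).re ≤ (c * flux u v s).re :=
  le_of_hasDerivAt_nonneg (f := fun r => (c * flux u v r).re) hrs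
    (fun x hx => h.hasDerivAt_re_mul_flux c (hS hx))
    (fun x hx => div_nonneg (add_nonneg (mul_nonneg hc (Complex.normSq_nonneg _))
      (mul_nonneg (hV x hx) (Complex.normSq_nonneg _))) (hp x hx).le)

lemma re_flux_le (h : IsRadialSol p V S u v) {r s : ℝ} (hrs : r ≤ s)
    (hS : Icc r s ⊆ S) (hp : ∀ x ∈ Icc r s, 0 < p x) (hV : ∀ x ∈ Icc r s, 0 ≤ (V x).re) :
    (flux u v r).re ≤ (flux u v s).re := by
  have := h.re_mul_flux_le (c := 1) (by simp) hrs hS hp (by simpa using hV)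
  simpa using this

/-- Since `p (|u|²)' = 2 Re (ū v)`, the sign of the real flux decides whether the modulus grows or
decays. -/
lemma normSq_le (h : IsRadialSol p V S u v) {r s : ℝ} (hrs : r ≤ s)
    (hS : Icc r s ⊆ S) (hp : ∀ x ∈ Icc r s, 0 < p x)
    (hj : ∀ x ∈ Icc r s, 0 ≤ (flux u v x).re) :
    Complex.normSq (u r) ≤ Complex.normSq (u s) :=
  le_of_hasDerivAt_nonneg (f := fun r => Complex.normSq (u r)) hrs
    (fun _ hx => h.hasDerivAt_normSq (hS hx))
    (fun x hx => div_nonneg (mul_nonneg zero_le_two (hj x hx)) (hp x hx).le)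

lemma normSq_ge (h : IsRadialSol p V S u v) {r s : ℝ} (hrs : r ≤ s)
    (hS : Icc r s ⊆ S) (hp : ∀ x ∈ Icc r s, 0 < p x)
    (hj : ∀ x ∈ Icc r s, (flux u v x).re ≤ 0) :
    Complex.normSq (u s) ≤ Complex.normSq (u r) :=
  le_of_hasDerivAt_nonpos (f := fun r => Complex.normSq (u r)) hrs
    (fun _ hx => h.hasDerivAt_normSq (hS hx))
    (fun x hx => div_nonpos_of_nonpos_of_nonneg
      (mul_nonpos_of_nonneg_of_nonpos zero_le_two (hj x hx)) (hp x hx).le)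

end IsRadialSol

/-! ### Fundamental systems of the radial equation -/

/-- A radial equation with continuous coefficients on a half-line has solutions with arbitrary
initial values. -/
lemma exists_isRadialSol {p : ℝ → ℝ} {V : ℝ → ℂ} {a r₀ : ℝ} (hp : ContinuousOn p (Ioi a))
    (hp0 : ∀ r ∈ Ioi a, 0 < p r) (hV : ContinuousOn V (Ioi a)) (h₀ : a < r₀) (x y : ℂ) :
    ∃ u v, IsRadialSol p V (Ioi a) u v ∧ u r₀ = x ∧ v r₀ = y := by
  let L₁ : ℂ × ℂ →L[ℝ] ℂ × ℂ :=
    (ContinuousLinearMap.inl ℝ ℂ ℂ).comp (ContinuousLinearMap.snd ℝ ℂ ℂ)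
  let L₂ : ℂ → (ℂ × ℂ →L[ℝ] ℂ × ℂ) := fun z => (ContinuousLinearMap.inr ℝ ℂ ℂ).comp
    ((ContinuousLinearMap.mul ℝ ℂ z).comp (ContinuousLinearMap.fst ℝ ℂ ℂ))
  let A : ℝ → (ℂ × ℂ →L[ℝ] ℂ × ℂ) := fun r => (p r)⁻¹ • L₁ + L₂ (V r / p r)
  have hpi : ContinuousOn (fun r => (p r)⁻¹) (Ioi a) := hp.inv₀ fun r hr => (hp0 r hr).ne'
  have hq : ContinuousOn (fun r => V r / (p r : ℂ)) (Ioi a) :=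
    hV.div (Complex.continuous_ofReal.comp_continuousOn hp)
      fun r hr => Complex.ofReal_ne_zero.2 (hp0 r hr).ne'
  have hL₂ : Continuous L₂ := by
    refine continuous_const.clm_comp (Continuous.clm_comp ?_ continuous_const)
    exact (ContinuousLinearMap.mul ℝ ℂ).continuous
  have hA : ContinuousOn A (Ioi a) :=
    (hpi.smul continuousOn_const).add (hL₂.comp_continuousOn hq)
  obtain ⟨f, hf0, hf⟩ := exists_linear_ode_solution hA h₀ (x, y)
  have hAf : ∀ r, A r (f r) = ((f r).2 / p r, V r * (f r).1 / p r) := by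
    intro r
    ext <;> simp [A, L₁, L₂] <;> ring
  refine ⟨fun r => (f r).1, fun r => (f r).2, ⟨fun r hr => ?_, fun r hr => ?_⟩, by simp [hf0],
    by simp [hf0]⟩
  · have := (ContinuousLinearMap.fst ℝ ℂ ℂ).hasFDerivAt.comp_hasDerivAt r (hf r hr)
    rw [hAf] at this
    exact this
  · have := (ContinuousLinearMap.snd ℝ ℂ ℂ).hasFDerivAt.comp_hasDerivAt r (hf r hr)
    rw [hAf] at this
    exact this

/-- A fundamental system of solutions with unit Wronskian. -/
structure IsFundamental (p : ℝ → ℝ) (V : ℝ → ℂ) (a : ℝ) (u₁ v₁ u₂ v₂ : ℝ → ℂ) : Prop where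
  sol₁ : IsRadialSol p V (Ioi a) u₁ v₁
  sol₂ : IsRadialSol p V (Ioi a) u₂ v₂
  wronskian : ∀ r ∈ Ioi a, u₁ r * v₂ r - u₂ r * v₁ r = 1

lemma exists_isFundamental {p : ℝ → ℝ} {V : ℝ → ℂ} {a : ℝ} (hp : ContinuousOn p (Ioi a))
    (hp0 : ∀ r ∈ Ioi a, 0 < p r) (hV : ContinuousOn V (Ioi a)) :
    ∃ u₁ v₁ u₂ v₂, IsFundamental p V a u₁ v₁ u₂ v₂ := by
  have h₀ : a < a + 1 := by linarith
  obtain ⟨u₁, v₁, h₁, hu₁, hv₁⟩ := exists_isRadialSol hp hp0 hV h₀ 1 0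
  obtain ⟨u₂, v₂, h₂, hu₂, hv₂⟩ := exists_isRadialSol hp hp0 hV h₀ 0 1
  refine ⟨u₁, v₁, u₂, v₂, h₁, h₂, fun r hr => ?_⟩
  rw [h₁.wronskian_const h₂ isOpen_Ioi isPreconnected_Ioi hr (mem_Ioi.2 h₀), hu₁, hv₁, hu₂, hv₂]
  simp

namespace IsFundamental

variable {p : ℝ → ℝ} {V : ℝ → ℂ} {a : ℝ} {u v u₁ v₁ u₂ v₂ : ℝ → ℂ} {T : Set ℝ}

/-- Cramer's rule: a state `(x, y)` at `r` is expanded in the fundamental states, the Wronskian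
being the determinant. -/
lemma fst_eq (H : IsFundamental p V a u₁ v₁ u₂ v₂) {r : ℝ} (hr : r ∈ Ioi a) (x y : ℂ) :
    x = (x * v₂ r - u₂ r * y) * u₁ r + (u₁ r * y - x * v₁ r) * u₂ r := by
  linear_combination (-x) * H.wronskian r hr

lemma snd_eq (H : IsFundamental p V a u₁ v₁ u₂ v₂) {r : ℝ} (hr : r ∈ Ioi a) (x y : ℂ) :
    y = (x * v₂ r - u₂ r * y) * v₁ r + (u₁ r * y - x * v₁ r) * v₂ r := by
  linear_combination (-y) * H.wronskian r hr

/-- Every solution on an open interval is a combination of the fundamental solutions. -/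
lemma exists_comb (H : IsFundamental p V a u₁ v₁ u₂ v₂) (hT : IsOpen T) (hT' : IsPreconnected T)
    (hTa : T ⊆ Ioi a) (h : IsRadialSol p V T u v) :
    ∃ c₁ c₂ : ℂ, ∀ r ∈ T, u r = c₁ * u₁ r + c₂ * u₂ r ∧ v r = c₁ * v₁ r + c₂ * v₂ r := by
  rcases T.eq_empty_or_nonempty with rfl | ⟨s, hs⟩
  · exact ⟨0, 0, by simp⟩
  -- The coefficients are the Wronskians with the two fundamental solutions. They are constant on
  -- `T`, so their values at `s` serve at every point.
  refine ⟨u s * v₂ s - u₂ s * v s, u₁ s * v s - u s * v₁ s, fun r hr => ?_⟩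
  rw [← h.wronskian_const (H.sol₂.mono hTa) hT hT' hr hs,
    ← (H.sol₁.mono hTa).wronskian_const h hT hT' hr hs]
  exact ⟨H.fst_eq (hTa hr) _ _, H.snd_eq (hTa hr) _ _⟩

end IsFundamental

/-- A solution that vanishes together with its derivative at one point vanishes. -/
lemma IsRadialSol.eq_zero {p : ℝ → ℝ} {V : ℝ → ℂ} {a s : ℝ} {u v : ℝ → ℂ}
    (hp : ContinuousOn p (Ioi a)) (hp0 : ∀ r ∈ Ioi a, 0 < p r) (hV : ContinuousOn V (Ioi a))
    (h : IsRadialSol p V (Ioi a) u v) (hs : a < s) (hu : u s = 0) (hv : v s = 0) {r : ℝ}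
    (hr : a < r) : u r = 0 ∧ v r = 0 := by
  obtain ⟨u₁, v₁, u₂, v₂, H⟩ := exists_isFundamental hp hp0 hV
  have e₁ := h.wronskian_const H.sol₂ isOpen_Ioi isPreconnected_Ioi (mem_Ioi.2 hr) (mem_Ioi.2 hs)
  have e₂ := H.sol₁.wronskian_const h isOpen_Ioi isPreconnected_Ioi (mem_Ioi.2 hr) (mem_Ioi.2 hs)
  simp only [hu, hv, mul_zero, zero_mul, sub_zero] at e₁ e₂
  constructor
  · rw [H.fst_eq (mem_Ioi.2 hr) (u r) (v r), e₁, e₂]; simp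
  · rw [H.snd_eq (mem_Ioi.2 hr) (u r) (v r), e₁, e₂]; simp

/-- Regularity of the coefficients of a radial equation on a half-line. -/
structure IsRadialEq (p : ℝ → ℝ) (V : ℝ → ℂ) (a : ℝ) : Prop where
  continuousOn_coeff : ContinuousOn p (Ioi a)
  coeff_pos : ∀ r ∈ Ioi a, 0 < p r
  continuousOn_potential : ContinuousOn V (Ioi a)

/-- A solution that does not vanish identically. -/
def IsNontrivial (a : ℝ) (u v : ℝ → ℂ) : Prop := ∀ r ∈ Ioi a, ¬(u r = 0 ∧ v r = 0)

/-! ### Solutions as limits of solutions of boundary value problems -/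

/-- Compactness of the unit sphere of `ℂ × ℂ`, the space of normalised coefficient vectors: a closed
condition that holds eventually along the sequence holds at a limit point, and the limit is still
nonzero. -/
lemma exists_norm_eq_one_of_eventually {K : ℝ → Set (ℂ × ℂ)} {T : Set ℝ}
    (hK : ∀ r ∈ T, IsClosed (K r)) {c : ℕ → ℂ × ℂ} (hc : ∀ i, ‖c i‖ = 1)
    (h : ∀ r ∈ T, ∀ᶠ i in atTop, c i ∈ K r) :
    ∃ c : ℂ × ℂ, ‖c‖ = 1 ∧ ∀ r ∈ T, c ∈ K r := by
  obtain ⟨d, hd, φ, hφ, hlim⟩ := (isCompact_sphere (0 : ℂ × ℂ) 1).tendsto_subseq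
    (x := c) (fun i => by simp [hc i])
  refine ⟨d, by simpa using hd, fun r hr => ?_⟩
  exact (hK r hr).mem_of_tendsto hlim (hφ.tendsto_atTop.eventually (h r hr))

lemma IsFundamental.isNontrivial_comb {p : ℝ → ℝ} {V : ℝ → ℂ} {a : ℝ} {u₁ v₁ u₂ v₂ : ℝ → ℂ}
    (H : IsFundamental p V a u₁ v₁ u₂ v₂) {c₁ c₂ : ℂ} (hc : ¬(c₁ = 0 ∧ c₂ = 0)) :
    IsNontrivial a (fun r => c₁ * u₁ r + c₂ * u₂ r) (fun r => c₁ * v₁ r + c₂ * v₂ r) := by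
  rintro r hr ⟨hu, hv⟩
  refine hc ⟨?_, ?_⟩
  · linear_combination (-c₁) * H.wronskian r hr + v₂ r * hu - u₂ r * hv
  · linear_combination (-c₂) * H.wronskian r hr - v₁ r * hu + u₁ r * hv

/-- If Neumann conditions at the points `x i` force, for large `i`, a sign of the flux in direction
`e` at every point of `T`, then some non-trivial solution has that sign on `T`. -/
lemma exists_sol_flux_nonneg {p : ℝ → ℝ} {V : ℝ → ℂ} {a : ℝ} (E : IsRadialEq p V a) {T : Set ℝ}
    {e : ℂ} {x : ℕ → ℝ} (hx : ∀ i, a < x i)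
    (h : ∀ r ∈ T, ∀ᶠ i in atTop, ∀ u v, IsRadialSol p V (Ioi a) u v → v (x i) = 0 →
      0 ≤ (e * flux u v r).re) :
    ∃ u v, IsRadialSol p V (Ioi a) u v ∧ IsNontrivial a u v ∧
      ∀ r ∈ T, 0 ≤ (e * flux u v r).re := by
  obtain ⟨u₁, v₁, u₂, v₂, H⟩ := exists_isFundamental E.continuousOn_coeff E.coeff_pos
    E.continuousOn_potential
  -- Coefficients of the solution whose `v` vanishes at `x i`. They are not both zero, since the
  -- Wronskian is `1` there.
  let w : ℕ → ℂ × ℂ := fun i => (v₂ (x i), -v₁ (x i))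
  have hw : ∀ i, w i ≠ 0 := by
    intro i hi
    have h1 : v₂ (x i) = 0 := congrArg Prod.fst hi
    have h2 : v₁ (x i) = 0 := neg_eq_zero.1 (congrArg Prod.snd hi)
    have := H.wronskian (x i) (hx i)
    simp [h1, h2] at this
  let c : ℕ → ℂ × ℂ := fun i => ((‖w i‖⁻¹ : ℝ) : ℂ) • w i
  have hc : ∀ i, ‖c i‖ = 1 := by
    intro i
    have : ‖w i‖ ≠ 0 := norm_ne_zero_iff.2 (hw i)
    simp only [c, norm_smul, Complex.norm_real, norm_inv, norm_norm]
    exact inv_mul_cancel₀ this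
  let U : ℂ × ℂ → ℝ → ℂ := fun c r => c.1 * u₁ r + c.2 * u₂ r
  let W : ℂ × ℂ → ℝ → ℂ := fun c r => c.1 * v₁ r + c.2 * v₂ r
  obtain ⟨d, hd, hdK⟩ := exists_norm_eq_one_of_eventually
    (K := fun r => {c | 0 ≤ (e * flux (U c) (W c) r).re}) (T := T) (fun r _ => by
      refine isClosed_le continuous_const (Complex.continuous_re.comp ?_)
      simp only [flux, U, W]
      refine continuous_const.mul ((Complex.continuous_conj.comp ?_).mul ?_) <;> fun_prop) hc
    (fun r hr => by
      filter_upwards [h r hr] with i hi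
      refine hi _ _ (H.sol₁.comb H.sol₂ _ _) ?_
      simp only [c, w, Prod.smul_mk, smul_eq_mul]
      ring)
  refine ⟨U d, W d, H.sol₁.comb H.sol₂ _ _, H.isNontrivial_comb ?_, hdK⟩
  rintro ⟨h1, h2⟩
  have : d = 0 := Prod.ext h1 h2
  simp [this] at hd

/-- A solution which is regular at the left end point: its modulus is non-decreasing. -/
lemma exists_sol_re_flux_nonneg {p : ℝ → ℝ} {V : ℝ → ℂ} {a b : ℝ} (E : IsRadialEq p V a)
    (hab : a < b) (hV : ∀ r ∈ Ioc a b, 0 ≤ (V r).re) :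
    ∃ u v, IsRadialSol p V (Ioi a) u v ∧ IsNontrivial a u v ∧
      ∀ r ∈ Ioc a b, 0 ≤ (flux u v r).re := by
  have hpos : ∀ i : ℕ, 0 < (b - a) / (i + 1 : ℝ) := fun i => div_pos (sub_pos.2 hab) (by positivity)
  -- The Neumann points tend to `a`. The flux vanishes at such a point and is non-decreasing, hence
  -- it is non-negative to the right of it.
  obtain ⟨u, v, h, h0, hj⟩ := exists_sol_flux_nonneg E (T := Ioc a b) (e := 1)
    (x := fun i : ℕ => a + (b - a) / (i + 1 : ℝ)) (fun i => by linarith [hpos i]) (by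
      intro r hr
      have hlim : Tendsto (fun i : ℕ => a + (b - a) / (i + 1 : ℝ)) atTop (𝓝 (a + 0)) :=
        tendsto_const_nhds.add (tendsto_const_nhds.div_atTop
          (tendsto_atTop_add_const_right _ _ tendsto_natCast_atTop_atTop))
      rw [add_zero] at hlim
      filter_upwards [hlim.eventually (gt_mem_nhds hr.1)] with i hi u v hs hv
      have hsub : Icc (a + (b - a) / (i + 1 : ℝ)) r ⊆ Ioc a b := fun s hs =>
        ⟨by linarith [hs.1, hpos i], hs.2.trans hr.2⟩
      have := hs.re_flux_le hi.le (fun s hs => (hsub hs).1)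
        (fun s hs => E.coeff_pos s (hsub hs).1) (fun s hs => hV s (hsub hs))
      rw [one_mul]
      refine le_trans (le_of_eq ?_) this
      simp [flux, hv])
  exact ⟨u, v, h, h0, by simpa using hj⟩

/-- The integral of `1 / p` diverges at the left end point. -/
def DivergesAt (p : ℝ → ℝ) (a : ℝ) : Prop :=
  ∃ (ψ ψ' : ℝ → ℝ) (b : ℝ), a < b ∧ (∀ r ∈ Ioc a b, HasDerivAt ψ (ψ' r) r ∧ ψ' r ≤ 1 / p r) ∧
    Tendsto ψ (𝓝[>] a) atBot

/-- Comparison of primitives: `g - c ψ` is non-decreasing near `a`, so `g` lies below `c ψ` plus a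
constant. -/
lemma DivergesAt.tendsto_atBot {p : ℝ → ℝ} {a b c : ℝ} (hp : DivergesAt p a) (hab : a < b)
    (hc : 0 < c) {g g' : ℝ → ℝ} (hg : ∀ r ∈ Ioc a b, HasDerivAt g (g' r) r)
    (hg' : ∀ r ∈ Ioc a b, c / p r ≤ g' r) : Tendsto g (𝓝[>] a) atBot := by
  obtain ⟨ψ, ψ', b', hab', hψ, hlim⟩ := hp
  set d := min b b'
  have hd : a < d := lt_min hab hab'
  refine tendsto_atBot_mono' _ ?_
    (tendsto_atBot_add_const_right _ (g d - c * ψ d) (hlim.const_mul_atBot hc))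
  filter_upwards [Ioc_mem_nhdsGT hd] with r hr
  have hsub : ∀ s ∈ Icc r d, s ∈ Ioc a b ∧ s ∈ Ioc a b' := fun s hs =>
    ⟨⟨hr.1.trans_le hs.1, hs.2.trans (min_le_left _ _)⟩,
      ⟨hr.1.trans_le hs.1, hs.2.trans (min_le_right _ _)⟩⟩
  have := le_of_hasDerivAt_nonneg (f := fun s => g s - c * ψ s) hr.2
    (fun s hs => (hg s (hsub s hs).1).sub ((hψ s (hsub s hs).2).1.const_mul c))
    (fun s hs => by
      have h1 := hg' s (hsub s hs).1
      have h2 := mul_le_mul_of_nonneg_left (hψ s (hsub s hs).2).2 hc.le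
      rw [mul_one_div] at h2
      linarith)
  linarith

/-- A solution that is bounded at the left end point has non-decreasing modulus. -/
lemma IsRadialSol.re_flux_nonneg_of_bounded {p : ℝ → ℝ} {V : ℝ → ℂ} {a b : ℝ} {u v : ℝ → ℂ}
    (h : IsRadialSol p V (Ioi a) u v) (hp0 : ∀ r ∈ Ioi a, 0 < p r) (hp : DivergesAt p a)
    (hV : ∀ r ∈ Ioc a b, 0 ≤ (V r).re) {C : ℝ} (hC : ∀ᶠ r in 𝓝[>] a, ‖u r‖ ≤ C) :
    ∀ r ∈ Ioc a b, 0 ≤ (flux u v r).re := by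
  intro s hs
  by_contra! hneg
  -- By monotonicity a negative real flux at `s` stays at least as negative to the left of `s`. Then
  -- `|u|²` increases towards `a` at a rate of at least a constant over `p` and cannot stay bounded.
  have hlim := hp.tendsto_atBot (g := fun r => -Complex.normSq (u r))
    (c := -(2 * (flux u v s).re)) hs.1 (by linarith)
    (fun r hr => (h.hasDerivAt_normSq hr.1).neg) (fun r hr => by
      rw [← neg_div]
      refine div_le_div_of_nonneg_right ?_ (hp0 r hr.1).le
      have := h.re_flux_le hr.2 (fun x hx => hr.1.trans_le hx.1)
        (fun x hx => hp0 x (hr.1.trans_le hx.1))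
        (fun x hx => hV x ⟨hr.1.trans_le hx.1, hx.2.trans hs.2⟩)
      linarith)
  obtain ⟨r, h1, h2⟩ := ((hlim.eventually (eventually_lt_atBot (-C ^ 2))).and hC).exists
  rw [Complex.normSq_eq_norm_sq] at h1
  nlinarith [norm_nonneg (u r)]

/-! ### Local asymptotics of logarithmic derivatives -/

/-- On `[α, β]` the potential `V` and its first two derivatives `V₁`, `V₂` with respect to `p d/dr`
are of order `lam ^ 2`, and the real part of `V` is bounded below by `c * lam ^ 2`. -/
structure PotentialBounds (p : ℝ → ℝ) (V V₁ V₂ : ℝ → ℂ) (α β c C lam : ℝ) : Prop where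
  deriv₁ : ∀ r ∈ Icc α β, HasDerivAt V (V₁ r / p r) r
  deriv₂ : ∀ r ∈ Icc α β, HasDerivAt V₁ (V₂ r / p r) r
  lower : ∀ r ∈ Icc α β, c * lam ^ 2 ≤ (V r).re
  upper : ∀ r ∈ Icc α β, ‖V r‖ ≤ C * lam ^ 2
  upper₁ : ∀ r ∈ Icc α β, ‖V₁ r‖ ≤ C * lam ^ 2
  upper₂ : ∀ r ∈ Icc α β, ‖V₂ r‖ ≤ C * lam ^ 2

lemma PotentialBounds.mono {p : ℝ → ℝ} {V V₁ V₂ : ℝ → ℂ} {α β α' β' c C lam : ℝ}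
    (h : PotentialBounds p V V₁ V₂ α β c C lam) (hs : Icc α' β' ⊆ Icc α β) :
    PotentialBounds p V V₁ V₂ α' β' c C lam :=
  ⟨fun r hr => h.deriv₁ r (hs hr), fun r hr => h.deriv₂ r (hs hr), fun r hr => h.lower r (hs hr),
    fun r hr => h.upper r (hs hr), fun r hr => h.upper₁ r (hs hr), fun r hr => h.upper₂ r (hs hr)⟩

lemma PotentialBounds.reflect {p : ℝ → ℝ} {V V₁ V₂ : ℝ → ℂ} {α β c C lam : ℝ}
    (h : PotentialBounds p V V₁ V₂ α β c C lam) :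
    PotentialBounds (fun r => p (-r)) (fun r => V (-r)) (fun r => -V₁ (-r)) (fun r => V₂ (-r))
      (-β) (-α) c C lam := by
  have hm : ∀ r ∈ Icc (-β) (-α), -r ∈ Icc α β := fun r hr =>
    ⟨by linarith [hr.2], by linarith [hr.1]⟩
  refine ⟨fun r hr => ?_, fun r hr => ?_, fun r hr => h.lower _ (hm r hr),
    fun r hr => h.upper _ (hm r hr), fun r hr => ?_, fun r hr => h.upper₂ _ (hm r hr)⟩
  · refine ((h.deriv₁ _ (hm r hr)).scomp r (hasDerivAt_neg r)).congr_deriv ?_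
    simp [neg_div]
  · refine ((h.deriv₂ _ (hm r hr)).scomp r (hasDerivAt_neg r)).neg.congr_deriv ?_
    simp
  · rw [norm_neg]; exact h.upper₁ _ (hm r hr)

lemma IsRadialSol.norm_fst_le {p : ℝ → ℝ} {V : ℝ → ℂ} {S : Set ℝ} {u v : ℝ → ℂ}
    (h : IsRadialSol p V S u v) {r s : ℝ} (hrs : r ≤ s)
    (hS : Icc r s ⊆ S) (hp : ∀ x ∈ Icc r s, 0 < p x)
    (hj : ∀ x ∈ Icc r s, 0 ≤ (flux u v x).re) : ‖u r‖ ≤ ‖u s‖ := by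
  have := h.normSq_le hrs hS hp hj
  rw [Complex.normSq_eq_norm_sq, Complex.normSq_eq_norm_sq] at this
  exact (sq_le_sq₀ (norm_nonneg _) (norm_nonneg _)).1 this

/-- A solution of non-decreasing modulus has logarithmic derivative `O(lam)`. -/
lemma IsRadialSol.norm_snd_le {p : ℝ → ℝ} {V : ℝ → ℂ} {u v : ℝ → ℂ} {α β P₁ P₂ C lam : ℝ}
    (hP₁ : 0 < P₁) (hp : ∀ r ∈ Icc α β, P₁ ≤ p r ∧ p r ≤ P₂)
    (h : IsRadialSol p V (Icc α β) u v) (hV : ∀ r ∈ Icc α β, ‖V r‖ ≤ C * lam ^ 2)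
    (hj : ∀ r ∈ Icc α β, 0 ≤ (flux u v r).re) (hlam : 0 < lam) {r₀ : ℝ}
    (hr₀ : r₀ ∈ Icc (α + 1 / lam) β) : ‖v r₀‖ ≤ (C / P₁ + 2 * P₂) * lam * ‖u r₀‖ := by
  have hl : 0 < 1 / lam := by positivity
  have hsub : Icc (r₀ - 1 / lam) r₀ ⊆ Icc α β :=
    Icc_subset_Icc (by linarith [hr₀.1]) hr₀.2
  have hr₀m : r₀ ∈ Icc α β := hsub ⟨by linarith, le_rfl⟩
  have hC : 0 ≤ C := by
    have := (norm_nonneg _).trans (hV r₀ hr₀m)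
    by_contra! hC
    nlinarith [pow_pos hlam 2]
  have hP₂ : 0 < P₂ := hP₁.trans_le ((hp r₀ hr₀m).1.trans (hp r₀ hr₀m).2)
  have hu : ∀ s ∈ Icc (r₀ - 1 / lam) r₀, ‖u s‖ ≤ ‖u r₀‖ := fun s hs =>
    h.norm_fst_le hs.2 (fun x hx => hsub ⟨hs.1.trans hx.1, hx.2⟩)
      (fun x hx => hP₁.trans_le (hp x (hsub ⟨hs.1.trans hx.1, hx.2⟩)).1)
      (fun x hx => hj x (hsub ⟨hs.1.trans hx.1, hx.2⟩))
  -- On the window of length `1 / lam` before `r₀` the modulus of `u` is at most `‖u r₀‖`, so `K`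
  -- bounds the variation of `v` there. If `‖v r₀‖` much exceeded `K`, then `u` would have to move
  -- by more than `2 ‖u r₀‖` across the window.
  set K := C / P₁ * lam * ‖u r₀‖ with hK
  have hv : ∀ s ∈ Icc (r₀ - 1 / lam) r₀, ‖v s - v r₀‖ ≤ K := by
    intro s hs
    have := (convex_Icc (r₀ - 1 / lam) r₀).norm_image_sub_le_of_norm_hasDerivWithin_le
      (f := v) (C := C * lam ^ 2 * ‖u r₀‖ / P₁)
      (fun x hx => (h.snd x (hsub hx)).hasDerivWithinAt)
      (fun x hx => by
        rw [norm_div, norm_mul, Complex.norm_real, Real.norm_eq_abs,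
          abs_of_pos (hP₁.trans_le (hp x (hsub hx)).1)]
        exact div_le_div₀ (by positivity) (mul_le_mul (hV x (hsub hx)) (hu x hx)
          (norm_nonneg _) (by positivity)) hP₁ (hp x (hsub hx)).1)
      (⟨by linarith, le_rfl⟩ : r₀ ∈ Icc (r₀ - 1 / lam) r₀) hs
    refine this.trans ?_
    have h1 : ‖s - r₀‖ ≤ 1 / lam := by
      rw [Real.norm_eq_abs, abs_le]; constructor <;> linarith [hs.1, hs.2]
    calc C * lam ^ 2 * ‖u r₀‖ / P₁ * ‖s - r₀‖ ≤ C * lam ^ 2 * ‖u r₀‖ / P₁ * (1 / lam) := by gcongr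
      _ = K := by rw [hK]; field_simp
  rcases le_or_gt ‖v r₀‖ K with hle | hgt
  · refine hle.trans ?_
    rw [hK]
    have : 0 ≤ 2 * P₂ * lam * ‖u r₀‖ := by positivity
    nlinarith
  have hK0 : 0 ≤ K := by positivity
  have hv0 : 0 < ‖v r₀‖ := hK0.trans_lt hgt
  -- the component of `u` along `v r₀` grows at a rate of at least `(‖v r₀‖ - K) / P₂`
  set e : ℂ := (starRingEnd ℂ) (v r₀) / ‖v r₀‖ with he
  have hen : ‖e‖ = 1 := by
    rw [he, norm_div, RCLike.norm_conj, Complex.norm_real, norm_norm, div_self hv0.ne']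
  have hev : (e * v r₀).re = ‖v r₀‖ := by
    rw [he, div_mul_eq_mul_div, ← Complex.normSq_eq_conj_mul_self, Complex.normSq_eq_norm_sq,
      Complex.div_ofReal_re, Complex.ofReal_re]
    field_simp
  have hmv := mul_sub_le_of_le_hasDerivAt (f := fun s => (e * u s).re)
    (f' := fun s => (e * (v s / p s)).re) (c := (‖v r₀‖ - K) / P₂)
    (by linarith : r₀ - 1 / lam ≤ r₀)
    (fun x hx => ((h.fst x (hsub hx)).const_mul e).complex_re) (fun x hx => by
      have hpx := hp x (hsub hx)
      rw [← mul_div_assoc, Complex.div_ofReal_re]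
      have h2 : (e * v x).re = ‖v r₀‖ + (e * (v x - v r₀)).re := by
        rw [mul_sub, Complex.sub_re, hev]; ring
      have h3 : |(e * (v x - v r₀)).re| ≤ K := by
        refine (Complex.abs_re_le_norm _).trans ?_
        rw [norm_mul, hen, one_mul]
        exact hv x hx
      have h4 := (abs_le.1 h3).1
      exact div_le_div₀ (by linarith) (by linarith) (hP₁.trans_le hpx.1) hpx.2)
  have h5 : (e * u r₀).re - (e * u (r₀ - 1 / lam)).re ≤ 2 * ‖u r₀‖ := by
    have h6 := (abs_le.1 (Complex.abs_re_le_norm (e * u r₀))).2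
    have h7 := (abs_le.1 (Complex.abs_re_le_norm (e * u (r₀ - 1 / lam)))).1
    rw [norm_mul, hen, one_mul] at h6 h7
    have := hu (r₀ - 1 / lam) ⟨le_rfl, by linarith⟩
    linarith
  have h8 : (‖v r₀‖ - K) / P₂ * (1 / lam) ≤ 2 * ‖u r₀‖ := by
    refine le_trans (le_of_eq ?_) (hmv.trans h5)
    ring
  rw [div_mul_div_comm, mul_one, div_le_iff₀ (by positivity)] at h8
  rw [hK] at h8
  linarith

/-- Grönwall's inequality with damping: `(g - B / μ) e^{μ (x - α)}` is non-increasing. -/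
lemma le_of_hasDerivAt_le_sub_mul {g g' : ℝ → ℝ} {α β B μ : ℝ} (hαβ : α ≤ β) (hμ : 0 < μ)
    (hB : 0 ≤ B) (hd : ∀ x ∈ Icc α β, HasDerivAt g (g' x) x)
    (hg : ∀ x ∈ Icc α β, g' x ≤ B - μ * g x) :
    g β ≤ B / μ + g α * Real.exp (-(μ * (β - α))) := by
  have h := le_of_hasDerivAt_nonpos (f := fun x => (g x - B / μ) * Real.exp (μ * (x - α))) hαβ
    (fun x hx => ((hd x hx).sub_const _).mul
      (((hasDerivAt_id x).sub_const α).const_mul μ).exp) (fun x hx => by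
      have h1 := hg x hx
      have h2 : 0 < Real.exp (μ * (x - α)) := Real.exp_pos _
      have h3 : μ * (B / μ) = B := by field_simp
      have h4 : g' x + μ * (g x - B / μ) ≤ 0 := by rw [mul_sub, h3]; linarith
      have := mul_nonpos_of_nonpos_of_nonneg h4 h2.le
      simp only [id, mul_one]
      linarith)
  simp only [sub_self, mul_zero, Real.exp_zero, mul_one] at h
  have h2 : 0 < Real.exp (-(μ * (β - α))) := Real.exp_pos _
  have h3 : Real.exp (μ * (β - α)) * Real.exp (-(μ * (β - α))) = 1 := by
    rw [← Real.exp_add]; simp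
  have h4 := mul_le_mul_of_nonneg_right h h2.le
  rw [mul_assoc, h3, mul_one] at h4
  have h5 : 0 ≤ B / μ * Real.exp (-(μ * (β - α))) := by positivity
  nlinarith

/-- The fourth power is what is needed below: it turns an initial squared error of order `lam ^ 2`
into one of order `lam ^ (-2)`. -/
lemma exp_neg_le_div_pow_four {x : ℝ} (hx : 0 < x) : Real.exp (-x) ≤ 24 / x ^ 4 := by
  have h := Real.pow_div_factorial_le_exp x hx.le 4
  rw [Real.exp_neg, ← one_div, div_le_div_iff₀ (Real.exp_pos x) (by positivity)]
  have : (Nat.factorial 4 : ℝ) = 24 := by norm_num [Nat.factorial]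
  rw [this, div_le_iff₀ (by norm_num)] at h
  linarith

/-! ### Principal square roots -/

lemma cpow_half_sq (z : ℂ) : (z ^ (1 / 2 : ℂ)) ^ 2 = z := by
  rw [← Complex.cpow_nat_mul]; simp

lemma norm_cpow_half (z : ℂ) : ‖z ^ (1 / 2 : ℂ)‖ = Real.sqrt ‖z‖ := by
  rw [eq_comm, Real.sqrt_eq_iff_mul_self_eq (norm_nonneg _) (norm_nonneg _), ← norm_mul, ← sq,
    cpow_half_sq]

lemma cpow_half_re_nonneg (z : ℂ) : 0 ≤ (z ^ (1 / 2 : ℂ)).re := by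
  have : (1 / 2 : ℂ) = ((1 / 2 : ℝ) : ℂ) := by push_cast; rfl
  rcases eq_or_ne z 0 with rfl | hz
  · rw [Complex.zero_cpow (by norm_num)]; simp
  rw [Complex.cpow_def_of_ne_zero hz, Complex.exp_re, this, Complex.im_mul_ofReal, Complex.log_im]
  refine mul_nonneg (Real.exp_pos _).le (Real.cos_nonneg_of_mem_Icc ⟨?_, ?_⟩)
  · linarith [Complex.neg_pi_lt_arg z]
  · linarith [Complex.arg_le_pi z]

/-- The real part of the principal root is at least the root of the real part. -/
lemma sqrt_re_le_cpow_half_re {z : ℂ} {c : ℝ} (hz : c ^ 2 ≤ z.re) :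
    c ≤ (z ^ (1 / 2 : ℂ)).re := by
  set s := z ^ (1 / 2 : ℂ) with hs
  have h1 : s ^ 2 = z := cpow_half_sq z
  have h2 : z.re = s.re ^ 2 - s.im ^ 2 := by
    rw [← h1, sq, Complex.mul_re]; ring
  have h3 := cpow_half_re_nonneg z
  rw [← hs] at h3
  nlinarith [sq_nonneg s.im]

lemma hasDerivAt_cpow_half {V : ℝ → ℂ} {V' : ℂ} {r : ℝ} (h : HasDerivAt V V' r)
    (hr : 0 < (V r).re) :
    HasDerivAt (fun s => V s ^ (1 / 2 : ℂ)) (V' / (2 * V r ^ (1 / 2 : ℂ))) r := by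
  have h0 : V r ≠ 0 := fun h0 => by simp [h0] at hr
  have hs : V r ^ (1 / 2 : ℂ) ≠ 0 := fun h0' => h0 (by rw [← cpow_half_sq (V r), h0']; simp)
  have := (Complex.hasStrictDerivAt_cpow_const (x := V r) (c := (1 / 2 : ℂ))
    (Or.inl hr)).hasDerivAt.comp_of_eq r h rfl
  refine this.congr_deriv ?_
  rw [Complex.cpow_sub _ _ h0, Complex.cpow_one]
  nth_rewrite 2 [← cpow_half_sq (V r)]
  field_simp

/-- Pointwise consequences of `PotentialBounds`. -/
lemma PotentialBounds.norm_ratio_le {p : ℝ → ℝ} {V V₁ V₂ : ℝ → ℂ} {α β c C lam : ℝ}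
    (h : PotentialBounds p V V₁ V₂ α β c C lam) (hc : 0 < c) (hlam : 0 < lam) {r : ℝ}
    (hr : r ∈ Icc α β) : 0 ≤ C ∧ 0 < (V r).re ∧ V r ≠ 0 ∧ ‖V₁ r / V r‖ ≤ C / c ∧
      ‖V₂ r / V r‖ ≤ C / c := by
  have hl2 : 0 < lam ^ 2 := by positivity
  have h1 := h.lower r hr
  have h2 : 0 < (V r).re := lt_of_lt_of_le (by positivity) h1
  have h0 : V r ≠ 0 := fun h0 => by simp [h0] at h2
  have h3 : c * lam ^ 2 ≤ ‖V r‖ := h1.trans ((le_abs_self _).trans (Complex.abs_re_le_norm _))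
  have hC : 0 ≤ C := by
    have := (norm_nonneg _).trans (h.upper r hr)
    by_contra! hC
    nlinarith
  refine ⟨hC, h2, h0, ?_, ?_⟩ <;> rw [norm_div, div_le_div_iff₀ (norm_pos_iff.2 h0) hc]
  · calc ‖V₁ r‖ * c ≤ C * lam ^ 2 * c := by gcongr; exact h.upper₁ r hr
      _ = C * (c * lam ^ 2) := by ring
      _ ≤ C * ‖V r‖ := by gcongr
  · calc ‖V₂ r‖ * c ≤ C * lam ^ 2 * c := by gcongr; exact h.upper₂ r hr
      _ = C * (c * lam ^ 2) := by ring
      _ ≤ C * ‖V r‖ := by gcongr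

/-! ### The Riccati equation and its approximate solution -/

/-- The second order approximation to the logarithmic derivative of a growing solution. -/
noncomputable def wkbRate (V V₁ : ℝ → ℂ) (r : ℝ) : ℂ := V r ^ (1 / 2 : ℂ) - V₁ r / (4 * V r)

/-- The defect of `wkbRate` in the Riccati equation. -/
noncomputable def wkbDefect (V V₁ V₂ : ℝ → ℂ) (r : ℝ) : ℂ :=
  V₂ r / V r / 4 - 5 / 16 * (V₁ r / V r) ^ 2

/-- The quotient `y = v / u` satisfies `p y' = V - y²`. The approximate rate satisfies the same
equation up to the defect, because the correction `V₁ / (4 V)` cancels the derivative of `√V`.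
Subtraction factors `y²` minus the squared rate and leaves a linear damping with coefficient `y`
plus the rate. -/
lemma hasDerivAt_riccati_sub_wkbRate {p : ℝ → ℝ} {V V₁ V₂ u v : ℝ → ℂ} {r : ℝ} (hp : p r ≠ 0)
    (hu : HasDerivAt u (v r / p r) r) (hv : HasDerivAt v (V r * u r / p r) r)
    (hV : HasDerivAt V (V₁ r / p r) r) (hV₁ : HasDerivAt V₁ (V₂ r / p r) r)
    (hre : 0 < (V r).re) (hu0 : u r ≠ 0) :
    HasDerivAt (fun s => v s / u s - wkbRate V V₁ s)
      ((wkbDefect V V₁ V₂ r - (v r / u r + wkbRate V V₁ r) * (v r / u r - wkbRate V V₁ r)) / p r)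
      r := by
  have h0 : V r ≠ 0 := fun h0 => by simp [h0] at hre
  have hs : V r ^ (1 / 2 : ℂ) ≠ 0 := fun h0' => h0 (by rw [← cpow_half_sq (V r), h0']; simp)
  have hp' : (p r : ℂ) ≠ 0 := Complex.ofReal_ne_zero.2 hp
  have h1 := (hv.div hu hu0).sub ((hasDerivAt_cpow_half hV hre).sub
    (hV₁.div (hV.const_mul 4) (by simp [h0])))
  refine h1.congr_deriv ?_
  simp only [wkbRate, wkbDefect]
  have e := cpow_half_sq (V r)
  set s := V r ^ (1 / 2 : ℂ)
  rw [← e]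
  field_simp
  ring

/-- **Local asymptotics.** The logarithmic derivative at `β` of a solution of non-decreasing
modulus on `[α, β]`, up to `O(1 / lam)`, uniformly in the potential. -/
theorem exists_norm_logDeriv_sub_wkbRate_le {p : ℝ → ℝ} {α β P₁ P₂ c C : ℝ} (hαβ : α < β)
    (hP₁ : 0 < P₁) (hp : ∀ r ∈ Icc α β, P₁ ≤ p r ∧ p r ≤ P₂) (hc : 0 < c) :
    ∃ K Λ : ℝ, 0 ≤ K ∧ 1 ≤ Λ ∧ ∀ lam, Λ ≤ lam → ∀ V V₁ V₂ u v : ℝ → ℂ,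
      PotentialBounds p V V₁ V₂ α β c C lam → IsRadialSol p V (Icc α β) u v →
      (∀ r ∈ Icc α β, u r ≠ 0) → (∀ r ∈ Icc α β, 0 ≤ (flux u v r).re) →
      ‖v β / u β - wkbRate V V₁ β‖ ≤ K / lam := by
  -- `c₁ lam` bounds the real part of the rate from below, half of `√c lam` being left for the
  -- correction. `D` bounds the defect, `K₁ lam` the error at the midpoint, and `c₂ lam` is the
  -- exponent gained from the midpoint to `β`. The absolute value of `C` makes these constants
  -- non-negative before any potential is given.
  set c₁ := Real.sqrt c / 2 with hc₁
  have hc₁0 : 0 < c₁ := by positivity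
  set D := |C| / c / 4 + 5 / 16 * (|C| / c) ^ 2 with hD
  set K₁ := |C| / P₁ + 2 * P₂ + Real.sqrt |C| + |C| / c / 4 with hK₁
  have hP₂ : 0 < P₂ := by
    have := hp α ⟨le_rfl, hαβ.le⟩
    linarith
  set c₂ := c₁ * ((β - α) / 2) / P₂ with hc₂
  have hc₂0 : 0 < c₂ := by have := sub_pos.2 hαβ; positivity
  have hD0 : 0 ≤ D := by positivity
  have hK₁0 : 0 ≤ K₁ := by positivity
  set M := D ^ 2 * P₂ / (c₁ ^ 2 * P₁) + K₁ ^ 2 * 24 / c₂ ^ 4 with hM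
  have hM0 : 0 ≤ M := by positivity
  refine ⟨Real.sqrt M, max 1 (max (2 / (β - α)) (|C| / c / 4 / c₁)), Real.sqrt_nonneg _,
    le_max_left _ _, ?_⟩
  intro lam hΛ V V₁ V₂ u v hb hsol hu hj
  have hl1 : 1 ≤ lam := (le_max_left _ _).trans hΛ
  have hl2 : 2 / (β - α) ≤ lam := ((le_max_left _ _).trans (le_max_right _ _)).trans hΛ
  have hl3 : |C| / c / 4 / c₁ ≤ lam := ((le_max_right _ _).trans (le_max_right _ _)).trans hΛ
  have hl0 : 0 < lam := by linarith
  rw [div_le_iff₀ (sub_pos.2 hαβ)] at hl2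
  rw [div_le_iff₀ hc₁0] at hl3
  have hC : |C| = C := abs_of_nonneg (hb.norm_ratio_le hc hl0 ⟨hαβ.le, le_rfl⟩).1
  have hratio : ∀ r ∈ Icc α β, ‖V₁ r / (4 * V r)‖ ≤ |C| / c / 4 := by
    intro r hr
    have := (hb.norm_ratio_le hc hl0 hr).2.2.2.1
    rw [hC, mul_comm, ← div_div, norm_div]
    simp only [Complex.norm_ofNat]
    linarith
  have hroot : ∀ r ∈ Icc α β, 2 * c₁ * lam ≤ (V r ^ (1 / 2 : ℂ)).re := by
    intro r hr
    refine sqrt_re_le_cpow_half_re ?_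
    rw [mul_pow, hc₁, mul_div_cancel₀ _ (two_ne_zero), Real.sq_sqrt hc.le]
    exact hb.lower r hr
  have hrate : ∀ r ∈ Icc α β, c₁ * lam ≤ (wkbRate V V₁ r).re := by
    intro r hr
    have h1 := hroot r hr
    have h2 := (abs_le.1 ((Complex.abs_re_le_norm _).trans (hratio r hr))).2
    rw [wkbRate, Complex.sub_re]
    linarith
  have hdef : ∀ r ∈ Icc α β, ‖wkbDefect V V₁ V₂ r‖ ≤ D := by
    intro r hr
    obtain ⟨-, -, -, h1, h2⟩ := hb.norm_ratio_le hc hl0 hr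
    rw [← hC] at h1 h2
    refine (norm_sub_le _ _).trans (add_le_add ?_ ?_)
    · rw [norm_div]; simp only [Complex.norm_ofNat]; gcongr
    · rw [norm_mul, norm_pow]
      have : ‖(5 / 16 : ℂ)‖ = 5 / 16 := by simp
      rw [this]; gcongr
  -- The left half leaves room of length `1 / lam` for the a priori bound on `v / u`; on the right
  -- half the error is damped exponentially.
  set mid := (α + β) / 2 with hmid
  have hsubm : Icc mid β ⊆ Icc α β := Icc_subset_Icc (by rw [hmid]; linarith) le_rfl
  set z : ℝ → ℂ := fun s => v s / u s - wkbRate V V₁ s with hz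
  have hmono := le_of_hasDerivAt_le_sub_mul (g := fun s => Complex.normSq (z s)) (α := mid)
    (β := β) (B := D ^ 2 / (c₁ * lam) / P₁) (μ := c₁ * lam / P₂) (by rw [hmid]; linarith)
    (by positivity) (by positivity)
    (fun r hr => by
      have hr' := hsubm hr
      exact (hasDerivAt_riccati_sub_wkbRate (hP₁.trans_le (hp r hr').1).ne' (hsol.fst r hr')
        (hsol.snd r hr') (hb.deriv₁ r hr') (hb.deriv₂ r hr')
        (hb.norm_ratio_le hc hl0 hr').2.1 (hu r hr')).complex_normSq)
    (fun r hr => by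
      have hr' := hsubm hr
      have hpr := hp r hr'
      have hpr0 : 0 < p r := hP₁.trans_le hpr.1
      -- Here the hypothesis on the flux enters: `v / u` is the flux over `|u|²`, so it only adds to
      -- the damping.
      have hyre : 0 ≤ (v r / u r).re := by
        have h1 : v r / u r = flux u v r / (Complex.normSq (u r) : ℂ) := by
          rw [flux, Complex.normSq_eq_conj_mul_self, mul_div_mul_left]
          exact (map_ne_zero _).2 (hu r hr')
        rw [h1, Complex.div_ofReal_re]
        exact div_nonneg (hj r hr') (Complex.normSq_nonneg _)
      have h1 : (starRingEnd ℂ) (z r) * ((wkbDefect V V₁ V₂ r -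
            (v r / u r + wkbRate V V₁ r) * (v r / u r - wkbRate V V₁ r)) / p r) =
          ((starRingEnd ℂ) (z r) * wkbDefect V V₁ V₂ r -
            (v r / u r + wkbRate V V₁ r) * (Complex.normSq (z r) : ℂ)) / (p r : ℝ) := by
        rw [Complex.normSq_eq_conj_mul_self]
        simp only [hz]
        ring
      change 2 * ((starRingEnd ℂ) (z r) * _).re ≤ _
      rw [h1, Complex.div_ofReal_re, Complex.sub_re, Complex.re_mul_ofReal, Complex.add_re]
      have h2 : ((starRingEnd ℂ) (z r) * wkbDefect V V₁ V₂ r).re ≤ ‖z r‖ * D := by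
        refine (le_abs_self _).trans ((Complex.abs_re_le_norm _).trans ?_)
        rw [norm_mul, RCLike.norm_conj]
        gcongr
        exact hdef r hr'
      set g := Complex.normSq (z r) with hg
      have hg0 : 0 ≤ g := Complex.normSq_nonneg _
      have hgz : g = ‖z r‖ ^ 2 := Complex.normSq_eq_norm_sq _
      -- Young's inequality absorbs the linear defect term into half of the damping.
      have h3 : 2 * (‖z r‖ * D) ≤ c₁ * lam * g + D ^ 2 / (c₁ * lam) := by
        have h4 : 0 < c₁ * lam := by positivity
        have h5 : 0 ≤ (c₁ * lam * ‖z r‖ - D) ^ 2 / (c₁ * lam) := by positivity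
        have h6 : (c₁ * lam * ‖z r‖ - D) ^ 2 / (c₁ * lam) =
            c₁ * lam * ‖z r‖ ^ 2 - 2 * (‖z r‖ * D) + D ^ 2 / (c₁ * lam) := by
          field_simp; ring
        rw [hgz]; linarith
      have h7 : c₁ * lam * g ≤ ((v r / u r).re + (wkbRate V V₁ r).re) * g := by
        gcongr
        linarith [hrate r hr']
      have h8 : 2 * (((starRingEnd ℂ) (z r) * wkbDefect V V₁ V₂ r).re -
          ((v r / u r).re + (wkbRate V V₁ r).re) * g) ≤ D ^ 2 / (c₁ * lam) - c₁ * lam * g := by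
        linarith
      calc 2 * ((((starRingEnd ℂ) (z r) * wkbDefect V V₁ V₂ r).re -
          ((v r / u r).re + (wkbRate V V₁ r).re) * g) / p r)
          = 2 * (((starRingEnd ℂ) (z r) * wkbDefect V V₁ V₂ r).re -
          ((v r / u r).re + (wkbRate V V₁ r).re) * g) / p r := by ring
        _ ≤ (D ^ 2 / (c₁ * lam) - c₁ * lam * g) / p r := by gcongr
        _ = D ^ 2 / (c₁ * lam) / p r - c₁ * lam * g / p r := by ring
        _ ≤ D ^ 2 / (c₁ * lam) / P₁ - c₁ * lam * g / P₂ :=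
          sub_le_sub (div_le_div_of_nonneg_left (by positivity) hP₁ hpr.1)
            (div_le_div_of_nonneg_left (by positivity) hpr0 hpr.2)
        _ = _ := by ring)
  have hmidm : mid ∈ Icc α β := hsubm ⟨le_rfl, by rw [hmid]; linarith⟩
  have hinit : ‖z mid‖ ≤ K₁ * lam := by
    have h1 : 1 / lam ≤ (β - α) / 2 := by
      rw [div_le_div_iff₀ hl0 two_pos]; linarith
    have h2 := hsol.norm_snd_le hP₁ hp hb.upper hj hl0 (r₀ := mid)
      ⟨by rw [hmid]; linarith, hmidm.2⟩
    have h3 : ‖v mid / u mid‖ ≤ (C / P₁ + 2 * P₂) * lam := by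
      rw [norm_div, div_le_iff₀ (norm_pos_iff.2 (hu mid hmidm))]
      exact h2
    have h4 : ‖V mid ^ (1 / 2 : ℂ)‖ ≤ Real.sqrt |C| * lam := by
      rw [norm_cpow_half]
      refine Real.sqrt_le_iff.2 ⟨by positivity, ?_⟩
      rw [mul_pow, Real.sq_sqrt (abs_nonneg _), hC]
      exact hb.upper mid hmidm
    have h5 := hratio mid hmidm
    have h6 : ‖wkbRate V V₁ mid‖ ≤ Real.sqrt |C| * lam + |C| / c / 4 :=
      (norm_sub_le _ _).trans (add_le_add h4 h5)
    have h7 : |C| / c / 4 ≤ |C| / c / 4 * lam := le_mul_of_one_le_right (by positivity) hl1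
    calc ‖z mid‖ ≤ ‖v mid / u mid‖ + ‖wkbRate V V₁ mid‖ := norm_sub_le _ _
      _ ≤ K₁ * lam := by rw [hK₁, hC] at *; linarith
  have hexp : Real.exp (-(c₁ * lam / P₂ * (β - mid))) ≤ 24 / (c₂ * lam) ^ 4 := by
    have : c₁ * lam / P₂ * (β - mid) = c₂ * lam := by rw [hmid, hc₂]; ring
    rw [this]
    exact exp_neg_le_div_pow_four (by positivity)
  have hfin : Complex.normSq (z β) ≤ M / lam ^ 2 := by
    refine hmono.trans ?_
    have h1 : Complex.normSq (z mid) ≤ (K₁ * lam) ^ 2 := by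
      rw [Complex.normSq_eq_norm_sq]; gcongr
    calc D ^ 2 / (c₁ * lam) / P₁ / (c₁ * lam / P₂) +
        Complex.normSq (z mid) * Real.exp (-(c₁ * lam / P₂ * (β - mid)))
        ≤ D ^ 2 / (c₁ * lam) / P₁ / (c₁ * lam / P₂) + (K₁ * lam) ^ 2 * (24 / (c₂ * lam) ^ 4) := by
          gcongr
      _ = M / lam ^ 2 := by rw [hM]; field_simp
  change ‖z β‖ ≤ _
  rw [← Real.sqrt_sq (norm_nonneg (z β)), ← Complex.normSq_eq_norm_sq]
  refine (Real.sqrt_le_sqrt hfin).trans (le_of_eq ?_)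
  rw [Real.sqrt_div hM0, Real.sqrt_sq hl0.le]

lemma flux_reflect (u v : ℝ → ℂ) (r : ℝ) :
    flux (fun r => u (-r)) (fun r => -v (-r)) r = -flux u v (-r) := by
  simp [flux]

/-- The mirror image of `exists_norm_logDeriv_sub_wkbRate_le`, for solutions of non-increasing
modulus. -/
theorem exists_norm_logDeriv_add_wkbRate_le {p : ℝ → ℝ} {α β P₁ P₂ c C : ℝ} (hαβ : α < β)
    (hP₁ : 0 < P₁) (hp : ∀ r ∈ Icc α β, P₁ ≤ p r ∧ p r ≤ P₂) (hc : 0 < c) :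
    ∃ K Λ : ℝ, 0 ≤ K ∧ 1 ≤ Λ ∧ ∀ lam, Λ ≤ lam → ∀ V V₁ V₂ u v : ℝ → ℂ,
      PotentialBounds p V V₁ V₂ α β c C lam → IsRadialSol p V (Icc α β) u v →
      (∀ r ∈ Icc α β, u r ≠ 0) → (∀ r ∈ Icc α β, (flux u v r).re ≤ 0) →
      ‖-(v α / u α) - (V α ^ (1 / 2 : ℂ) + V₁ α / (4 * V α))‖ ≤ K / lam := by
  have hm : ∀ r ∈ Icc (-β) (-α), -r ∈ Icc α β := fun r hr =>
    ⟨by linarith [hr.2], by linarith [hr.1]⟩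
  obtain ⟨K, Λ, hK, hΛ, h⟩ := exists_norm_logDeriv_sub_wkbRate_le (p := fun r => p (-r))
    (α := -β) (β := -α) (C := C) (neg_lt_neg hαβ) hP₁ (fun r hr => hp _ (hm r hr)) hc
  refine ⟨K, Λ, hK, hΛ, fun lam hlam V V₁ V₂ u v hb hs hu hj => ?_⟩
  have := h lam hlam _ _ _ _ _ hb.reflect (hs.reflect.mono fun r hr => hm r hr)
    (fun r hr => hu _ (hm r hr)) (fun r hr => by
      rw [flux_reflect, Complex.neg_re]
      exact neg_nonneg.2 (hj _ (hm r hr)))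
  simpa [wkbRate, neg_div] using this

/-- The product of a growing and a decaying solution, divided by their Wronskian, is
`1 / (2 √V)` up to `O(1 / lam ^ 3)`. -/
theorem exists_norm_green_diag_sub_le {p : ℝ → ℝ} {α s β P₁ P₂ c C : ℝ} (hαs : α < s)
    (hsβ : s < β) (hP₁ : 0 < P₁) (hp : ∀ r ∈ Icc α β, P₁ ≤ p r ∧ p r ≤ P₂) (hc : 0 < c) :
    ∃ K Λ : ℝ, 0 ≤ K ∧ 1 ≤ Λ ∧ ∀ lam, Λ ≤ lam → ∀ V V₁ V₂ u v x y : ℝ → ℂ,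
      PotentialBounds p V V₁ V₂ α β c C lam →
      IsRadialSol p V (Icc α β) u v → IsRadialSol p V (Icc α β) x y →
      (∀ r ∈ Icc α s, u r ≠ 0) → (∀ r ∈ Icc s β, x r ≠ 0) →
      (∀ r ∈ Icc α s, 0 ≤ (flux u v r).re) → (∀ r ∈ Icc s β, (flux x y r).re ≤ 0) →
      ‖u s * x s / (v s * x s - u s * y s) - 1 / (2 * V s ^ (1 / 2 : ℂ))‖ ≤ K / lam ^ 3 := by
  have h1 : Icc α s ⊆ Icc α β := Icc_subset_Icc le_rfl hsβ.le
  have h2 : Icc s β ⊆ Icc α β := Icc_subset_Icc hαs.le le_rfl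
  obtain ⟨K, Λ, hK, hΛ, hf⟩ := exists_norm_logDeriv_sub_wkbRate_le (C := C) hαs hP₁
    (fun r hr => hp r (h1 hr)) hc
  obtain ⟨K', Λ', hK', hΛ', hg⟩ := exists_norm_logDeriv_add_wkbRate_le (C := C) hsβ hP₁
    (fun r hr => hp r (h2 hr)) hc
  have hsc : 0 < Real.sqrt c := Real.sqrt_pos.2 hc
  refine ⟨(K + K') / (2 * c), max (max Λ Λ') ((K + K') / Real.sqrt c), by positivity,
    (hΛ.trans (le_max_left _ _)).trans (le_max_left _ _), ?_⟩
  intro lam hlam V V₁ V₂ u v x y hb hu hx hu0 hx0 hju hjx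
  have hl1 : Λ ≤ lam := ((le_max_left _ _).trans (le_max_left _ _)).trans hlam
  have hl2 : Λ' ≤ lam := ((le_max_right _ _).trans (le_max_left _ _)).trans hlam
  have hl3 : (K + K') / Real.sqrt c ≤ lam := (le_max_right _ _).trans hlam
  have hl : 1 ≤ lam := hΛ.trans hl1
  have hl0 : 0 < lam := by linarith
  have e1 := hf lam hl1 V V₁ V₂ u v (hb.mono h1) (hu.mono h1) hu0 hju
  have e2 := hg lam hl2 V V₁ V₂ x y (hb.mono h2) (hx.mono h2) hx0 hjx
  have hs1 : s ∈ Icc α s := ⟨hαs.le, le_rfl⟩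
  have hs2 : s ∈ Icc s β := ⟨le_rfl, hsβ.le⟩
  have hus := hu0 s hs1
  have hxs := hx0 s hs2
  set S := V s ^ (1 / 2 : ℂ) with hS
  -- `Y` is the Wronskian divided by `u s * x s`, the reciprocal of the diagonal. The corrections
  -- `V₁ / (4 V)` of the two logarithmic derivatives cancel in it.
  set Y := v s / u s + -(y s / x s) with hY
  have e3 : ‖Y - 2 * S‖ ≤ (K + K') / lam := by
    have : Y - 2 * S = (v s / u s - wkbRate V V₁ s) +
        (-(y s / x s) - (S + V₁ s / (4 * V s))) := by
      rw [hY, wkbRate]; ring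
    rw [this, add_div]
    exact (norm_add_le _ _).trans (add_le_add e1 e2)
  have hSre : Real.sqrt c * lam ≤ S.re := by
    refine sqrt_re_le_cpow_half_re ?_
    rw [mul_pow, Real.sq_sqrt hc.le]
    exact hb.lower s (h1 hs1)
  have hSn : Real.sqrt c * lam ≤ ‖S‖ := hSre.trans ((le_abs_self _).trans (Complex.abs_re_le_norm _))
  have hS0 : S ≠ 0 := norm_pos_iff.1 (lt_of_lt_of_le (by positivity) hSn)
  have e4 : (K + K') / lam ≤ Real.sqrt c * lam := by
    rw [div_le_iff₀ hsc] at hl3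
    rw [div_le_iff₀ hl0]
    calc K + K' ≤ lam * Real.sqrt c := hl3
      _ ≤ lam * Real.sqrt c * lam := le_mul_of_one_le_right (by positivity) hl
      _ = _ := by ring
  have hYn : Real.sqrt c * lam ≤ ‖Y‖ := by
    have := norm_sub_norm_le (2 * S) Y
    rw [norm_sub_rev, norm_mul] at this
    simp only [Complex.norm_ofNat] at this
    linarith
  have hY0 : Y ≠ 0 := norm_pos_iff.1 (lt_of_lt_of_le (by positivity) hYn)
  have e5 : u s * x s / (v s * x s - u s * y s) = 1 / Y := by
    have hY' : Y * (u s * x s) = v s * x s - u s * y s := by rw [hY]; field_simp; ring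
    rw [← hY', eq_div_iff hY0, div_mul_eq_mul_div, div_eq_one_iff_eq]
    · ring
    · exact mul_ne_zero hY0 (mul_ne_zero hus hxs)
  have e6 : 1 / Y - 1 / (2 * S) = -(Y - 2 * S) / (Y * (2 * S)) := by field_simp; ring
  rw [e5, e6, norm_div, norm_neg, norm_mul, norm_mul, Complex.norm_ofNat]
  calc ‖Y - 2 * S‖ / (‖Y‖ * (2 * ‖S‖))
      ≤ (K + K') / lam / ((Real.sqrt c * lam) * (2 * (Real.sqrt c * lam))) := by gcongr
    _ = (K + K') / (2 * Real.sqrt c ^ 2) / lam ^ 3 := by field_simp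
    _ = _ := by rw [Real.sq_sqrt hc.le]

/-! ### The radial form of the mode equation -/

/-- Smooth positive metric functions on a half-line. -/
structure IsSection (N grr h w : ℝ → ℝ) (a : ℝ) : Prop where
  lapse : ContDiffOn ℝ (⊤ : ℕ∞) N (Ioi a)
  rr : ContDiffOn ℝ (⊤ : ℕ∞) grr (Ioi a)
  angular : ContDiffOn ℝ (⊤ : ℕ∞) h (Ioi a)
  shift : ContDiffOn ℝ (⊤ : ℕ∞) w (Ioi a)
  lapse_pos : ∀ r ∈ Ioi a, 0 < N r
  rr_pos : ∀ r ∈ Ioi a, 0 < grr r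
  angular_pos : ∀ r ∈ Ioi a, 0 < h r

/-- The coefficient `p = √g g^{rr}` of the radial equation `p (p u')' = V u`. -/
noncomputable def radialCoeff (N grr h : ℝ → ℝ) (r : ℝ) : ℝ :=
  N r * Real.sqrt (h r) / Real.sqrt (grr r)

/-- The potential `V = χ² + m² N² g_θθ` of the radial equation. -/
noncomputable def radialPotential (N h w : ℝ → ℝ) (m ω : ℝ) (k : ℤ) (r : ℝ) : ℂ :=
  h r * (ω + Complex.I * k * w r) ^ 2 + (N r : ℂ) ^ 2 * (k : ℂ) ^ 2 +
    (m : ℂ) ^ 2 * (N r : ℂ) ^ 2 * h r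

section Operator

variable {N grr h w : ℝ → ℝ} {a : ℝ}

namespace IsSection

lemma radialCoeff_pos (H : IsSection N grr h w a) {r : ℝ} (hr : r ∈ Ioi a) :
    0 < radialCoeff N grr h r :=
  div_pos (mul_pos (H.lapse_pos r hr) (Real.sqrt_pos.2 (H.angular_pos r hr)))
    (Real.sqrt_pos.2 (H.rr_pos r hr))

lemma contDiffOn_radialCoeff (H : IsSection N grr h w a) :
    ContDiffOn ℝ (⊤ : ℕ∞) (radialCoeff N grr h) (Ioi a) :=
  (H.lapse.mul (H.angular.sqrt fun r hr => (H.angular_pos r hr).ne')).div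
    (H.rr.sqrt fun r hr => (H.rr_pos r hr).ne')
    fun r hr => (Real.sqrt_pos.2 (H.rr_pos r hr)).ne'

lemma contDiffOn_radialPotential (H : IsSection N grr h w a) (m ω : ℝ) (k : ℤ) :
    ContDiffOn ℝ (⊤ : ℕ∞) (radialPotential N h w m ω k) (Ioi a) := by
  have hc : ∀ {f : ℝ → ℝ}, ContDiffOn ℝ (⊤ : ℕ∞) f (Ioi a) →
      ContDiffOn ℝ (⊤ : ℕ∞) (fun r => (f r : ℂ)) (Ioi a) := fun hf =>
    Complex.ofRealCLM.contDiff.comp_contDiffOn hf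
  exact (((hc H.angular).mul ((contDiffOn_const.add (contDiffOn_const.mul (hc H.shift))).pow 2)).add
    (((hc H.lapse).pow 2).mul contDiffOn_const)).add
    ((contDiffOn_const.mul ((hc H.lapse).pow 2)).mul (hc H.angular))

lemma isRadialEq (H : IsSection N grr h w a) (m ω : ℝ) (k : ℤ) :
    IsRadialEq (radialCoeff N grr h) (radialPotential N h w m ω k) a :=
  ⟨H.contDiffOn_radialCoeff.continuousOn, fun _ hr => H.radialCoeff_pos hr,
    (H.contDiffOn_radialPotential m ω k).continuousOn⟩

end IsSection

lemma sectionMetric_inv {N grr h w : ℝ → ℝ} {y : Fin 3 → ℝ} (hN : N (y 1) ≠ 0)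
    (hg : grr (y 1) ≠ 0) (hh : h (y 1) ≠ 0) :
    (sectionMetric N grr h w y)⁻¹ =
      !![1 / (N (y 1) : ℂ) ^ 2, 0, Complex.I * w (y 1) / (N (y 1) : ℂ) ^ 2;
         0, 1 / (grr (y 1) : ℂ), 0;
         Complex.I * w (y 1) / (N (y 1) : ℂ) ^ 2, 0,
          1 / (h (y 1) : ℂ) - (w (y 1) : ℂ) ^ 2 / (N (y 1) : ℂ) ^ 2] := by
  have hN' : (N (y 1) : ℂ) ≠ 0 := Complex.ofReal_ne_zero.2 hN
  have hg' : (grr (y 1) : ℂ) ≠ 0 := Complex.ofReal_ne_zero.2 hg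
  have hh' : (h (y 1) : ℂ) ≠ 0 := Complex.ofReal_ne_zero.2 hh
  have hI := Complex.I_sq
  refine Matrix.inv_eq_right_inv ?_
  ext i j
  fin_cases i <;> fin_cases j <;>
    simp [sectionMetric, Matrix.mul_apply, Fin.sum_univ_three] <;> field_simp <;>
    (try linear_combination (-(h (y 1) * (w (y 1) : ℂ) ^ 2)) * hI) <;>
    ring_nf <;> simp

lemma volDensity_sectionMetric {N grr h w : ℝ → ℝ} {y : Fin 3 → ℝ} (hN : 0 < N (y 1))
    (hg : 0 < grr (y 1)) (hh : 0 < h (y 1)) :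
    volDensity (sectionMetric N grr h w) y =
      N (y 1) * Real.sqrt (grr (y 1)) * Real.sqrt (h (y 1)) := by
  have hdet : (sectionMetric N grr h w y).det =
      ((N (y 1) ^ 2 * grr (y 1) * h (y 1) : ℝ) : ℂ) := by
    simp [sectionMetric, Matrix.det_fin_three]
    ring
  rw [volDensity, hdet, Complex.norm_real, Real.norm_eq_abs, abs_of_pos (by positivity),
    Real.sqrt_mul (by positivity), Real.sqrt_mul (by positivity), Real.sqrt_sq hN.le]

/-- Both factors contain square roots but the product does not; this is what turns the `τ` and `θ`
parts of the operator, after division by `√g`, into `V / p`. -/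
lemma radialCoeff_mul_volDensity {N grr h w : ℝ → ℝ} {y : Fin 3 → ℝ} (hN : 0 < N (y 1))
    (hg : 0 < grr (y 1)) (hh : 0 < h (y 1)) :
    radialCoeff N grr h (y 1) * volDensity (sectionMetric N grr h w) y =
      N (y 1) ^ 2 * h (y 1) := by
  have h1 := (Real.sqrt_pos.2 hg).ne'
  rw [volDensity_sectionMetric hN hg hh, radialCoeff]
  field_simp
  rw [Real.sq_sqrt hh.le]

lemma volDensity_eq_radialCoeff_mul {N grr h w : ℝ → ℝ} {y : Fin 3 → ℝ} (hN : 0 < N (y 1))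
    (hg : 0 < grr (y 1)) (hh : 0 < h (y 1)) :
    volDensity (sectionMetric N grr h w) y = radialCoeff N grr h (y 1) * grr (y 1) := by
  have h1 := (Real.sqrt_pos.2 hg).ne'
  rw [volDensity_sectionMetric hN hg hh, radialCoeff]
  field_simp
  rw [Real.sq_sqrt hg.le]

lemma volDensity_mul_inv_rr {N grr h w : ℝ → ℝ} {y : Fin 3 → ℝ} (hN : 0 < N (y 1))
    (hg : 0 < grr (y 1)) (hh : 0 < h (y 1)) :
    (volDensity (sectionMetric N grr h w) y : ℂ) * (sectionMetric N grr h w y)⁻¹ 1 1 =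
      radialCoeff N grr h (y 1) := by
  have hg' : (grr (y 1) : ℂ) ≠ 0 := Complex.ofReal_ne_zero.2 hg.ne'
  rw [sectionMetric_inv hN.ne' hg.ne' hh.ne', volDensity_eq_radialCoeff_mul hN hg hh]
  simp [hg']

/-- The phase factor of a mode. -/
noncomputable def modePhase (ω : ℝ) (k : ℤ) (x x' : Fin 3 → ℝ) : ℂ :=
  Complex.exp (Complex.I * ω * (x 0 - x' 0)) * Complex.exp (Complex.I * k * (x 2 - x' 2))

lemma partialD_congr {μ : Fin 3} {Φ Ψ : (Fin 3 → ℝ) → ℂ} {x : Fin 3 → ℝ}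
    (h : ∀ᶠ t in 𝓝 (x μ), Φ (Function.update x μ t) = Ψ (Function.update x μ t)) :
    partialD μ Φ x = partialD μ Ψ x :=
  Filter.EventuallyEq.deriv_eq h

lemma partialD_zero_mul_modeKernel (f : ℝ → ℂ) (ω : ℝ) (k : ℤ) (G : ℝ → ℝ → ℂ)
    (x x' : Fin 3 → ℝ) :
    partialD 0 (fun y => f (y 1) * modeKernel ω k G y x') x =
      f (x 1) * (Complex.I * ω * modeKernel ω k G x x') := by
  have h1 : HasDerivAt (fun t : ℝ => Complex.exp (Complex.I * ω * ((t : ℂ) - x' 0)))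
      (Complex.exp (Complex.I * ω * (x 0 - x' 0)) * (Complex.I * ω * 1)) (x 0) :=
    (((Complex.ofRealCLM.hasDerivAt (x := x 0)).sub_const (x' 0 : ℂ)).const_mul _).cexp
  have h2 := ((h1.mul_const (Complex.exp (Complex.I * k * (x 2 - x' 2)))).mul_const
    (G (x 1) (x' 1))).const_mul (f (x 1))
  simp only [partialD, modeKernel, Function.update_self, ne_eq, Fin.reduceEq, not_false_eq_true,
    Function.update_of_ne]
  rw [h2.deriv]
  ring

lemma partialD_two_mul_modeKernel (f : ℝ → ℂ) (ω : ℝ) (k : ℤ) (G : ℝ → ℝ → ℂ)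
    (x x' : Fin 3 → ℝ) :
    partialD 2 (fun y => f (y 1) * modeKernel ω k G y x') x =
      f (x 1) * (Complex.I * k * modeKernel ω k G x x') := by
  have h1 : HasDerivAt (fun t : ℝ => Complex.exp (Complex.I * k * ((t : ℂ) - x' 2)))
      (Complex.exp (Complex.I * k * (x 2 - x' 2)) * (Complex.I * k * 1)) (x 2) :=
    (((Complex.ofRealCLM.hasDerivAt (x := x 2)).sub_const (x' 2 : ℂ)).const_mul _).cexp
  have h2 := ((h1.const_mul (Complex.exp (Complex.I * ω * (x 0 - x' 0)))).mul_const
    (G (x 1) (x' 1))).const_mul (f (x 1))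
  simp only [partialD, modeKernel, Function.update_self, ne_eq, Fin.reduceEq, not_false_eq_true,
    Function.update_of_ne]
  rw [h2.deriv]
  ring

lemma partialD_one_modeKernel (ω : ℝ) (k : ℤ) (G : ℝ → ℝ → ℂ) (x x' : Fin 3 → ℝ) :
    partialD 1 (fun y => modeKernel ω k G y x') x =
      modePhase ω k x x' * deriv (fun r => G r (x' 1)) (x 1) := by
  simp only [partialD, modeKernel, modePhase, Function.update_self, ne_eq, Fin.reduceEq,
    not_false_eq_true, Function.update_of_ne]
  rw [deriv_const_mul_field]

/-- On a mode, the Klein-Gordon operator is the radial operator `p (p u')' - V u`. -/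
theorem IsSection.kleinGordon_modeKernel (H : IsSection N grr h w a) (m ω : ℝ) (k : ℤ)
    (G : ℝ → ℝ → ℂ) {x x' : Fin 3 → ℝ} (hx : x 1 ∈ Ioi a) :
    kleinGordon (sectionMetric N grr h w) m (fun y => modeKernel ω k G y x') x =
      (volDensity (sectionMetric N grr h w) x : ℂ)⁻¹ * (modePhase ω k x x' *
        (deriv (fun r => (radialCoeff N grr h r : ℂ) * deriv (fun r => G r (x' 1)) r) (x 1) -
          radialPotential N h w m ω k (x 1) * G (x 1) (x' 1) / radialCoeff N grr h (x 1))) := by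
  set g := sectionMetric N grr h w with hg
  set Φ : (Fin 3 → ℝ) → ℂ := fun y => modeKernel ω k G y x' with hΦ
  have hd0 : ∀ y, partialD 0 Φ y = Complex.I * ω * Φ y := fun y => by
    simpa using partialD_zero_mul_modeKernel (fun _ => 1) ω k G y x'
  have hd2 : ∀ y, partialD 2 Φ y = Complex.I * k * Φ y := fun y => by
    simpa using partialD_two_mul_modeKernel (fun _ => 1) ω k G y x'
  let vol : ℝ → ℂ := fun r => (N r * Real.sqrt (grr r) * Real.sqrt (h r) : ℝ)
  have hvol : ∀ y : Fin 3 → ℝ, y 1 ∈ Ioi a → (volDensity g y : ℂ) = vol (y 1) := fun y hy => by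
    rw [hg, volDensity_sectionMetric (H.lapse_pos _ hy) (H.rr_pos _ hy) (H.angular_pos _ hy)]
  have hinv := fun (y : Fin 3 → ℝ) (hy : y 1 ∈ Ioi a) => sectionMetric_inv (w := w) (y := y)
    (H.lapse_pos _ hy).ne' (H.rr_pos _ hy).ne' (H.angular_pos _ hy).ne'
  rw [← hg] at hinv
  have hsum0 : ∀ y : Fin 3 → ℝ, y 1 ∈ Ioi a →
      (volDensity g y : ℂ) * ∑ ν, (g y)⁻¹ 0 ν * partialD ν Φ y =
        (vol (y 1) * (Complex.I * ω + Complex.I * w (y 1) * (Complex.I * k)) /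
          (N (y 1) : ℂ) ^ 2) * Φ y := fun y hy => by
    rw [hvol y hy, Fin.sum_univ_three, hinv y hy, hd0, hd2]
    simp
    ring
  have hsum2 : ∀ y : Fin 3 → ℝ, y 1 ∈ Ioi a →
      (volDensity g y : ℂ) * ∑ ν, (g y)⁻¹ 2 ν * partialD ν Φ y =
        (vol (y 1) * (Complex.I * w (y 1) * (Complex.I * ω) / (N (y 1) : ℂ) ^ 2 +
          (1 / h (y 1) - (w (y 1) : ℂ) ^ 2 / (N (y 1) : ℂ) ^ 2) * (Complex.I * k))) * Φ y :=
    fun y hy => by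
    rw [hvol y hy, Fin.sum_univ_three, hinv y hy, hd0, hd2]
    simp
    ring
  have hsum1 : ∀ y : Fin 3 → ℝ, y 1 ∈ Ioi a →
      (volDensity g y : ℂ) * ∑ ν, (g y)⁻¹ 1 ν * partialD ν Φ y =
        modePhase ω k y x' *
          ((radialCoeff N grr h (y 1) : ℂ) * deriv (fun r => G r (x' 1)) (y 1)) :=
    fun y hy => by
    rw [← volDensity_mul_inv_rr (w := w) (H.lapse_pos _ hy) (H.rr_pos _ hy) (H.angular_pos _ hy),
      ← hg, Fin.sum_univ_three, hΦ, partialD_one_modeKernel, hinv y hy]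
    simp
    ring
  have e0 : partialD 0 (fun y => (volDensity g y : ℂ) * ∑ ν, (g y)⁻¹ 0 ν * partialD ν Φ y) x =
      (vol (x 1) * (Complex.I * ω + Complex.I * w (x 1) * (Complex.I * k)) /
          (N (x 1) : ℂ) ^ 2) * (Complex.I * ω * Φ x) := by
    rw [← partialD_zero_mul_modeKernel (fun r => vol r * (Complex.I * ω + Complex.I * w r *
      (Complex.I * k)) / (N r : ℂ) ^ 2)]
    exact partialD_congr (Eventually.of_forall fun t => hsum0 _ (by simpa using hx))
  have e2 : partialD 2 (fun y => (volDensity g y : ℂ) * ∑ ν, (g y)⁻¹ 2 ν * partialD ν Φ y) x =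
      (vol (x 1) * (Complex.I * w (x 1) * (Complex.I * ω) / (N (x 1) : ℂ) ^ 2 +
          (1 / h (x 1) - (w (x 1) : ℂ) ^ 2 / (N (x 1) : ℂ) ^ 2) * (Complex.I * k))) *
        (Complex.I * k * Φ x) := by
    rw [← partialD_two_mul_modeKernel (fun r => vol r * (Complex.I * w r * (Complex.I * ω) /
      (N r : ℂ) ^ 2 + (1 / h r - (w r : ℂ) ^ 2 / (N r : ℂ) ^ 2) * (Complex.I * k)))]
    exact partialD_congr (Eventually.of_forall fun t => hsum2 _ (by simpa using hx))
  have e1 : partialD 1 (fun y => (volDensity g y : ℂ) * ∑ ν, (g y)⁻¹ 1 ν * partialD ν Φ y) x =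
      modePhase ω k x x' *
        deriv (fun r => (radialCoeff N grr h r : ℂ) * deriv (fun r => G r (x' 1)) r) (x 1) := by
    rw [← deriv_const_mul_field]
    refine Filter.EventuallyEq.deriv_eq ?_
    filter_upwards [Ioi_mem_nhds hx] with t ht
    refine (hsum1 _ (by simpa using ht)).trans ?_
    simp [modePhase]
  have hN' : (N (x 1) : ℂ) ≠ 0 := Complex.ofReal_ne_zero.2 (H.lapse_pos _ hx).ne'
  have hh' : (h (x 1) : ℂ) ≠ 0 := Complex.ofReal_ne_zero.2 (H.angular_pos _ hx).ne'
  have hp' : (radialCoeff N grr h (x 1) : ℂ) ≠ 0 :=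
    Complex.ofReal_ne_zero.2 (H.radialCoeff_pos hx).ne'
  have hpv : (radialCoeff N grr h (x 1) : ℂ) * vol (x 1) = (N (x 1) : ℂ) ^ 2 * h (x 1) := by
    rw [← hvol x hx]
    exact_mod_cast radialCoeff_mul_volDensity (w := w) (H.lapse_pos _ hx) (H.rr_pos _ hx)
      (H.angular_pos _ hx)
  have hv0 : vol (x 1) ≠ 0 := fun h0 => by
    rw [h0, mul_zero] at hpv
    exact mul_ne_zero (pow_ne_zero 2 hN') hh' hpv.symm
  -- With `p` eliminated in favour of the volume density the final identity is rational in `N`, `h`,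
  -- `w` and `vol`.
  have hp1 : (radialCoeff N grr h (x 1) : ℂ) = (N (x 1) : ℂ) ^ 2 * h (x 1) / vol (x 1) := by
    rw [← hpv]; field_simp
  have hΦx : Φ x = modePhase ω k x x' * G (x 1) (x' 1) := rfl
  rw [kleinGordon, Fin.sum_univ_three, e0, e1, e2, hΦx, hvol x hx]
  set D := deriv (fun r => (radialCoeff N grr h r : ℂ) * deriv (fun r => G r (x' 1)) r) (x 1)
  rw [hp1, radialPotential]
  have hI := Complex.I_sq
  field_simp
  ring_nf
  simp only [show Complex.I ^ 3 = -Complex.I by rw [pow_succ, hI]; ring, hI]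
  ring

end Operator

/-! ### Radial Green's functions -/

/-- A Green's function of the radial equation `p (p u')' = V u`, without boundary conditions. -/
structure IsRadialGreenFn (p : ℝ → ℝ) (V : ℝ → ℂ) (S : Set ℝ) (G : ℝ → ℝ → ℂ) : Prop where
  continuousOn : ∀ r' ∈ S, ContinuousOn (fun r => G r r') S
  sol : ∀ r' ∈ S, IsRadialSol p V (S \ {r'}) (fun r => G r r')
    (fun r => p r * deriv (fun r => G r r') r)
  jump : ∀ r' ∈ S, ∃ a b : ℂ, Tendsto (deriv fun r => G r r') (𝓝[<] r') (𝓝 a) ∧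
    Tendsto (deriv fun r => G r r') (𝓝[>] r') (𝓝 b) ∧ (p r' : ℂ) * (b - a) = -1

/-- Bootstrapping: `v' = V u / p` is continuous, so `v` is `C¹`; hence `u' = v / p` is `C¹`. -/
lemma IsRadialSol.contDiffOn_two {p : ℝ → ℝ} {V u v : ℝ → ℂ} {S : Set ℝ} (hS : IsOpen S)
    (h : IsRadialSol p V S u v) (hp : ContDiffOn ℝ 1 p S) (hp0 : ∀ r ∈ S, p r ≠ 0)
    (hV : ContinuousOn V S) : ContDiffOn ℝ 2 u S := by
  have hpc : ContDiffOn ℝ 1 (fun r => (p r : ℂ)) S :=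
    Complex.ofRealCLM.contDiff.comp_contDiffOn hp
  have hp0' : ∀ r ∈ S, (p r : ℂ) ≠ 0 := fun r hr => Complex.ofReal_ne_zero.2 (hp0 r hr)
  have hv : ContDiffOn ℝ 1 v S := by
    rw [show (1 : WithTop ℕ∞) = 0 + 1 by simp, contDiffOn_succ_iff_deriv_of_isOpen hS]
    refine ⟨fun r hr => (h.snd r hr).differentiableAt.differentiableWithinAt, by simp, ?_⟩
    rw [contDiffOn_zero]
    exact ((hV.mul h.continuousOn_fst).div hpc.continuousOn hp0').congr
      fun r hr => (h.snd r hr).deriv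
  rw [show (2 : WithTop ℕ∞) = 1 + 1 by norm_num, contDiffOn_succ_iff_deriv_of_isOpen hS]
  refine ⟨fun r hr => (h.fst r hr).differentiableAt.differentiableWithinAt, by simp, ?_⟩
  exact (hv.mul (hpc.inv hp0')).congr fun r hr => by
    rw [(h.fst r hr).deriv, div_eq_mul_inv]; rfl

section Sections

variable {N grr h w : ℝ → ℝ} {a : ℝ} {S : Set ℝ} {m ω : ℝ} {k : ℤ} {G : ℝ → ℝ → ℂ}

/-- Mode Green's functions of a section are Green's functions of its radial equation. -/
theorem IsSection.isRadialGreenFn (H : IsSection N grr h w a) (hS : IsOpen S) (hSa : S ⊆ Ioi a)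
    (hG : IsModeGreen (sectionMetric N grr h w) S m ω k G) :
    IsRadialGreenFn (radialCoeff N grr h) (radialPotential N h w m ω k) S G := by
  refine ⟨hG.continuousOn, fun r' hr' => ?_, fun r' hr' => ?_⟩
  · have hSo : IsOpen (S \ {r'}) := hS.sdiff isClosed_singleton
    have hc := hG.contDiffOn r' hr'
    rw [show (2 : WithTop ℕ∞) = 1 + 1 by norm_num, contDiffOn_succ_iff_deriv_of_isOpen hSo] at hc
    have hp0 : ∀ r ∈ S, (radialCoeff N grr h r : ℂ) ≠ 0 := fun r hr =>
      Complex.ofReal_ne_zero.2 (H.radialCoeff_pos (hSa hr)).ne'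
    constructor
    · intro r hr
      refine ((hc.1 r hr).differentiableAt (hSo.mem_nhds hr)).hasDerivAt.congr_deriv ?_
      rw [mul_div_cancel_left₀ _ (hp0 r hr.1)]
    · intro r hr
      have hd : DifferentiableAt ℝ
          (fun r => (radialCoeff N grr h r : ℂ) * deriv (fun r => G r r') r) r := by
        refine DifferentiableAt.mul ?_ ((hc.2.2.differentiableOn (by simp) r hr).differentiableAt
          (hSo.mem_nhds hr))
        exact Complex.ofRealCLM.differentiableAt.comp r
          ((H.contDiffOn_radialCoeff.differentiableOn (by simp) r (hSa hr.1)).differentiableAt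
            (Ioi_mem_nhds (hSa hr.1)))
      refine hd.hasDerivAt.congr_deriv ?_
      -- Any `τ` and `θ` would do: the phase and the volume factor do not vanish and can be
      -- cancelled.
      have he := hG.equation ![0, r, 0] ![0, r', 0] hr.1 hr' hr.2
      rw [H.kleinGordon_modeKernel m ω k G (hSa hr.1 : (![0, r, 0] : Fin 3 → ℝ) 1 ∈ Ioi a)] at he
      have hv : (volDensity (sectionMetric N grr h w) ![0, r, 0] : ℂ)⁻¹ ≠ 0 := by
        have := radialCoeff_mul_volDensity (w := w) (y := ![0, r, 0])
          (H.lapse_pos r (hSa hr.1)) (H.rr_pos r (hSa hr.1)) (H.angular_pos r (hSa hr.1))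
        refine inv_ne_zero (Complex.ofReal_ne_zero.2 fun h0 => ?_)
        rw [h0, mul_zero] at this
        exact (mul_pos (pow_pos (H.lapse_pos r (hSa hr.1)) 2)
          (H.angular_pos r (hSa hr.1))).ne this
      have hm : modePhase ω k ![0, r, 0] ![0, r', 0] ≠ 0 :=
        mul_ne_zero (Complex.exp_ne_zero _) (Complex.exp_ne_zero _)
      rw [mul_eq_zero_iff_left hv, mul_eq_zero_iff_left hm, sub_eq_zero] at he
      exact he
  · obtain ⟨x, y, h1, h2, h3⟩ := hG.jump ![0, r', 0] hr'
    refine ⟨x, y, h1, h2, ?_⟩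
    rw [volDensity_mul_inv_rr (H.lapse_pos r' (hSa hr')) (H.rr_pos r' (hSa hr'))
      (H.angular_pos r' (hSa hr'))] at h3
    exact h3

/-- Green's functions of the radial equation of a section are mode Green's functions. -/
theorem IsSection.isModeGreen (H : IsSection N grr h w a) (hS : IsOpen S) (hSa : S ⊆ Ioi a)
    (hG : IsRadialGreenFn (radialCoeff N grr h) (radialPotential N h w m ω k) S G) :
    IsModeGreen (sectionMetric N grr h w) S m ω k G := by
  refine ⟨hG.continuousOn, fun r' hr' => ?_, fun x x' hx hx' hne => ?_, fun x' hx' => ?_⟩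
  · have hsub : S \ {r'} ⊆ Ioi a := fun r hr => hSa hr.1
    exact (hG.sol r' hr').contDiffOn_two (hS.sdiff isClosed_singleton)
      ((H.contDiffOn_radialCoeff.of_le (by norm_cast)).mono hsub)
      (fun r hr => (H.radialCoeff_pos (hsub hr)).ne')
      ((H.contDiffOn_radialPotential m ω k).continuousOn.mono hsub)
  · rw [H.kleinGordon_modeKernel m ω k G (hSa hx), ((hG.sol _ hx').snd _ ⟨hx, hne⟩).deriv,
      sub_self, mul_zero, mul_zero]
  · obtain ⟨x, y, h1, h2, h3⟩ := hG.jump _ hx'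
    refine ⟨x, y, h1, h2, ?_⟩
    rw [volDensity_mul_inv_rr (H.lapse_pos _ (hSa hx')) (H.rr_pos _ (hSa hx'))
      (H.angular_pos _ (hSa hx'))]
    exact h3

end Sections

/-! ### Green's functions built from two solutions, and their differences -/

/-- The kernel `u(r_<) x(r_>) / W`. -/
noncomputable def greenKernel (u x : ℝ → ℂ) (W : ℂ) (r r' : ℝ) : ℂ :=
  u (min r r') * x (max r r') / W

lemma greenKernel_of_le {u x : ℝ → ℂ} {W : ℂ} {r r' : ℝ} (h : r ≤ r') :
    greenKernel u x W r r' = u r * (x r' / W) := by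
  rw [greenKernel, min_eq_left h, max_eq_right h, mul_div_assoc]

lemma greenKernel_of_ge {u x : ℝ → ℂ} {W : ℂ} {r r' : ℝ} (h : r' ≤ r) :
    greenKernel u x W r r' = u r' / W * x r := by
  rw [greenKernel, min_eq_right h, max_eq_left h]
  ring

section Kernel

variable {p : ℝ → ℝ} {V u v x y : ℝ → ℂ} {S : Set ℝ} {W : ℂ}

lemma IsRadialSol.hasDerivAt_greenKernel_of_lt (hu : IsRadialSol p V S u v) {r r' : ℝ} (hr : r ∈ S)
    (hlt : r < r') :
    HasDerivAt (fun r => greenKernel u x W r r') (v r / p r * (x r' / W)) r := by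
  refine ((hu.fst r hr).mul_const _).congr_of_eventuallyEq ?_
  filter_upwards [Iio_mem_nhds hlt] with s hs
  exact greenKernel_of_le (le_of_lt hs)

lemma IsRadialSol.hasDerivAt_greenKernel_of_gt (hx : IsRadialSol p V S x y) {r r' : ℝ} (hr : r ∈ S)
    (hlt : r' < r) :
    HasDerivAt (fun r => greenKernel u x W r r') (u r' / W * (y r / p r)) r := by
  refine ((hx.fst r hr).const_mul _).congr_of_eventuallyEq ?_
  filter_upwards [Ioi_mem_nhds hlt] with s hs
  exact greenKernel_of_ge (le_of_lt hs)

/-- On either side of `r'` the kernel is a multiple of one solution. With this sign of `W` the jump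
of the derivative times `p` is `(u y - v x) / W = -1`. -/
theorem isRadialGreenFn_greenKernel (hS : IsOpen S) (hpc : ContinuousOn p S)
    (hp0 : ∀ r ∈ S, 0 < p r) (hu : IsRadialSol p V S u v) (hx : IsRadialSol p V S x y)
    (hW : ∀ r ∈ S, v r * x r - u r * y r = W) (hW0 : W ≠ 0) :
    IsRadialGreenFn p V S (greenKernel u x W) := by
  have hp0' : ∀ r ∈ S, (p r : ℂ) ≠ 0 := fun r hr => Complex.ofReal_ne_zero.2 (hp0 r hr).ne'
  have hpc' : ContinuousOn (fun r => (p r : ℂ)) S := Complex.continuous_ofReal.comp_continuousOn hpc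
  refine ⟨fun r' hr' => ?_, fun r' hr' => ⟨fun r hr => ?_, fun r hr => ?_⟩, fun r' hr' => ?_⟩
  · refine ((hu.continuousOn_fst.comp (by fun_prop) ?_).mul
      (hx.continuousOn_fst.comp (by fun_prop) ?_)).div_const W
    · intro r hr
      rcases min_choice r r' with h | h <;> simp only [h] <;> assumption
    · intro r hr
      rcases max_choice r r' with h | h <;> simp only [h] <;> assumption
  · rcases lt_or_gt_of_ne (mem_singleton_iff.not.1 hr.2) with h | h
    · have := hu.hasDerivAt_greenKernel_of_lt (x := x) (W := W) hr.1 h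
      rw [this.deriv, mul_div_cancel_left₀ _ (hp0' r hr.1)]
      exact this
    · have := hx.hasDerivAt_greenKernel_of_gt (u := u) (W := W) hr.1 h
      rw [this.deriv, mul_div_cancel_left₀ _ (hp0' r hr.1)]
      exact this
  · rcases lt_or_gt_of_ne (mem_singleton_iff.not.1 hr.2) with h | h
    · have := ((hu.snd r hr.1).mul_const (x r' / W)).congr_of_eventuallyEq
        (f₁ := fun r => p r * deriv (fun r => greenKernel u x W r r') r) (by
          filter_upwards [Iio_mem_nhds h, hS.mem_nhds hr.1] with s hs hsS
          rw [(hu.hasDerivAt_greenKernel_of_lt hsS hs).deriv]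
          have := hp0' s hsS
          field_simp)
      refine this.congr_deriv ?_
      rw [greenKernel_of_le h.le]
      ring
    · have := ((hx.snd r hr.1).const_mul (u r' / W)).congr_of_eventuallyEq
        (f₁ := fun r => p r * deriv (fun r => greenKernel u x W r r') r) (by
          filter_upwards [Ioi_mem_nhds h, hS.mem_nhds hr.1] with s hs hsS
          rw [(hx.hasDerivAt_greenKernel_of_gt hsS hs).deriv]
          have := hp0' s hsS
          field_simp)
      refine this.congr_deriv ?_
      rw [greenKernel_of_ge h.le]
      ring
  · have hSn := hS.mem_nhds hr'
    have hpr := hp0' r' hr'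
    refine ⟨v r' / p r' * (x r' / W), u r' / W * (y r' / p r'), ?_, ?_, ?_⟩
    · have hc : ContinuousAt (fun r => v r / p r * (x r' / W)) r' :=
        ((hu.snd r' hr').continuousAt.div (hpc'.continuousAt hSn) hpr).mul continuousAt_const
      refine (hc.tendsto.mono_left nhdsWithin_le_nhds).congr' ?_
      filter_upwards [self_mem_nhdsWithin, mem_nhdsWithin_of_mem_nhds hSn] with s hs hsS
      exact (hu.hasDerivAt_greenKernel_of_lt hsS hs).deriv.symm
    · have hc : ContinuousAt (fun r => u r' / W * (y r / p r)) r' :=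
        continuousAt_const.mul ((hx.snd r' hr').continuousAt.div (hpc'.continuousAt hSn) hpr)
      refine (hc.tendsto.mono_left nhdsWithin_le_nhds).congr' ?_
      filter_upwards [self_mem_nhdsWithin, mem_nhdsWithin_of_mem_nhds hSn] with s hs hsS
      exact (hx.hasDerivAt_greenKernel_of_gt hsS hs).deriv.symm
    · have h1 := hW r' hr'
      field_simp
      linear_combination -h1

/-- The difference of two Green's functions solves the radial equation. -/
theorem IsRadialGreenFn.exists_sub_eq {a : ℝ} {G G' : ℝ → ℝ → ℂ} {u₁ v₁ u₂ v₂ : ℝ → ℂ}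
    (hG : IsRadialGreenFn p V S G) (hG' : IsRadialGreenFn p V S G') (hS : IsOpen S)
    (hSc : S.OrdConnected) (hSa : S ⊆ Ioi a) (hpc : ContinuousOn p S) (hp0 : ∀ r ∈ S, 0 < p r)
    (H : IsFundamental p V a u₁ v₁ u₂ v₂) {r' : ℝ} (hr' : r' ∈ S) :
    ∃ c₁ c₂ : ℂ, ∀ s ∈ S, G' s r' - G s r' = c₁ * u₁ s + c₂ * u₂ s := by
  obtain ⟨l, b, hl, hb, hj⟩ := hG.jump r' hr'
  obtain ⟨l', b', hl', hb', hj'⟩ := hG'.jump r' hr'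
  have hp0' : (p r' : ℂ) ≠ 0 := Complex.ofReal_ne_zero.2 (hp0 r' hr').ne'
  -- Both functions have the same jump, so the derivative of their difference has equal limits from
  -- the two sides.
  have hjump : l' - l = b' - b := by
    refine mul_left_cancel₀ hp0' ?_
    linear_combination hj - hj'
  have hSn := hS.mem_nhds hr'
  set d : ℝ → ℂ := fun s => G' s r' - G s r' with hd
  set e : ℝ → ℂ := fun s => p s * deriv (fun r => G' r r') s - p s * deriv (fun r => G r r') s
    with he
  have hsol : IsRadialSol p V (S \ {r'}) d e := by
    have := (hG'.sol r' hr').comb (hG.sol r' hr') 1 (-1)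
    simpa [hd, he, sub_eq_add_neg] using this
  have hdc : ContinuousAt d r' :=
    ((hG'.continuousOn r' hr').continuousAt hSn).sub ((hG.continuousOn r' hr').continuousAt hSn)
  have hpcc : ContinuousAt (fun r => (p r : ℂ)) r' :=
    Complex.continuous_ofReal.continuousAt.comp (hpc.continuousAt hSn)
  -- On each side the difference is a combination of the fundamental solutions, with coefficients
  -- determined by the limits of its value and of its weighted derivative at `r'`. These limits
  -- agree, so one combination serves on both sides and at `r'` itself.
  have hside : ∀ (T : Set ℝ) (q : ℂ), IsOpen T → T.OrdConnected → r' ∉ T → (𝓝[T] r').NeBot →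
      Tendsto (deriv fun r => G r r') (𝓝[T] r') (𝓝 q) →
      Tendsto (deriv fun r => G' r r') (𝓝[T] r') (𝓝 (q + (l' - l))) →
      ∀ s ∈ S ∩ T, d s = (d r' * v₂ r' - u₂ r' * (p r' * (l' - l))) * u₁ s +
        (u₁ r' * (p r' * (l' - l)) - d r' * v₁ r') * u₂ s := by
    intro T q hT hTc hrT hne hq hq'
    have hsub : S ∩ T ⊆ S \ {r'} := fun s hs => ⟨hs.1, fun h => hrT (h ▸ hs.2)⟩
    obtain ⟨c₁, c₂, hc⟩ := H.exists_comb (hS.inter hT) (hSc.inter hTc).isPreconnected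
      (fun s hs => hSa hs.1) (hsol.mono hsub)
    have hmem : ∀ᶠ s in 𝓝[T] r', s ∈ S ∩ T := by
      filter_upwards [self_mem_nhdsWithin, mem_nhdsWithin_of_mem_nhds hSn] with s h1 h2
      exact ⟨h2, h1⟩
    have hcont : ∀ f : ℝ → ℂ, ContinuousAt f r' → Tendsto f (𝓝[T] r') (𝓝 (f r')) := fun f hf =>
      hf.tendsto.mono_left nhdsWithin_le_nhds
    have hra := hSa hr'
    have hu₁ := hcont u₁ (H.sol₁.fst r' hra).continuousAt
    have hu₂ := hcont u₂ (H.sol₂.fst r' hra).continuousAt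
    have hv₁ := hcont v₁ (H.sol₁.snd r' hra).continuousAt
    have hv₂ := hcont v₂ (H.sol₂.snd r' hra).continuousAt
    have e1 : d r' = c₁ * u₁ r' + c₂ * u₂ r' := by
      refine tendsto_nhds_unique (hcont d hdc) ?_
      refine ((hu₁.const_mul c₁).add (hu₂.const_mul c₂)).congr' ?_
      filter_upwards [hmem] with s hs
      exact (hc s hs).1.symm
    have e2 : (p r' : ℂ) * (l' - l) = c₁ * v₁ r' + c₂ * v₂ r' := by
      have h1 : Tendsto e (𝓝[T] r') (𝓝 (p r' * (q + (l' - l)) - p r' * q)) :=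
        ((hcont _ hpcc).mul hq').sub ((hcont _ hpcc).mul hq)
      rw [show (p r' : ℂ) * (q + (l' - l)) - p r' * q = p r' * (l' - l) by ring] at h1
      refine tendsto_nhds_unique h1 ?_
      refine ((hv₁.const_mul c₁).add (hv₂.const_mul c₂)).congr' ?_
      filter_upwards [hmem] with s hs
      exact (hc s hs).2.symm
    intro s hs
    rw [(hc s hs).1, e1, e2]
    have hw := H.wronskian r' hra
    linear_combination (-c₁ * u₁ s - c₂ * u₂ s) * hw
  refine ⟨d r' * v₂ r' - u₂ r' * (p r' * (l' - l)),
    u₁ r' * (p r' * (l' - l)) - d r' * v₁ r', fun s hs => ?_⟩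
  rcases lt_trichotomy s r' with h | rfl | h
  · exact hside (Iio r') l isOpen_Iio ordConnected_Iio (by simp) inferInstance hl
      (by rwa [add_sub_cancel]) s ⟨hs, h⟩
  · exact H.fst_eq (hSa hr') (d s) _
  · exact hside (Ioi r') b isOpen_Ioi ordConnected_Ioi (by simp) inferInstance hb
      (by rw [hjump]; rwa [add_sub_cancel]) s ⟨hs, h⟩

end Kernel

/-! ### Regularity at the inner end point, Dirichlet condition at the outer one -/

section Nonvanishing

variable {p : ℝ → ℝ} {V u v : ℝ → ℂ} {a b : ℝ}

lemma IsRadialSol.snd_eq_zero_of_eventually {S : Set ℝ} (h : IsRadialSol p V S u v) {r : ℝ}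
    (hr : r ∈ S) (hp : p r ≠ 0) (h0 : ∀ᶠ s in 𝓝 r, u s = 0) : v r = 0 := by
  have h1 := (h.fst r hr).unique ((hasDerivAt_const r (0 : ℂ)).congr_of_eventuallyEq h0)
  rcases div_eq_zero_iff.1 h1 with h2 | h2
  · exact h2
  · exact absurd (Complex.ofReal_eq_zero.1 h2) hp

/-- A non-trivial solution with outgoing flux has no zeros. -/
lemma IsRadialSol.fst_ne_zero (h : IsRadialSol p V (Ioi a) u v) (hp0 : ∀ r ∈ Ioi a, 0 < p r)
    (h0 : IsNontrivial a u v) (hj : ∀ r ∈ Ioc a b, 0 ≤ (flux u v r).re) :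
    ∀ r ∈ Ioc a b, u r ≠ 0 := by
  intro r hr hur
  have hz : ∀ s ∈ Ioo a r, u s = 0 := by
    intro s hs
    have := h.norm_fst_le hs.2.le (fun x hx => hs.1.trans_le hx.1)
      (fun x hx => hp0 x (hs.1.trans_le hx.1))
      (fun x hx => hj x ⟨hs.1.trans_le hx.1, hx.2.trans hr.2⟩)
    rw [hur, norm_zero] at this
    exact norm_le_zero_iff.1 this
  obtain ⟨s, hs⟩ := nonempty_Ioo.2 hr.1
  refine h0 s hs.1 ⟨hz s hs, h.snd_eq_zero_of_eventually hs.1 (hp0 s hs.1).ne' ?_⟩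
  filter_upwards [isOpen_Ioo.mem_nhds hs] with t ht using hz t ht

/-- A non-trivial solution with ingoing flux has no zeros before the end point. -/
lemma IsRadialSol.fst_ne_zero' (h : IsRadialSol p V (Ioi a) u v) (hp0 : ∀ r ∈ Ioi a, 0 < p r)
    (h0 : IsNontrivial a u v) (hj : ∀ r ∈ Ioc a b, (flux u v r).re ≤ 0) :
    ∀ r ∈ Ioo a b, u r ≠ 0 := by
  intro r hr hur
  have hz : ∀ s ∈ Ioo r b, u s = 0 := by
    intro s hs
    have := h.normSq_ge hs.1.le (fun x hx => hr.1.trans_le hx.1)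
      (fun x hx => hp0 x (hr.1.trans_le hx.1))
      (fun x hx => hj x ⟨hr.1.trans_le hx.1, hx.2.trans hs.2.le⟩)
    rw [hur, map_zero] at this
    exact Complex.normSq_eq_zero.1 (le_antisymm this (Complex.normSq_nonneg _))
  obtain ⟨s, hs⟩ := nonempty_Ioo.2 hr.2
  have hsa : a < s := hr.1.trans hs.1
  refine h0 s hsa ⟨hz s hs, h.snd_eq_zero_of_eventually hsa (hp0 s hsa).ne' ?_⟩
  filter_upwards [isOpen_Ioo.mem_nhds hs] with t ht using hz t ht

lemma isNontrivial_of_ne_zero (E : IsRadialEq p V a) (h : IsRadialSol p V (Ioi a) u v) {s : ℝ}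
    (hs : a < s) (h0 : ¬(u s = 0 ∧ v s = 0)) : IsNontrivial a u v := fun _ hr ⟨h1, h2⟩ =>
  h0 (h.eq_zero E.continuousOn_coeff E.coeff_pos E.continuousOn_potential hr h1 h2 hs)

end Nonvanishing

/-- A pair of independent solutions, with Wronskian `W`, from which a Green's function is built. -/
structure IsGreenPair (p : ℝ → ℝ) (V : ℝ → ℂ) (a : ℝ) (u v x y : ℝ → ℂ) (W : ℂ) : Prop where
  fst : IsRadialSol p V (Ioi a) u v
  snd : IsRadialSol p V (Ioi a) x y
  wronskian : ∀ r ∈ Ioi a, v r * x r - u r * y r = W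
  ne_zero : W ≠ 0

section Mirror

variable {p : ℝ → ℝ} {V : ℝ → ℂ} {a b : ℝ}

/-- The regular solution comes from the Neumann limit, the other from the data `(0, 1)` at the
mirror. Their Wronskian, evaluated at `b`, is `-u b`, which is nonzero because a non-trivial
solution with non-negative real flux has no zeros. -/
lemma exists_mirror_pair (E : IsRadialEq p V a) (hab : a < b) (hV : ∀ r ∈ Ioc a b, 0 ≤ (V r).re) :
    ∃ u v x y W, IsGreenPair p V a u v x y W ∧ x b = 0 ∧
      (∀ r ∈ Ioc a b, u r ≠ 0 ∧ 0 ≤ (flux u v r).re) ∧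
      (∀ r ∈ Ioo a b, x r ≠ 0 ∧ (flux x y r).re ≤ 0) := by
  obtain ⟨u, v, hu, hu0, hju⟩ := exists_sol_re_flux_nonneg E hab hV
  obtain ⟨x, y, hx, hxb, hyb⟩ := exists_isRadialSol E.continuousOn_coeff E.coeff_pos
    E.continuousOn_potential hab 0 1
  have hun := hu.fst_ne_zero E.coeff_pos hu0 hju
  have hjx : ∀ r ∈ Ioc a b, (flux x y r).re ≤ 0 := by
    intro r hr
    have := hx.re_flux_le hr.2 (fun s hs => hr.1.trans_le hs.1)
      (fun s hs => E.coeff_pos s (hr.1.trans_le hs.1))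
      (fun s hs => hV s ⟨hr.1.trans_le hs.1, hs.2⟩)
    simpa [flux, hxb] using this
  have hxn := hx.fst_ne_zero' E.coeff_pos
    (isNontrivial_of_ne_zero E hx hab (by simp [hyb])) hjx
  refine ⟨u, v, x, y, -u b, ⟨hu, hx, fun r hr => ?_, neg_ne_zero.2 (hun b ⟨hab, le_rfl⟩)⟩, hxb,
    fun r hr => ⟨hun r hr, hju r hr⟩, fun r hr => ⟨hxn r hr, hjx r ⟨hr.1, hr.2.le⟩⟩⟩
  have := hu.wronskian_const hx isOpen_Ioi isPreconnected_Ioi hr (mem_Ioi.2 hab)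
  rw [hxb, hyb] at this
  linear_combination -this

/-- A solution that is bounded at the left end point and vanishes at the mirror is trivial. -/
lemma IsRadialSol.eq_zero_of_bounded_of_dirichlet {u v : ℝ → ℂ} (E : IsRadialEq p V a)
    (hp : DivergesAt p a) (hab : a < b) (hV : ∀ r ∈ Ioc a b, 0 ≤ (V r).re)
    (h : IsRadialSol p V (Ioi a) u v) {C : ℝ} (hC : ∀ᶠ r in 𝓝[>] a, ‖u r‖ ≤ C)
    (hb : Tendsto u (𝓝[<] b) (𝓝 0)) : ∀ r ∈ Ioo a b, u r = 0 := by
  have hj := h.re_flux_nonneg_of_bounded E.coeff_pos hp hV hC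
  have hub : u b = 0 := tendsto_nhds_unique
    ((h.fst b hab).continuousAt.tendsto.mono_left nhdsWithin_le_nhds) hb
  intro r hr
  have := h.norm_fst_le hr.2.le (fun x hx => hr.1.trans_le hx.1)
    (fun x hx => E.coeff_pos x (hr.1.trans_le hx.1)) (fun x hx => hj x ⟨hr.1.trans_le hx.1, hx.2⟩)
  rw [hub, norm_zero] at this
  exact norm_le_zero_iff.1 this

end Mirror

/-! ### The black hole -/

namespace StationaryBlackHole

variable (B : StationaryBlackHole)

lemma isSection : IsSection B.lapse B.grr B.gθθ (fun r => B.shift r + B.ΩH) B.rPlus :=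
  ⟨B.contDiff_lapse, B.contDiff_grr, B.contDiff_gθθ, B.contDiff_shift.add contDiffOn_const,
    B.lapse_pos, B.grr_pos, B.gθθ_pos⟩

/-- The coefficient of the radial equation of the black hole. -/
noncomputable abbrev coeff : ℝ → ℝ := radialCoeff B.lapse B.grr B.gθθ

/-- The potential of the radial equation of the black hole. -/
noncomputable abbrev potential (m : ℝ) (n k : ℤ) : ℝ → ℂ :=
  radialPotential B.lapse B.gθθ (fun r => B.shift r + B.ΩH) m (B.κ * n) k

end StationaryBlackHole

lemma radialPotential_eq (N h w : ℝ → ℝ) (m ω : ℝ) (k : ℤ) (r : ℝ) :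
    radialPotential N h w m ω k r =
      ((h r * ω ^ 2 + (N r ^ 2 - h r * w r ^ 2) * k ^ 2 + m ^ 2 * N r ^ 2 * h r : ℝ) : ℂ) +
        ((2 * h r * ω * k * w r : ℝ) : ℂ) * Complex.I := by
  rw [radialPotential]
  push_cast
  linear_combination (h r * k ^ 2 * w r ^ 2 : ℂ) * Complex.I_sq

lemma radialPotential_re (N h w : ℝ → ℝ) (m ω : ℝ) (k : ℤ) (r : ℝ) :
    (radialPotential N h w m ω k r).re =
      h r * ω ^ 2 + (N r ^ 2 - h r * w r ^ 2) * k ^ 2 + m ^ 2 * N r ^ 2 * h r := by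
  rw [radialPotential_eq, Complex.add_re, Complex.ofReal_re, Complex.re_ofReal_mul,
    Complex.I_re, mul_zero, add_zero]

lemma radialPotential_im (N h w : ℝ → ℝ) (m ω : ℝ) (k : ℤ) (r : ℝ) :
    (radialPotential N h w m ω k r).im = 2 * h r * ω * k * w r := by
  rw [radialPotential_eq, Complex.add_im, Complex.ofReal_im, Complex.im_ofReal_mul,
    Complex.I_im, mul_one, zero_add]

namespace StationaryBlackHole

variable {B : StationaryBlackHole} {rM : ℝ}

lemma IsMirror.potential_re_nonneg (hM : B.IsMirror rM) (m : ℝ) (n k : ℤ) :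
    ∀ r ∈ Ioc B.rPlus rM, 0 ≤ (B.potential m n k r).re := by
  intro r hr
  have h1 := hM.2 r hr
  have h2 := B.gθθ_pos r hr.1
  rw [radialPotential_re]
  have h3 : 0 ≤ (B.lapse r ^ 2 - B.gθθ r * (B.shift r + B.ΩH) ^ 2) * (k : ℝ) ^ 2 :=
    mul_nonneg (by linarith) (sq_nonneg _)
  positivity

/-- The horizon is at infinite distance in the coordinate `∫ dr / p`. -/
lemma IsMirror.divergesAt (hM : B.IsMirror rM) : DivergesAt B.coeff B.rPlus := by
  obtain ⟨h₀, hh₀, hlim⟩ := B.gθθ_tendsto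
  obtain ⟨C, hC⟩ := B.shift_isBigO.bound
  set f : ℝ → ℝ := fun s => Real.sqrt (B.lapse s ^ 2 - B.gθθ s * (B.shift s + B.ΩH) ^ 2) with hf
  have hκ := B.κ_pos
  -- Chosen so that `g_θθ (N^θ + Ω_H)² ≤ 3/4 N²` near the horizon, whence the norm `f` of the
  -- generator is at least `N / 2`.
  have hN4 : ∀ᶠ r in 𝓝[>] B.rPlus, 2 * h₀ * C ^ 2 * B.lapse r ^ 2 < 3 / 4 := by
    have : Tendsto (fun r => 2 * h₀ * C ^ 2 * B.lapse r ^ 2) (𝓝[>] B.rPlus)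
        (𝓝 (2 * h₀ * C ^ 2 * 0 ^ 2)) := (B.lapse_tendsto.pow 2).const_mul _
    exact this.eventually (gt_mem_nhds (by norm_num))
  have hev : ∀ᶠ r in 𝓝[>] B.rPlus, r ∈ Ioc B.rPlus rM ∧ B.gθθ r < 2 * h₀ ∧
      |B.shift r + B.ΩH| ≤ C * B.lapse r ^ 2 ∧ 2 * h₀ * C ^ 2 * B.lapse r ^ 2 < 3 / 4 ∧
      deriv f r / Real.sqrt (B.grr r) < 2 * B.κ := by
    filter_upwards [Ioc_mem_nhdsGT hM.1, hlim.eventually (gt_mem_nhds (by linarith : h₀ < 2 * h₀)),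
      hC, hN4, B.surface_gravity.eventually (gt_mem_nhds (by linarith : B.κ < 2 * B.κ))]
      with r h1 h2 h3 h4 h5
    refine ⟨h1, h2, ?_, h4, h5⟩
    simpa [Real.norm_eq_abs, abs_of_nonneg (sq_nonneg (B.lapse r))] using h3
  obtain ⟨b, hb, hsub⟩ := mem_nhdsGT_iff_exists_Ioc_subset.1 hev
  have hfpos : ∀ r ∈ Ioc B.rPlus rM, 0 < f r := fun r hr =>
    Real.sqrt_pos.2 (by linarith [hM.2 r hr])
  -- The comparison function is `c log f`. Near the horizon `f' ≤ 2 κ √g_rr` and `f ≥ N / 2` give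
  -- `f' / f ≤ 4 κ √g_rr / N`, and `g_θθ < 2 h₀` turns this into a multiple of `1 / p`.
  set c := 1 / (4 * B.κ * Real.sqrt (2 * h₀)) with hc
  have hs0 : 0 < Real.sqrt (2 * h₀) := Real.sqrt_pos.2 (by linarith)
  have hc0 : 0 < c := by positivity
  refine ⟨fun r => c * Real.log (f r), fun r => c * (deriv f r / f r), b, hb, ?_, ?_⟩
  · intro r hr
    obtain ⟨hrm, hh, hw, hN, hd⟩ := hsub hr
    have hra : r ∈ Ioi B.rPlus := hrm.1
    have hN0 := B.lapse_pos r hra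
    have hg0 := B.grr_pos r hra
    have hh0 := B.gθθ_pos r hra
    have hsg := Real.sqrt_pos.2 hg0
    have hsh := Real.sqrt_pos.2 hh0
    have hdiff : DifferentiableAt ℝ f r := by
      have h1 : ∀ {F : ℝ → ℝ}, ContDiffOn ℝ (⊤ : ℕ∞) F (Ioi B.rPlus) → DifferentiableAt ℝ F r :=
        fun hF => (hF.differentiableOn (by simp) r hra).differentiableAt (Ioi_mem_nhds hra)
      exact (((h1 B.contDiff_lapse).pow 2).sub ((h1 B.contDiff_gθθ).mul
        (((h1 B.contDiff_shift).add_const _).pow 2))).sqrt (sub_pos.2 (hM.2 r hrm)).ne'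
    refine ⟨(hdiff.hasDerivAt.log (hfpos r hrm).ne').const_mul c, ?_⟩
    have hfN : B.lapse r / 2 ≤ f r := by
      refine Real.le_sqrt_of_sq_le ?_
      have h2 : (B.shift r + B.ΩH) ^ 2 ≤ (C * B.lapse r ^ 2) ^ 2 := sq_le_sq' (abs_le.1 hw).1
        (abs_le.1 hw).2
      have h3 : B.gθθ r * (B.shift r + B.ΩH) ^ 2 ≤ 2 * h₀ * (C * B.lapse r ^ 2) ^ 2 :=
        mul_le_mul hh.le h2 (sq_nonneg _) (by linarith)
      have h4 : 2 * h₀ * (C * B.lapse r ^ 2) ^ 2 ≤ 3 / 4 * B.lapse r ^ 2 := by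
        have := mul_le_mul_of_nonneg_right hN.le (sq_nonneg (B.lapse r))
        linarith
      linarith
    rw [div_lt_iff₀ hsg] at hd
    have h5 : deriv f r / f r ≤ 4 * B.κ * Real.sqrt (B.grr r) / B.lapse r := by
      rw [div_le_div_iff₀ (hfpos r hrm) hN0]
      have h6 : 0 ≤ 2 * B.κ * Real.sqrt (B.grr r) := by positivity
      nlinarith
    calc c * (deriv f r / f r) ≤ c * (4 * B.κ * Real.sqrt (B.grr r) / B.lapse r) := by gcongr
      _ = Real.sqrt (B.grr r) / (B.lapse r * Real.sqrt (2 * h₀)) := by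
          rw [hc]; field_simp
      _ ≤ Real.sqrt (B.grr r) / (B.lapse r * Real.sqrt (B.gθθ r)) := by gcongr
      _ = 1 / B.coeff r := by rw [coeff, radialCoeff, one_div_div]
  · refine Tendsto.const_mul_atBot hc0 (Real.tendsto_log_nhdsGT_zero.comp
      (tendsto_nhdsWithin_iff.2 ⟨?_, ?_⟩))
    · refine tendsto_of_tendsto_of_tendsto_of_le_of_le' tendsto_const_nhds B.lapse_tendsto
        (Eventually.of_forall fun r => Real.sqrt_nonneg _) ?_
      filter_upwards [self_mem_nhdsWithin] with r hr
      rw [Real.sqrt_le_left (B.lapse_pos r hr).le]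
      have := mul_nonneg (B.gθθ_pos r hr).le (sq_nonneg (B.shift r + B.ΩH))
      linarith
    · filter_upwards [Ioc_mem_nhdsGT hM.1] with r hr using hfpos r hr

lemma IsMirror.exists_pair (hM : B.IsMirror rM) (m : ℝ) (n k : ℤ) :
    ∃ u v x y W, IsGreenPair B.coeff (B.potential m n k) B.rPlus u v x y W ∧ x rM = 0 ∧
      (∀ r ∈ Ioc B.rPlus rM, u r ≠ 0 ∧ 0 ≤ (flux u v r).re) ∧
      (∀ r ∈ Ioo B.rPlus rM, x r ≠ 0 ∧ (flux x y r).re ≤ 0) :=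
  exists_mirror_pair (B.isSection.isRadialEq m _ k) hM.1 (hM.potential_re_nonneg m n k)

/-- Boundedness at the horizon follows from the monotonicity of `|u|`, which is at most its value at
the mirror. -/
lemma IsMirror.isRadialGreen_greenKernel (hM : B.IsMirror rM) {m : ℝ} {n k : ℤ}
    {u v x y : ℝ → ℂ} {W : ℂ}
    (h : IsGreenPair B.coeff (B.potential m n k) B.rPlus u v x y W) (hx : x rM = 0)
    (hu : ∀ r ∈ Ioc B.rPlus rM, u r ≠ 0 ∧ 0 ≤ (flux u v r).re) :
    B.IsRadialGreen rM m n k (greenKernel u x W) := by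
  have hsub : Ioo B.rPlus rM ⊆ Ioi B.rPlus := fun r hr => hr.1
  have E := B.isSection.isRadialEq m (B.κ * n) k
  refine ⟨B.isSection.isModeGreen isOpen_Ioo hsub
    (isRadialGreenFn_greenKernel isOpen_Ioo (E.continuousOn_coeff.mono hsub)
      (fun r hr => E.coeff_pos r hr.1) (h.fst.mono hsub) (h.snd.mono hsub)
      (fun r hr => h.wronskian r hr.1) h.ne_zero), fun r' hr' => ?_, fun r' hr' => ?_⟩
  · refine ⟨‖u rM‖ * ‖x r' / W‖, ?_⟩
    filter_upwards [Ioo_mem_nhdsGT hr'.1] with r hr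
    rw [greenKernel_of_le hr.2.le, norm_mul]
    gcongr
    exact h.fst.norm_fst_le (hr.2.trans hr'.2).le (fun s hs => hr.1.trans_le hs.1)
      (fun s hs => E.coeff_pos s (hr.1.trans_le hs.1))
      (fun s hs => (hu s ⟨hr.1.trans_le hs.1, hs.2⟩).2)
  · have h1 : Tendsto (fun r => u r' / W * x r) (𝓝[<] rM) (𝓝 (u r' / W * x rM)) :=
      ((h.snd.fst rM hM.1).continuousAt.tendsto.mono_left nhdsWithin_le_nhds).const_mul _
    rw [hx, mul_zero] at h1
    refine h1.congr' ?_
    filter_upwards [Ioo_mem_nhdsLT hr'.2] with r hr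
    rw [greenKernel_of_ge hr.1.le]

/-- The difference of two candidates is a global homogeneous solution, bounded at the horizon and
vanishing at the mirror. Its modulus is non-decreasing, so it is zero. -/
theorem IsMirror.isRadialGreen_unique (hM : B.IsMirror rM) {m : ℝ} {n k : ℤ} {G G' : ℝ → ℝ → ℂ}
    (hG : B.IsRadialGreen rM m n k G) (hG' : B.IsRadialGreen rM m n k G') :
    ∀ s ∈ Ioo B.rPlus rM, ∀ s' ∈ Ioo B.rPlus rM, G' s s' = G s s' := by
  intro s hs s' hs'
  have hsub : Ioo B.rPlus rM ⊆ Ioi B.rPlus := fun r hr => hr.1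
  have E := B.isSection.isRadialEq m (B.κ * n) k
  obtain ⟨u₁, v₁, u₂, v₂, H⟩ := exists_isFundamental E.continuousOn_coeff E.coeff_pos
    E.continuousOn_potential
  obtain ⟨c₁, c₂, hc⟩ := (B.isSection.isRadialGreenFn isOpen_Ioo hsub hG.green).exists_sub_eq
    (B.isSection.isRadialGreenFn isOpen_Ioo hsub hG'.green) isOpen_Ioo ordConnected_Ioo hsub
    (E.continuousOn_coeff.mono hsub) (fun r hr => E.coeff_pos r hr.1) H hs'
  obtain ⟨C, hC⟩ := hG.regular s' hs'
  obtain ⟨C', hC'⟩ := hG'.regular s' hs'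
  have h0 := (H.sol₁.comb H.sol₂ c₁ c₂).eq_zero_of_bounded_of_dirichlet E hM.divergesAt hM.1
    (hM.potential_re_nonneg m n k) (C := C' + C) (by
      filter_upwards [hC, hC', Ioo_mem_nhdsGT hM.1] with r h1 h2 hr
      rw [← hc r hr]
      exact (norm_sub_le _ _).trans (add_le_add h2 h1)) (by
      have := (hG'.dirichlet s' hs').sub (hG.dirichlet s' hs')
      rw [sub_zero] at this
      refine this.congr' ?_
      filter_upwards [Ioo_mem_nhdsLT hM.1] with r hr
      exact hc r hr) s hs
  rw [← hc s hs] at h0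
  exact sub_eq_zero.1 h0

end StationaryBlackHole

/-! ### Large quantum numbers -/

/-- The size `√(n² + k²)` of a pair of quantum numbers. -/
noncomputable def modeNorm (q : ℤ × ℤ) : ℝ := Real.sqrt ((q.1 : ℝ) ^ 2 + (q.2 : ℝ) ^ 2)

lemma modeNorm_sq (q : ℤ × ℤ) : modeNorm q ^ 2 = (q.1 : ℝ) ^ 2 + (q.2 : ℝ) ^ 2 :=
  Real.sq_sqrt (by positivity)

lemma modeNorm_nonneg (q : ℤ × ℤ) : 0 ≤ modeNorm q := Real.sqrt_nonneg _

lemma abs_fst_le_modeNorm (q : ℤ × ℤ) : |(q.1 : ℝ)| ≤ modeNorm q :=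
  Real.abs_le_sqrt (by nlinarith [sq_nonneg (q.2 : ℝ)])

lemma abs_snd_le_modeNorm (q : ℤ × ℤ) : |(q.2 : ℝ)| ≤ modeNorm q :=
  Real.abs_le_sqrt (by nlinarith [sq_nonneg (q.1 : ℝ)])

lemma one_le_modeNorm {q : ℤ × ℤ} (hq : q ≠ 0) : 1 ≤ modeNorm q := by
  rcases eq_or_ne q.1 0 with h1 | h1
  · have h2 : q.2 ≠ 0 := fun h2 => hq (Prod.ext h1 h2)
    refine le_trans ?_ (abs_snd_le_modeNorm q)
    exact_mod_cast Int.one_le_abs h2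
  · refine le_trans ?_ (abs_fst_le_modeNorm q)
    exact_mod_cast Int.one_le_abs h1

lemma tendsto_modeNorm_cofinite : Tendsto modeNorm cofinite atTop := by
  rw [tendsto_atTop]
  intro M
  rw [eventually_cofinite]
  refine ((finite_Icc (-⌈M⌉) ⌈M⌉).prod (finite_Icc (-⌈M⌉) ⌈M⌉)).subset ?_
  rintro q hq
  replace hq := not_le.1 hq
  have hM := Int.le_ceil M
  have h1 := abs_le.1 ((abs_fst_le_modeNorm q).trans (hq.le.trans hM))
  have h2 := abs_le.1 ((abs_snd_le_modeNorm q).trans (hq.le.trans hM))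
  refine ⟨⟨?_, ?_⟩, ⟨?_, ?_⟩⟩
  · exact_mod_cast h1.1
  · exact_mod_cast h1.2
  · exact_mod_cast h2.1
  · exact_mod_cast h2.2

/-- The exponent exceeds the rank of the lattice. The sum is compared with the Eisenstein-type
series in the sup norm, which is at most the Euclidean norm. -/
lemma summable_inv_modeNorm_pow_three : Summable fun q : ℤ × ℤ => (modeNorm q ^ 3)⁻¹ := by
  have h := EisensteinSeries.summable_one_div_norm_rpow (k := 3) (by norm_num)
  rw [← (finTwoArrowEquiv _).symm.summable_iff] at h
  refine h.of_nonneg_of_le (fun q => inv_nonneg.2 (pow_nonneg (modeNorm_nonneg q) 3)) fun q => ?_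
  rcases eq_or_ne q 0 with rfl | hq
  · simp only [modeNorm]
    simp
  have hle : ‖(finTwoArrowEquiv ℤ).symm q‖ ≤ modeNorm q := by
    rw [pi_norm_le_iff_of_nonneg (modeNorm_nonneg q)]
    intro i
    fin_cases i
    · simpa [Int.norm_eq_abs] using abs_fst_le_modeNorm q
    · simpa [Int.norm_eq_abs] using abs_snd_le_modeNorm q
  have hpos : 0 < ‖(finTwoArrowEquiv ℤ).symm q‖ := by
    rw [norm_pos_iff]
    intro h0
    apply hq
    have := congrArg (finTwoArrowEquiv ℤ) h0
    rw [Equiv.apply_symm_apply] at this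
    rw [this]
    rfl
  have h3 : ‖(finTwoArrowEquiv ℤ).symm q‖ ^ (-3 : ℝ) = (‖(finTwoArrowEquiv ℤ).symm q‖ ^ 3)⁻¹ := by
    rw [Real.rpow_neg hpos.le]
    norm_cast
  simp only [Function.comp_apply]
  rw [h3]
  gcongr

section Bounds

variable {N grr h w : ℝ → ℝ} {a α β : ℝ}

/-- `V` is a quadratic polynomial in `(n, k)` with smooth coefficients independent of the mode.
Applied to each coefficient, this makes the bounds on `V` and on its two derivatives uniform in the
mode. -/
lemma IsSection.exists_iterated_deriv (H : IsSection N grr h w a) (hα : a < α) {A : ℝ → ℂ}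
    (hA : ContDiffOn ℝ (⊤ : ℕ∞) A (Ioi a)) :
    ∃ (A₁ A₂ : ℝ → ℂ) (C : ℝ), 0 ≤ C ∧ ∀ r ∈ Icc α β,
      HasDerivAt A (A₁ r / radialCoeff N grr h r) r ∧
      HasDerivAt A₁ (A₂ r / radialCoeff N grr h r) r ∧
      ‖A r‖ ≤ C ∧ ‖A₁ r‖ ≤ C ∧ ‖A₂ r‖ ≤ C := by
  have hp : ContDiffOn ℝ (⊤ : ℕ∞) (fun r => (radialCoeff N grr h r : ℂ)) (Ioi a) :=
    Complex.ofRealCLM.contDiff.comp_contDiffOn H.contDiffOn_radialCoeff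
  have key : ∀ F : ℝ → ℂ, ContDiffOn ℝ (⊤ : ℕ∞) F (Ioi a) →
      ContDiffOn ℝ (⊤ : ℕ∞) (fun r => radialCoeff N grr h r * deriv F r) (Ioi a) ∧
      ∀ r ∈ Ioi a, HasDerivAt F (radialCoeff N grr h r * deriv F r / radialCoeff N grr h r) r := by
    intro F hF
    refine ⟨hp.mul (hF.deriv_of_isOpen isOpen_Ioi (by norm_cast)), fun r hr => ?_⟩
    rw [mul_div_cancel_left₀ _ (Complex.ofReal_ne_zero.2 (H.radialCoeff_pos hr).ne')]
    exact ((hF.differentiableOn (by simp) r hr).differentiableAt (Ioi_mem_nhds hr)).hasDerivAt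
  obtain ⟨h1, h1'⟩ := key A hA
  obtain ⟨h2, h2'⟩ := key _ h1
  have hsub : Icc α β ⊆ Ioi a := fun r hr => hα.trans_le hr.1
  obtain ⟨C₀, hC₀⟩ := isCompact_Icc.exists_bound_of_continuousOn (hA.continuousOn.mono hsub)
  obtain ⟨C₁, hC₁⟩ := isCompact_Icc.exists_bound_of_continuousOn (h1.continuousOn.mono hsub)
  obtain ⟨C₂, hC₂⟩ := isCompact_Icc.exists_bound_of_continuousOn (h2.continuousOn.mono hsub)
  refine ⟨_, _, max 0 (max C₀ (max C₁ C₂)), le_max_left _ _, fun r hr => ⟨h1' r (hsub hr),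
    h2' r (hsub hr), ?_, ?_, ?_⟩⟩
  · exact (hC₀ r hr).trans ((le_max_left _ _).trans (le_max_right _ _))
  · exact (hC₁ r hr).trans (((le_max_left _ _).trans (le_max_right _ _)).trans (le_max_right _ _))
  · exact (hC₂ r hr).trans (((le_max_right _ _).trans (le_max_right _ _)).trans (le_max_right _ _))

lemma norm_quadratic_le {q : ℤ × ℤ} (hq : q ≠ 0) {z₀ z₁ z₂ z₃ : ℂ} {C₀ C₁ C₂ C₃ : ℝ}
    (h₀ : ‖z₀‖ ≤ C₀) (h₁ : ‖z₁‖ ≤ C₁) (h₂ : ‖z₂‖ ≤ C₂) (h₃ : ‖z₃‖ ≤ C₃) :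
    ‖(q.1 : ℂ) ^ 2 * z₀ + q.1 * q.2 * z₁ + (q.2 : ℂ) ^ 2 * z₂ + z₃‖ ≤
      (C₀ + C₁ + C₂ + C₃) * modeNorm q ^ 2 := by
  have e1 := abs_fst_le_modeNorm q
  have e2 := abs_snd_le_modeNorm q
  have e3 := one_le_modeNorm hq
  have hn : ‖(q.1 : ℂ)‖ = |(q.1 : ℝ)| := by simp
  have hk : ‖(q.2 : ℂ)‖ = |(q.2 : ℝ)| := by simp
  have p0 := norm_nonneg z₀
  have p1 := norm_nonneg z₁
  have p2 := norm_nonneg z₂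
  have p3 := norm_nonneg z₃
  have f0 : ‖(q.1 : ℂ) ^ 2 * z₀‖ ≤ modeNorm q ^ 2 * C₀ := by
    rw [norm_mul, norm_pow, hn]; gcongr
  have f1 : ‖(q.1 : ℂ) * q.2 * z₁‖ ≤ modeNorm q ^ 2 * C₁ := by
    rw [norm_mul, norm_mul, hn, hk, sq]; gcongr
  have f2 : ‖(q.2 : ℂ) ^ 2 * z₂‖ ≤ modeNorm q ^ 2 * C₂ := by
    rw [norm_mul, norm_pow, hk]; gcongr
  have f3 : ‖z₃‖ ≤ modeNorm q ^ 2 * C₃ := by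
    have : 1 ≤ modeNorm q ^ 2 := one_le_pow₀ e3
    nlinarith
  refine (norm_add_le _ _).trans ((add_le_add (norm_add₃_le) le_rfl).trans ?_)
  linarith

/-- Uniform bounds on the potentials of all modes on a compact interval where the corotating Killing
field is timelike. -/
theorem IsSection.exists_potentialBounds (H : IsSection N grr h w a) (hα : a < α) (hαβ : α ≤ β)
    (ht : ∀ r ∈ Icc α β, h r * w r ^ 2 < N r ^ 2) {κ : ℝ} (hκ : 0 < κ) (m : ℝ) :
    ∃ (c C : ℝ) (V₁ V₂ : ℤ × ℤ → ℝ → ℂ), 0 < c ∧ ∀ q : ℤ × ℤ, q ≠ 0 →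
      PotentialBounds (radialCoeff N grr h) (radialPotential N h w m (κ * q.1) q.2) (V₁ q) (V₂ q)
        α β c C (modeNorm q) := by
  have hc : ∀ {f : ℝ → ℝ}, ContDiffOn ℝ (⊤ : ℕ∞) f (Ioi a) →
      ContDiffOn ℝ (⊤ : ℕ∞) (fun r => (f r : ℂ)) (Ioi a) := fun hf =>
    Complex.ofRealCLM.contDiff.comp_contDiffOn hf
  have hsub : Icc α β ⊆ Ioi a := fun r hr => hα.trans_le hr.1
  have cN := hc H.lapse
  have ch := hc H.angular
  have cw := hc H.shift
  obtain ⟨A₁, A₂, CA, hCA, hA⟩ := H.exists_iterated_deriv (β := β) hα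
    (A := fun r => (κ : ℂ) ^ 2 * h r) (contDiffOn_const.mul ch)
  obtain ⟨B₁, B₂, CB, hCB, hB⟩ := H.exists_iterated_deriv (β := β) hα
    (A := fun r => 2 * Complex.I * κ * (h r * w r)) (contDiffOn_const.mul (ch.mul cw))
  obtain ⟨D₁, D₂, CD, hCD, hD⟩ := H.exists_iterated_deriv (β := β) hα
    (A := fun r => (N r : ℂ) ^ 2 - h r * (w r : ℂ) ^ 2) ((cN.pow 2).sub (ch.mul (cw.pow 2)))
  obtain ⟨E₁, E₂, CE, hCE, hE⟩ := H.exists_iterated_deriv (β := β) hα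
    (A := fun r => (m : ℂ) ^ 2 * (N r : ℂ) ^ 2 * h r) ((contDiffOn_const.mul (cN.pow 2)).mul ch)
  -- The real part of `V` is at least `h κ² n² + (N² - h w²) k²`; by compactness both coefficients
  -- have a common positive lower bound.
  have hpos : ∃ c : ℝ, 0 < c ∧ ∀ r ∈ Icc α β, c ≤ h r * κ ^ 2 ∧ c ≤ N r ^ 2 - h r * w r ^ 2 := by
    have hh := H.angular.continuousOn.mono hsub
    have hN := H.lapse.continuousOn.mono hsub
    have hw := H.shift.continuousOn.mono hsub
    have hcont : ContinuousOn (fun r => min (h r * κ ^ 2) (N r ^ 2 - h r * w r ^ 2)) (Icc α β) :=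
      ContinuousOn.inf (hh.mul continuousOn_const) ((hN.pow 2).sub (hh.mul (hw.pow 2)))
    obtain ⟨r₀, hr₀, hmin⟩ := isCompact_Icc.exists_isMinOn ⟨α, le_rfl, hαβ⟩ hcont
    refine ⟨_, lt_min (mul_pos (H.angular_pos _ (hsub hr₀)) (pow_pos hκ 2))
      (sub_pos.2 (ht r₀ hr₀)), fun r hr => ?_⟩
    have := isMinOn_iff.1 hmin r hr
    exact ⟨this.trans (min_le_left _ _), this.trans (min_le_right _ _)⟩
  obtain ⟨c, hc0, hcl⟩ := hpos
  have hV : ∀ (q : ℤ × ℤ) (r : ℝ), radialPotential N h w m (κ * q.1) q.2 r =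
      (q.1 : ℂ) ^ 2 * ((κ : ℂ) ^ 2 * h r) + q.1 * q.2 * (2 * Complex.I * κ * (h r * w r)) +
        (q.2 : ℂ) ^ 2 * ((N r : ℂ) ^ 2 - h r * (w r : ℂ) ^ 2) +
        (m : ℂ) ^ 2 * (N r : ℂ) ^ 2 * h r := by
    intro q r
    rw [radialPotential]
    push_cast
    linear_combination (h r * q.2 ^ 2 * w r ^ 2 : ℂ) * Complex.I_sq
  refine ⟨c, CA + CB + CD + CE,
    fun q r => (q.1 : ℂ) ^ 2 * A₁ r + q.1 * q.2 * B₁ r + (q.2 : ℂ) ^ 2 * D₁ r + E₁ r,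
    fun q r => (q.1 : ℂ) ^ 2 * A₂ r + q.1 * q.2 * B₂ r + (q.2 : ℂ) ^ 2 * D₂ r + E₂ r,
    hc0, fun q hq => ⟨fun r hr => ?_, fun r hr => ?_, fun r hr => ?_, fun r hr => ?_,
      fun r hr => ?_, fun r hr => ?_⟩⟩
  · rw [funext (hV q)]
    refine (((((hA r hr).1.const_mul ((q.1 : ℂ) ^ 2)).add
      ((hB r hr).1.const_mul ((q.1 : ℂ) * q.2))).add
      ((hD r hr).1.const_mul ((q.2 : ℂ) ^ 2))).add (hE r hr).1).congr_deriv ?_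
    ring
  · refine (((((hA r hr).2.1.const_mul ((q.1 : ℂ) ^ 2)).add
      ((hB r hr).2.1.const_mul ((q.1 : ℂ) * q.2))).add
      ((hD r hr).2.1.const_mul ((q.2 : ℂ) ^ 2))).add (hE r hr).2.1).congr_deriv ?_
    ring
  · rw [radialPotential_re, modeNorm_sq]
    obtain ⟨h1, h2⟩ := hcl r hr
    have h3 : 0 ≤ m ^ 2 * N r ^ 2 * h r := by have := H.angular_pos r (hsub hr); positivity
    nlinarith [mul_le_mul_of_nonneg_right h1 (sq_nonneg (q.1 : ℝ)),
      mul_le_mul_of_nonneg_right h2 (sq_nonneg (q.2 : ℝ))]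
  · rw [hV]
    exact norm_quadratic_le hq (hA r hr).2.2.1 (hB r hr).2.2.1 (hD r hr).2.2.1 (hE r hr).2.2.1
  · exact norm_quadratic_le hq (hA r hr).2.2.2.1 (hB r hr).2.2.2.1 (hD r hr).2.2.2.1
      (hE r hr).2.2.2.1
  · exact norm_quadratic_le hq (hA r hr).2.2.2.2 (hB r hr).2.2.2.2 (hD r hr).2.2.2.2
      (hE r hr).2.2.2.2

lemma IsSection.exists_coeff_bounds (H : IsSection N grr h w a) (hα : a < α) (hαβ : α ≤ β) :
    ∃ P₁ P₂ : ℝ, 0 < P₁ ∧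
      ∀ r ∈ Icc α β, P₁ ≤ radialCoeff N grr h r ∧ radialCoeff N grr h r ≤ P₂ := by
  have hsub : Icc α β ⊆ Ioi a := fun r hr => hα.trans_le hr.1
  have hcont := H.contDiffOn_radialCoeff.continuousOn.mono hsub
  obtain ⟨r₀, hr₀, hmin⟩ := isCompact_Icc.exists_isMinOn ⟨α, le_rfl, hαβ⟩ hcont
  obtain ⟨r₁, hr₁, hmax⟩ := isCompact_Icc.exists_isMaxOn ⟨α, le_rfl, hαβ⟩ hcont
  exact ⟨_, _, H.radialCoeff_pos (hsub hr₀), fun r hr =>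
    ⟨isMinOn_iff.1 hmin r hr, isMaxOn_iff.1 hmax r hr⟩⟩

/-- `χ` is the root of the massless potential, so bounds proved for every mass apply to it at `m =
0`. -/
lemma chi_eq_cpow (N h w : ℝ → ℝ) (ω : ℝ) (k : ℤ) (r : ℝ) :
    chi (N r) (h r) (w r) ω k = radialPotential N h w 0 ω k r ^ (1 / 2 : ℂ) := by
  simp [chi, radialPotential]

/-- `χ` is of the order of the size of the quantum numbers. -/
lemma IsSection.exists_chi_bounds (H : IsSection N grr h w a) {s : ℝ} (hs : a < s)
    (ht : h s * w s ^ 2 < N s ^ 2) {κ : ℝ} (hκ : 0 < κ) :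
    ∃ c C : ℝ, 0 < c ∧ 0 < C ∧ ∀ q : ℤ × ℤ, q ≠ 0 →
      c * modeNorm q ≤ (chi (N s) (h s) (w s) (κ * q.1) q.2).re ∧
      ‖chi (N s) (h s) (w s) (κ * q.1) q.2‖ ≤ C * modeNorm q := by
  -- Only the point `s` matters, so the uniform bounds are used on the degenerate interval `[s, s]`.
  obtain ⟨c, C, V₁, V₂, hc, hb⟩ := H.exists_potentialBounds hs (le_refl s)
    (fun r hr => by rw [show r = s from le_antisymm hr.2 hr.1]; exact ht) hκ 0
  have hss : s ∈ Icc s s := ⟨le_rfl, le_rfl⟩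
  have hlow : ∀ q : ℤ × ℤ, q ≠ 0 →
      Real.sqrt c * modeNorm q ≤ (chi (N s) (h s) (w s) (κ * q.1) q.2).re := by
    intro q hq
    rw [chi_eq_cpow]
    refine sqrt_re_le_cpow_half_re ?_
    rw [mul_pow, Real.sq_sqrt hc.le]
    exact (hb q hq).lower s hss
  refine ⟨Real.sqrt c, Real.sqrt |C| + 1, Real.sqrt_pos.2 hc, by positivity, fun q hq =>
    ⟨hlow q hq, ?_⟩⟩
  have hm := modeNorm_nonneg q
  rw [chi_eq_cpow, norm_cpow_half]
  refine Real.sqrt_le_iff.2 ⟨by positivity, ((hb q hq).upper s hss).trans ?_⟩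
  rw [mul_pow]
  gcongr
  calc C ≤ |C| := le_abs_self C
    _ = Real.sqrt |C| ^ 2 := (Real.sq_sqrt (abs_nonneg _)).symm
    _ ≤ _ := by gcongr; linarith

/-- **Asymptotics of the Green's function at coincidence** for large quantum numbers. -/
theorem IsSection.exists_norm_greenKernel_sub_le (H : IsSection N grr h w a) {s : ℝ} (hα : a < α)
    (hαs : α < s) (hsβ : s < β) (ht : ∀ r ∈ Icc α β, h r * w r ^ 2 < N r ^ 2) {κ : ℝ} (hκ : 0 < κ)
    (m : ℝ) : ∃ K Λ : ℝ, ∀ q : ℤ × ℤ, Λ ≤ modeNorm q → ∀ (u v x y : ℝ → ℂ) (W : ℂ),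
      IsGreenPair (radialCoeff N grr h) (radialPotential N h w m (κ * q.1) q.2) a u v x y W →
      (∀ r ∈ Icc α s, u r ≠ 0 ∧ 0 ≤ (flux u v r).re) →
      (∀ r ∈ Icc s β, x r ≠ 0 ∧ (flux x y r).re ≤ 0) →
      ‖greenKernel u x W s s - 1 / (2 * chi (N s) (h s) (w s) (κ * q.1) q.2)‖ ≤
        K * ‖(chi (N s) (h s) (w s) (κ * q.1) q.2 ^ 3)⁻¹‖ := by
  have hαβ := hαs.trans hsβ
  have hsub : Icc α β ⊆ Ioi a := fun r hr => hα.trans_le hr.1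
  have hsm : s ∈ Icc α β := ⟨hαs.le, hsβ.le⟩
  obtain ⟨P₁, P₂, hP₁, hP⟩ := H.exists_coeff_bounds hα hαβ.le
  obtain ⟨c, C, V₁, V₂, hc, hb⟩ := H.exists_potentialBounds hα hαβ.le ht hκ m
  obtain ⟨c₀, C₀, hc₀, hC₀, hχ⟩ := H.exists_chi_bounds (hsub hsm) (ht s hsm) hκ
  obtain ⟨K, Λ, hK, hΛ, hG⟩ := exists_norm_green_diag_sub_le (C := C) hαs hsβ hP₁ hP hc
  -- `M` is `V - χ²` at `s`. Replacing `√V` by `χ` changes the reciprocal by `M` over a product of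
  -- three factors of order `lam`, which is again of order `lam ^ (-3)`.
  set M := m ^ 2 * N s ^ 2 * h s with hM
  have hM0 : 0 ≤ M := by have := H.angular_pos s (hsub hsm); positivity
  refine ⟨(K + M / (2 * Real.sqrt c * c₀ ^ 2)) * C₀ ^ 3, Λ, fun q hq u v x y W hp hu hx => ?_⟩
  have hlam : 1 ≤ modeNorm q := hΛ.trans hq
  have hlam0 : 0 < modeNorm q := by linarith
  have hq0 : q ≠ 0 := by
    rintro rfl
    simp [modeNorm] at hlam
    linarith
  have e1 := hG (modeNorm q) hq _ _ _ u v x y (hb q hq0) (hp.fst.mono hsub) (hp.snd.mono hsub)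
    (fun r hr => (hu r hr).1) (fun r hr => (hx r hr).1) (fun r hr => (hu r hr).2)
    (fun r hr => (hx r hr).2)
  rw [hp.wronskian s (hsub hsm)] at e1
  obtain ⟨e2, e3⟩ := hχ q hq0
  set χ := chi (N s) (h s) (w s) (κ * q.1) q.2 with hχd
  set S := radialPotential N h w m (κ * q.1) q.2 s ^ (1 / 2 : ℂ) with hS
  have hχn : c₀ * modeNorm q ≤ ‖χ‖ := e2.trans ((le_abs_self _).trans (Complex.abs_re_le_norm _))
  have hχsq : χ ^ 2 = radialPotential N h w 0 (κ * q.1) q.2 s := by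
    rw [hχd, chi_eq_cpow, cpow_half_sq]
  have hSχ : S ^ 2 - χ ^ 2 = (M : ℂ) := by
    rw [hχsq, hS, cpow_half_sq, radialPotential, radialPotential, hM]
    push_cast
    ring
  have hSre : Real.sqrt c * modeNorm q ≤ S.re := by
    refine sqrt_re_le_cpow_half_re ?_
    rw [mul_pow, Real.sq_sqrt hc.le]
    exact (hb q hq0).lower s hsm
  have hSn : Real.sqrt c * modeNorm q ≤ ‖S‖ := hSre.trans ((le_abs_self _).trans (Complex.abs_re_le_norm _))
  have hsum : c₀ * modeNorm q ≤ ‖S + χ‖ := by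
    refine le_trans ?_ ((le_abs_self _).trans (Complex.abs_re_le_norm _))
    rw [Complex.add_re]
    have : 0 ≤ Real.sqrt c * modeNorm q := by positivity
    linarith
  have hsc := Real.sqrt_pos.2 hc
  have hpos : 0 < c₀ * modeNorm q := by positivity
  have hS0 : S ≠ 0 := norm_pos_iff.1 ((mul_pos hsc hlam0).trans_le hSn)
  have hχ0 : χ ≠ 0 := norm_pos_iff.1 (hpos.trans_le hχn)
  have hsum0 : S + χ ≠ 0 := norm_pos_iff.1 (hpos.trans_le hsum)
  have e4 : ‖1 / (2 * S) - 1 / (2 * χ)‖ ≤ M / (2 * Real.sqrt c * c₀ ^ 2) / modeNorm q ^ 3 := by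
    have : 1 / (2 * S) - 1 / (2 * χ) = -(M : ℂ) / (2 * S * χ * (S + χ)) := by
      rw [← hSχ]; field_simp; ring
    rw [this, norm_div, norm_neg, Complex.norm_real, Real.norm_eq_abs, abs_of_nonneg hM0, norm_mul,
      norm_mul, norm_mul, Complex.norm_ofNat]
    calc M / (2 * ‖S‖ * ‖χ‖ * ‖S + χ‖)
        ≤ M / (2 * (Real.sqrt c * modeNorm q) * (c₀ * modeNorm q) * (c₀ * modeNorm q)) := by gcongr
      _ = _ := by field_simp
  have e5 : 1 / modeNorm q ^ 3 ≤ C₀ ^ 3 * ‖(χ ^ 3)⁻¹‖ := by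
    rw [norm_inv, norm_pow, ← div_eq_mul_inv, div_le_div_iff₀ (by positivity)
      (pow_pos (norm_pos_iff.2 hχ0) 3), one_mul, ← mul_pow]
    gcongr
  have e6 : greenKernel u x W s s = u s * x s / W := by simp [greenKernel]
  rw [e6]
  calc ‖u s * x s / W - 1 / (2 * χ)‖
      ≤ ‖u s * x s / W - 1 / (2 * S)‖ + ‖1 / (2 * S) - 1 / (2 * χ)‖ :=
        norm_sub_le_norm_sub_add_norm_sub _ _ _
    _ ≤ K / modeNorm q ^ 3 + M / (2 * Real.sqrt c * c₀ ^ 2) / modeNorm q ^ 3 := add_le_add e1 e4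
    _ = (K + M / (2 * Real.sqrt c * c₀ ^ 2)) * (1 / modeNorm q ^ 3) := by ring
    _ ≤ (K + M / (2 * Real.sqrt c * c₀ ^ 2)) * (C₀ ^ 3 * ‖(χ ^ 3)⁻¹‖) := by gcongr
    _ = _ := by ring

end Bounds

/-! ### The modified Bessel equation -/

/-- The potential of the modified Bessel equation `ρ (ρ u')' = (q² ρ² + k²) u`. -/
noncomputable def besselPotential (q : ℂ) (k : ℤ) (ρ : ℝ) : ℂ := q ^ 2 * (ρ : ℂ) ^ 2 + (k : ℂ) ^ 2

/-- Solutions of the modified Bessel equation on the half-line. -/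
abbrev IsBesselSol (q : ℂ) (k : ℤ) (u v : ℝ → ℂ) : Prop :=
  IsRadialSol (fun ρ => ρ) (besselPotential q k) (Ioi 0) u v

/-- The radiation condition `√ρ (u' + q u) → 0`. -/
def IsRadiating (q : ℂ) (u v : ℝ → ℂ) : Prop :=
  Tendsto (fun ρ : ℝ => (Real.sqrt ρ : ℂ) * (v ρ / (ρ : ℝ) + q * u ρ)) atTop (𝓝 0)

section Bessel

variable {q : ℂ} {k : ℤ} {u v : ℝ → ℂ}

lemma isRadialEq_bessel (q : ℂ) (k : ℤ) : IsRadialEq (fun ρ => ρ) (besselPotential q k) 0 :=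
  ⟨continuousOn_id, fun _ hr => hr,
    (by unfold besselPotential; fun_prop : Continuous (besselPotential q k)).continuousOn⟩

lemma divergesAt_id : DivergesAt (fun ρ => ρ) 0 :=
  ⟨Real.log, fun ρ => ρ⁻¹, 1, one_pos, fun ρ hρ => ⟨Real.hasDerivAt_log hρ.1.ne', by simp⟩,
    Real.tendsto_log_nhdsGT_zero⟩

/-- Because `q̄ q² = |q|² q`, multiplication by `q̄` gives both terms of the potential a real part
proportional to `Re q`. The flux in direction `q̄` is thus monotone for `Re q ≥ 0` even where `Re q²
< 0`. -/
lemma conj_mul_besselPotential_re (q : ℂ) (k : ℤ) (ρ : ℝ) :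
    ((starRingEnd ℂ) q * besselPotential q k ρ).re =
      q.re * (Complex.normSq q * ρ ^ 2 + (k : ℝ) ^ 2) := by
  have h1 : (starRingEnd ℂ) q * besselPotential q k ρ =
      q * ((Complex.normSq q * ρ ^ 2 : ℝ) : ℂ) + (starRingEnd ℂ) q * (((k : ℝ) ^ 2 : ℝ) : ℂ) := by
    rw [besselPotential]
    push_cast
    rw [Complex.normSq_eq_conj_mul_self]
    ring
  rw [h1, Complex.add_re, Complex.re_mul_ofReal, Complex.re_mul_ofReal, Complex.conj_re]
  ring

lemma IsRadialSol.re_conj_mul_flux_le (h : IsBesselSol q k u v) (hq : 0 ≤ q.re) {r s : ℝ}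
    (hr : 0 < r) (hrs : r ≤ s) :
    ((starRingEnd ℂ) q * flux u v r).re ≤ ((starRingEnd ℂ) q * flux u v s).re :=
  h.re_mul_flux_le (by simpa using hq) hrs (fun _ hx => hr.trans_le hx.1)
    (fun _ hx => hr.trans_le hx.1) fun x _ => by
      rw [conj_mul_besselPotential_re]
      exact mul_nonneg hq (add_nonneg (mul_nonneg (Complex.normSq_nonneg _) (sq_nonneg _))
        (sq_nonneg _))

/-- The norm of the radiation condition. -/
lemma normSq_radiating (u v q : ℂ) {ρ : ℝ} (hρ : 0 < ρ) :
    Complex.normSq ((Real.sqrt ρ : ℂ) * (v / (ρ : ℝ) + q * u)) =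
      Complex.normSq v / ρ + ρ * (Complex.normSq q * Complex.normSq u) +
        2 * ((starRingEnd ℂ) q * ((starRingEnd ℂ) u * v)).re := by
  rw [Complex.normSq_mul, Complex.normSq_ofReal, Real.mul_self_sqrt hρ.le, Complex.normSq_add,
    Complex.normSq_mul, Complex.normSq_div, Complex.normSq_ofReal]
  have h1 : (v / (ρ : ℂ) * (starRingEnd ℂ) (q * u)).re =
      ((starRingEnd ℂ) q * ((starRingEnd ℂ) u * v)).re / ρ := by
    rw [← Complex.div_ofReal_re, map_mul]
    congr 1
    ring
  rw [h1]
  field_simp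

/-- If `Re q > 0` there is a decaying solution. -/
lemma exists_decaying_bessel (hq : 0 < q.re) :
    ∃ u v, IsBesselSol q k u v ∧ IsNontrivial 0 u v ∧
      (∀ ρ ∈ Ioi (0 : ℝ), ((starRingEnd ℂ) q * flux u v ρ).re ≤ 0) ∧
      Tendsto (fun ρ => Complex.normSq (v ρ) / ρ + ρ * Complex.normSq (u ρ)) atTop (𝓝 0) := by
  -- Neumann points running to infinity: the flux in direction `q̄` vanishes there and is
  -- non-decreasing, so the limiting solution has it non-positive everywhere.
  obtain ⟨u, v, h, h0, hj⟩ := exists_sol_flux_nonneg (isRadialEq_bessel q k) (T := Ioi 0)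
    (e := -(starRingEnd ℂ) q) (x := fun i : ℕ => (i : ℝ) + 1) (fun i => by positivity) (by
      intro r hr
      filter_upwards [(tendsto_natCast_atTop_atTop (R := ℝ)).eventually (eventually_ge_atTop r)]
        with i hi u v hs hv
      have := hs.re_conj_mul_flux_le hq.le hr (by linarith : r ≤ (i : ℝ) + 1)
      rw [neg_mul, Complex.neg_re, neg_nonneg]
      refine this.trans (le_of_eq ?_)
      simp [flux, hv])
  have hj' : ∀ ρ ∈ Ioi (0 : ℝ), ((starRingEnd ℂ) q * flux u v ρ).re ≤ 0 := fun ρ hρ => by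
    have := hj ρ hρ
    rwa [neg_mul, Complex.neg_re, neg_nonneg] at this
  refine ⟨u, v, h, h0, hj', ?_⟩
  set M : ℝ → ℝ := fun ρ => ((starRingEnd ℂ) q * flux u v ρ).re with hM
  set F : ℝ → ℝ := fun ρ => Complex.normSq (v ρ) / ρ + ρ * Complex.normSq (u ρ) with hF
  -- the flux converges
  obtain ⟨L, hL⟩ : ∃ L, Tendsto M atTop (𝓝 L) := by
    have hmono : Monotone fun x => M (max 1 x) := fun x y hxy =>
      h.re_conj_mul_flux_le hq.le (by positivity) (max_le_max le_rfl hxy)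
    have hbd : BddAbove (range fun x => M (max 1 x)) :=
      ⟨0, by rintro _ ⟨x, rfl⟩; exact hj' _ (lt_of_lt_of_le one_pos (le_max_left 1 x))⟩
    refine ⟨_, (tendsto_atTop_ciSup hmono hbd).congr' ?_⟩
    filter_upwards [eventually_ge_atTop 1] with x hx
    rw [max_eq_right hx]
  set c := q.re * min 1 (Complex.normSq q) with hc
  have hq0 : q ≠ 0 := fun h0 => by simp [h0] at hq
  have hc0 : 0 < c := mul_pos hq (lt_min one_pos (Complex.normSq_pos.2 hq0))
  -- Chosen so that `F' ≤ C F` for `ρ ≥ 1`; hence over a unit interval `F` grows at most by the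
  -- factor `e^C`.
  set C := Complex.normSq q + (k : ℝ) ^ 2 + 2 with hC
  have hnn := fun z => Complex.normSq_nonneg z
  have hF' : ∀ ρ ∈ Ioi (0 : ℝ), HasDerivAt F ((2 * (v ρ / (ρ : ℝ) * (starRingEnd ℂ)
      (besselPotential q k ρ / ρ * u ρ)).re - Complex.normSq (v ρ) / ρ ^ 2) +
      (Complex.normSq (u ρ) + 2 * (flux u v ρ).re)) ρ := by
    intro ρ hρ
    have hρ0 : ρ ≠ 0 := (mem_Ioi.1 hρ).ne'
    have h1 := (h.snd ρ hρ).complex_normSq.div (hasDerivAt_id ρ) hρ0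
    have h2 := (hasDerivAt_id ρ).mul (h.hasDerivAt_normSq hρ)
    refine (h1.add h2).congr_deriv ?_
    have e : ((starRingEnd ℂ) (v ρ) * (besselPotential q k ρ * u ρ / (ρ : ℝ))).re =
        (v ρ / (ρ : ℝ) * (starRingEnd ℂ) (besselPotential q k ρ / ρ * u ρ)).re * ρ := by
      rw [← Complex.conj_re (v ρ / (ρ : ℝ) * _), ← Complex.re_mul_ofReal]
      congr 1
      have : (ρ : ℂ) ≠ 0 := Complex.ofReal_ne_zero.2 hρ0
      simp only [map_mul, map_div₀, Complex.conj_conj, Complex.conj_ofReal]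
      field_simp
    simp only [id, e]
    field_simp
  -- The derivative of `M` is at least `c F`, and `F` on `[x, x + 1]` is at least `e^{-C} F (x +
  -- 1)`. The increments of the convergent `M` tend to zero and carry `F` with them.
  have hbound : ∀ x, 1 ≤ x → c * Real.exp (-C) * F (x + 1) ≤ M (x + 1) - M x := by
    intro x hx
    have hx0 : ∀ s ∈ Icc x (x + 1), s ∈ Ioi (0 : ℝ) := fun s hs =>
      lt_of_lt_of_le one_pos (hx.trans hs.1)
    have hgrow : ∀ s ∈ Icc x (x + 1), Real.exp (-C) * F (x + 1) ≤ F s := by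
      intro s hs
      have hanti := le_of_hasDerivAt_nonpos (f := fun t => F t * Real.exp (-(C * (t - s)))) hs.2
        (fun t ht => (hF' t (hx0 t ⟨hs.1.trans ht.1, ht.2⟩)).mul
          ((((hasDerivAt_id t).sub_const s).const_mul C).neg.exp)) (fun t ht => by
          have ht1 : 1 ≤ t := hx.trans (hs.1.trans ht.1)
          have ht0 : 0 < t := by linarith
          have hFle : (2 * (v t / (t : ℝ) * (starRingEnd ℂ)
              (besselPotential q k t / t * u t)).re - Complex.normSq (v t) / t ^ 2) +
              (Complex.normSq (u t) + 2 * (flux u v t).re) ≤ C * F t := by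
            set X := Complex.normSq (v t) / t with hX
            set U := t * Complex.normSq (u t) with hU
            have hX0 : 0 ≤ X := div_nonneg (hnn _) ht0.le
            have hU0 : 0 ≤ U := mul_nonneg ht0.le (hnn _)
            have huv : 2 * (‖u t‖ * ‖v t‖) ≤ X + U := by
              have h1 : (‖v t‖ / Real.sqrt t) ^ 2 = X := by
                rw [div_pow, Real.sq_sqrt ht0.le, hX, Complex.normSq_eq_norm_sq]
              have h2 : (Real.sqrt t * ‖u t‖) ^ 2 = U := by
                rw [mul_pow, Real.sq_sqrt ht0.le, hU, Complex.normSq_eq_norm_sq]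
              have h3 : (‖v t‖ / Real.sqrt t) * (Real.sqrt t * ‖u t‖) = ‖u t‖ * ‖v t‖ := by
                have := (Real.sqrt_pos.2 ht0).ne'
                field_simp
              rw [← h1, ← h2, ← h3]
              nlinarith [sq_nonneg (‖v t‖ / Real.sqrt t - Real.sqrt t * ‖u t‖)]
            have hV : ‖besselPotential q k t / t‖ ≤ (Complex.normSq q + (k : ℝ) ^ 2) * t := by
              rw [norm_div, Complex.norm_real, Real.norm_eq_abs, abs_of_pos ht0, div_le_iff₀ ht0,
                besselPotential]
              refine (norm_add_le _ _).trans ?_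
              rw [norm_mul, norm_pow, norm_pow, norm_pow, Complex.norm_real, Real.norm_eq_abs,
                sq_abs, Complex.normSq_eq_norm_sq, Complex.norm_intCast, sq_abs]
              have : 1 ≤ t ^ 2 := one_le_pow₀ ht1
              nlinarith [sq_nonneg (k : ℝ)]
            have e1 : 2 * (v t / (t : ℝ) * (starRingEnd ℂ)
                (besselPotential q k t / t * u t)).re ≤
                (Complex.normSq q + (k : ℝ) ^ 2) * (X + U) := by
              have h1 := (le_abs_self _).trans (Complex.abs_re_le_norm
                (v t / (t : ℝ) * (starRingEnd ℂ) (besselPotential q k t / t * u t)))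
              rw [norm_mul, RCLike.norm_conj, norm_mul, norm_div, Complex.norm_real,
                Real.norm_eq_abs, abs_of_pos ht0] at h1
              have h2 : ‖v t‖ / t * (‖besselPotential q k t / t‖ * ‖u t‖) ≤
                  ‖v t‖ / t * ((Complex.normSq q + (k : ℝ) ^ 2) * t * ‖u t‖) := by gcongr
              have h3 : ‖v t‖ / t * ((Complex.normSq q + (k : ℝ) ^ 2) * t * ‖u t‖) =
                  (Complex.normSq q + (k : ℝ) ^ 2) * (‖u t‖ * ‖v t‖) := by field_simp
              have h4 := mul_le_mul_of_nonneg_left huv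
                (add_nonneg (hnn q) (sq_nonneg (k : ℝ)))
              linarith
            have e2 : 2 * (flux u v t).re ≤ X + U := by
              have h1 := (le_abs_self _).trans (Complex.abs_re_le_norm (flux u v t))
              rw [flux, norm_mul, RCLike.norm_conj] at h1
              rw [flux]
              linarith
            have e3 : Complex.normSq (u t) ≤ U := le_mul_of_one_le_left (hnn _) ht1
            have e4 : 0 ≤ Complex.normSq (v t) / t ^ 2 := div_nonneg (hnn _) (sq_nonneg _)
            have e5 : F t = X + U := rfl
            rw [e5, hC]
            linarith
          have h2 : 0 < Real.exp (-(C * (t - s))) := Real.exp_pos _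
          have := mul_le_mul_of_nonneg_right hFle h2.le
          simp only [id, mul_one, Pi.neg_apply]
          linarith)
      simp only [sub_self, mul_zero, neg_zero, Real.exp_zero, mul_one] at hanti
      refine le_trans ?_ hanti
      rw [mul_comm]
      have hF0 : 0 ≤ F (x + 1) := add_nonneg (div_nonneg (hnn _) (by linarith))
        (mul_nonneg (by linarith) (hnn _))
      have hC0 : 0 ≤ C := by have := hnn q; positivity
      refine mul_le_mul_of_nonneg_left (Real.exp_le_exp.2 ?_) hF0
      nlinarith [hs.1]
    have := mul_sub_le_of_le_hasDerivAt (f := M) (c := c * Real.exp (-C) * F (x + 1))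
      (by linarith : x ≤ x + 1) (fun s hs => h.hasDerivAt_re_mul_flux _ (hx0 s hs)) (fun s hs => by
        have hs0 : 0 < s := hx0 s hs
        rw [conj_mul_besselPotential_re, Complex.conj_re]
        have h1 : c * F s ≤ (q.re * Complex.normSq (v s) +
            q.re * (Complex.normSq q * s ^ 2 + (k : ℝ) ^ 2) * Complex.normSq (u s)) / s := by
          rw [le_div_iff₀ hs0]
          have e1 : c * F s * s = c * Complex.normSq (v s) + c * (s ^ 2 * Complex.normSq (u s)) := by
            simp only [hF]; field_simp
          have e2 : c ≤ q.re := mul_le_of_le_one_right hq.le (min_le_left _ _)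
          have e3 : c ≤ q.re * Complex.normSq q :=
            mul_le_mul_of_nonneg_left (min_le_right _ _) hq.le
          have e4 := mul_le_mul_of_nonneg_right e2 (hnn (v s))
          have e5 := mul_le_mul_of_nonneg_right e3 (mul_nonneg (sq_nonneg s) (hnn (u s)))
          have e6 : 0 ≤ q.re * (k : ℝ) ^ 2 * Complex.normSq (u s) := by
            have := hnn (u s); positivity
          rw [e1]
          linarith
        refine le_trans ?_ h1
        have := mul_le_mul_of_nonneg_left (hgrow s hs) hc0.le
        linarith)
    rw [add_sub_cancel_left, mul_one] at this
    exact this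
  have hdiff : Tendsto (fun x => (M (x + 1) - M x) / (c * Real.exp (-C))) atTop (𝓝 0) := by
    have h1 := ((hL.comp (tendsto_atTop_add_const_right atTop (1 : ℝ) tendsto_id)).sub hL).div_const
      (c * Real.exp (-C))
    simpa using h1
  have hshift : Tendsto (fun x => F (x + 1)) atTop (𝓝 0) := by
    refine tendsto_of_tendsto_of_tendsto_of_le_of_le' tendsto_const_nhds hdiff ?_ ?_
    · filter_upwards [eventually_ge_atTop 1] with x hx
      exact add_nonneg (div_nonneg (hnn _) (by linarith)) (mul_nonneg (by linarith) (hnn _))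
    · filter_upwards [eventually_ge_atTop 1] with x hx
      rw [le_div_iff₀ (mul_pos hc0 (Real.exp_pos _))]
      linarith [hbound x hx]
  have := hshift.comp (tendsto_atTop_add_const_right atTop (-1 : ℝ) tendsto_id)
  simpa [Function.comp_def] using this

/-- Decay implies the radiation condition, for every `q`. -/
lemma isRadiating_of_tendsto
    (h : Tendsto (fun ρ => Complex.normSq (v ρ) / ρ + ρ * Complex.normSq (u ρ)) atTop (𝓝 0)) :
    IsRadiating q u v := by
  rw [IsRadiating, tendsto_zero_iff_norm_tendsto_zero]
  have hs : Tendsto (fun ρ => Real.sqrt ((2 + 2 * Complex.normSq q) *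
      (Complex.normSq (v ρ) / ρ + ρ * Complex.normSq (u ρ)))) atTop (𝓝 0) := by
    have := (h.const_mul (2 + 2 * Complex.normSq q)).sqrt
    simpa using this
  refine tendsto_of_tendsto_of_tendsto_of_le_of_le' tendsto_const_nhds hs
    (Eventually.of_forall fun _ => norm_nonneg _) ?_
  filter_upwards [eventually_gt_atTop 0] with ρ hρ
  refine Real.le_sqrt_of_sq_le ?_
  rw [← Complex.normSq_eq_norm_sq, Complex.normSq_mul, Complex.normSq_ofReal,
    Real.mul_self_sqrt hρ.le]
  have h1 : Complex.normSq (v ρ / (ρ : ℝ) + q * u ρ) ≤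
      2 * (Complex.normSq (v ρ) / ρ ^ 2) + 2 * (Complex.normSq q * Complex.normSq (u ρ)) := by
    have e1 := norm_add_le (v ρ / (ρ : ℝ)) (q * u ρ)
    have e2 : Complex.normSq (v ρ) / ρ ^ 2 = ‖v ρ / (ρ : ℝ)‖ ^ 2 := by
      rw [← Complex.normSq_eq_norm_sq, Complex.normSq_div, Complex.normSq_ofReal, sq]
    have e3 : Complex.normSq q * Complex.normSq (u ρ) = ‖q * u ρ‖ ^ 2 := by
      rw [← Complex.normSq_eq_norm_sq, Complex.normSq_mul]
    rw [e2, e3, Complex.normSq_eq_norm_sq]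
    have := norm_nonneg (v ρ / (ρ : ℝ) + q * u ρ)
    nlinarith [sq_nonneg (‖v ρ / (ρ : ℝ)‖ - ‖q * u ρ‖)]
  have n1 := Complex.normSq_nonneg q
  have n2 := Complex.normSq_nonneg (u ρ)
  have n3 := Complex.normSq_nonneg (v ρ)
  calc ρ * Complex.normSq (v ρ / (ρ : ℝ) + q * u ρ)
      ≤ ρ * (2 * (Complex.normSq (v ρ) / ρ ^ 2) + 2 * (Complex.normSq q * Complex.normSq (u ρ))) := by
        gcongr
    _ = 2 * (Complex.normSq (v ρ) / ρ) + 2 * Complex.normSq q * (ρ * Complex.normSq (u ρ)) := by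
        field_simp
    _ ≤ _ := by
        have a1 : 0 ≤ Complex.normSq (v ρ) / ρ := by positivity
        have a2 : 0 ≤ ρ * Complex.normSq (u ρ) := by positivity
        nlinarith [mul_nonneg n1 a1]

end Bessel

/-! ### Oscillatory solutions -/

section Oscillatory

variable {q : ℂ} {k : ℤ} {u v : ℝ → ℂ} {σ : ℝ}

/-- The Liouville transform `√ρ u` of a radial function. -/
noncomputable def liouville (u : ℝ → ℂ) (ρ : ℝ) : ℂ := (Real.sqrt ρ : ℂ) * u ρ

/-- The derivative of the Liouville transform. -/
noncomputable def liouvilleDeriv (u v : ℝ → ℂ) (ρ : ℝ) : ℂ := (v ρ + u ρ / 2) / (Real.sqrt ρ : ℂ)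

/-- The local squared frequency of the Liouville transform. -/
noncomputable def liouvilleFreq (σ : ℝ) (k : ℤ) (ρ : ℝ) : ℝ :=
  σ ^ 2 - ((k : ℝ) ^ 2 - 1 / 4) / ρ ^ 2

/-- The energy of the Liouville transform. -/
noncomputable def liouvilleEnergy (σ : ℝ) (k : ℤ) (u v : ℝ → ℂ) (ρ : ℝ) : ℝ :=
  Complex.normSq (liouvilleDeriv u v ρ) +
    liouvilleFreq σ k ρ * Complex.normSq (liouville u ρ)

lemma hasDerivAt_sqrt_ofReal {ρ : ℝ} (hρ : 0 < ρ) :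
    HasDerivAt (fun x : ℝ => (Real.sqrt x : ℂ)) (1 / (2 * (Real.sqrt ρ : ℂ))) ρ := by
  have := (Real.hasDerivAt_sqrt hρ.ne').ofReal_comp
  simpa using this

lemma IsRadialSol.hasDerivAt_liouville (h : IsBesselSol q k u v) {ρ : ℝ} (hρ : 0 < ρ) :
    HasDerivAt (liouville u) (liouvilleDeriv u v ρ) ρ := by
  refine ((hasDerivAt_sqrt_ofReal hρ).mul (h.fst ρ hρ)).congr_deriv ?_
  have h1 : (Real.sqrt ρ : ℂ) ≠ 0 := Complex.ofReal_ne_zero.2 (Real.sqrt_pos.2 hρ).ne'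
  have h2 : (ρ : ℂ) = (Real.sqrt ρ : ℂ) ^ 2 := by
    rw [← Complex.ofReal_pow, Real.sq_sqrt hρ.le]
  rw [liouvilleDeriv, h2]
  field_simp
  ring

/-- For `q² = -σ²` the factor `√ρ` removes the first-order term: `Y = √ρ u` obeys an oscillator
equation whose frequency tends to `σ²`. -/
lemma IsRadialSol.hasDerivAt_liouvilleDeriv (h : IsBesselSol q k u v) (hq : q ^ 2 = -(σ : ℂ) ^ 2)
    {ρ : ℝ} (hρ : 0 < ρ) :
    HasDerivAt (liouvilleDeriv u v) (-((liouvilleFreq σ k ρ : ℝ) : ℂ) * liouville u ρ) ρ := by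
  have h1 : (Real.sqrt ρ : ℂ) ≠ 0 := Complex.ofReal_ne_zero.2 (Real.sqrt_pos.2 hρ).ne'
  have h2 : (ρ : ℂ) = (Real.sqrt ρ : ℂ) ^ 2 := by
    rw [← Complex.ofReal_pow, Real.sq_sqrt hρ.le]
  refine (((h.snd ρ hρ).add ((h.fst ρ hρ).div_const 2)).div (hasDerivAt_sqrt_ofReal hρ)
    h1).congr_deriv ?_
  rw [liouvilleFreq, liouville, besselPotential, hq]
  push_cast
  simp only [Pi.add_apply]
  rw [h2]
  field_simp
  ring

/-- Only the explicit radial dependence of the frequency contributes. For a nonzero integer `k` the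
result is non-negative, so the energy never decreases. -/
lemma IsRadialSol.hasDerivAt_liouvilleEnergy (h : IsBesselSol q k u v)
    (hq : q ^ 2 = -(σ : ℂ) ^ 2) {ρ : ℝ} (hρ : 0 < ρ) :
    HasDerivAt (liouvilleEnergy σ k u v)
      (2 * ((k : ℝ) ^ 2 - 1 / 4) / ρ ^ 3 * Complex.normSq (liouville u ρ)) ρ := by
  have h1 := (h.hasDerivAt_liouvilleDeriv hq hρ).complex_normSq
  have h2 := (h.hasDerivAt_liouville hρ).complex_normSq
  have h3 : HasDerivAt (liouvilleFreq σ k) (2 * ((k : ℝ) ^ 2 - 1 / 4) / ρ ^ 3) ρ := by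
    have := ((hasDerivAt_const ρ ((k : ℝ) ^ 2 - 1 / 4)).div (hasDerivAt_pow 2 ρ)
      (pow_pos hρ 2).ne').const_sub (σ ^ 2)
    refine this.congr_deriv ?_
    field_simp
    ring
  refine (h1.add (h3.mul h2)).congr_deriv ?_
  have e : ((starRingEnd ℂ) (liouvilleDeriv u v ρ) *
      (-((liouvilleFreq σ k ρ : ℝ) : ℂ) * liouville u ρ)).re =
      -(liouvilleFreq σ k ρ * ((starRingEnd ℂ) (liouville u ρ) * liouvilleDeriv u v ρ).re) := by
    rw [← Complex.re_ofReal_mul, ← Complex.neg_re, ← Complex.conj_re]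
    congr 1
    simp only [map_mul, map_neg, Complex.conj_conj, Complex.conj_ofReal]
    ring
  rw [e]
  ring

lemma sq_sub_quarter_pos (hk : k ≠ 0) : 3 / 4 ≤ (k : ℝ) ^ 2 - 1 / 4 := by
  have : (1 : ℝ) ≤ (k : ℝ) ^ 2 := by
    have h1 : (1 : ℝ) ≤ |(k : ℝ)| := by exact_mod_cast Int.one_le_abs hk
    rw [← sq_abs]
    exact one_le_pow₀ h1
  linarith

lemma IsRadialSol.liouvilleEnergy_le (h : IsBesselSol q k u v) (hq : q ^ 2 = -(σ : ℂ) ^ 2)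
    (hk : k ≠ 0) {r s : ℝ} (hr : 0 < r) (hrs : r ≤ s) :
    liouvilleEnergy σ k u v r ≤ liouvilleEnergy σ k u v s :=
  le_of_hasDerivAt_nonneg hrs (fun x hx => h.hasDerivAt_liouvilleEnergy hq (hr.trans_le hx.1))
    fun x hx => by
      have h1 := sq_sub_quarter_pos hk
      have h2 := Complex.normSq_nonneg (liouville u x)
      have h3 : 0 < x := hr.trans_le hx.1
      have h4 : 0 ≤ (k : ℝ) ^ 2 - 1 / 4 := by linarith
      positivity

lemma tendsto_liouvilleFreq (σ : ℝ) (k : ℤ) : Tendsto (liouvilleFreq σ k) atTop (𝓝 (σ ^ 2)) := by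
  have : Tendsto (fun ρ : ℝ => ((k : ℝ) ^ 2 - 1 / 4) / ρ ^ 2) atTop (𝓝 0) :=
    tendsto_const_nhds.div_atTop (tendsto_pow_atTop two_ne_zero)
  have h2 := (tendsto_const_nhds (x := σ ^ 2)).sub this
  rwa [sub_zero] at h2

/-- Oscillatory solutions are `O(1 / √ρ)`. -/
lemma IsRadialSol.exists_liouville_bound (h : IsBesselSol q k u v) (hq : q ^ 2 = -(σ : ℂ) ^ 2)
    (hσ : σ ≠ 0) (hk : k ≠ 0) :
    ∃ R B : ℝ, 0 < R ∧ ∀ ρ, R ≤ ρ → ‖liouville u ρ‖ ≤ B := by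
  have hσ2 : 0 < σ ^ 2 := by positivity
  obtain ⟨R, hR⟩ := eventually_atTop.1 (((tendsto_liouvilleFreq σ k).eventually
    (lt_mem_nhds (by linarith : σ ^ 2 / 2 < σ ^ 2))).and (eventually_gt_atTop 0))
  have hR0 : 0 < R := (hR R le_rfl).2
  set ν := (k : ℝ) ^ 2 - 1 / 4 with hν
  have hν0 : 0 < ν := by linarith [sq_sub_quarter_pos hk]
  -- Beyond `R` the energy satisfies `E' ≤ (2 D / ρ³) E`, so `E e^{D / ρ²}` is non-increasing and
  -- `E` stays bounded.
  set D := 2 * ν / σ ^ 2 with hD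
  have hD0 : 0 < D := by positivity
  set E := liouvilleEnergy σ k u v with hE
  have hEY : ∀ ρ, R ≤ ρ → σ ^ 2 / 2 * Complex.normSq (liouville u ρ) ≤ E ρ := by
    intro ρ hρ
    have h1 := Complex.normSq_nonneg (liouvilleDeriv u v ρ)
    have h2 := mul_le_mul_of_nonneg_right (hR ρ hρ).1.le (Complex.normSq_nonneg (liouville u ρ))
    simp only [hE, liouvilleEnergy]
    linarith
  have hE0 : ∀ ρ, R ≤ ρ → 0 ≤ E ρ := fun ρ hρ => (mul_nonneg (by positivity)
    (Complex.normSq_nonneg _)).trans (hEY ρ hρ)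
  have hanti : ∀ ρ, R ≤ ρ → E ρ * Real.exp (D / ρ ^ 2) ≤ E R * Real.exp (D / R ^ 2) := by
    intro ρ hρ
    refine le_of_hasDerivAt_nonpos (f := fun x => E x * Real.exp (D / x ^ 2)) hρ
      (fun x hx => (h.hasDerivAt_liouvilleEnergy hq (hR0.trans_le hx.1)).mul
        ((hasDerivAt_const x D).div (hasDerivAt_pow 2 x)
          (pow_pos (hR0.trans_le hx.1) 2).ne').exp) (fun x hx => ?_)
    have hx0 : 0 < x := hR0.trans_le hx.1
    have h1 := hEY x hx.1
    have h2 : 0 < Real.exp (D / x ^ 2) := Real.exp_pos _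
    have h3 : 2 * ν / x ^ 3 * Complex.normSq (liouville u x) ≤ 2 * D / x ^ 3 * E x := by
      calc 2 * ν / x ^ 3 * Complex.normSq (liouville u x)
          = 2 * D / x ^ 3 * (σ ^ 2 / 2 * Complex.normSq (liouville u x)) := by
            rw [hD]; field_simp
        _ ≤ _ := by gcongr
    have h4 := mul_le_mul_of_nonneg_right h3 h2.le
    have h5 : ((0 : ℝ) * x ^ 2 - D * (↑(2 : ℕ) * x ^ (2 - 1))) / (x ^ 2) ^ 2 = -(2 * D / x ^ 3) := by
      push_cast
      field_simp
      ring
    rw [h5]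
    simp only [Pi.div_apply]
    linarith
  refine ⟨R, Real.sqrt (2 / σ ^ 2 * (E R * Real.exp (D / R ^ 2))), hR0, fun ρ hρ => ?_⟩
  refine Real.le_sqrt_of_sq_le ?_
  rw [← Complex.normSq_eq_norm_sq]
  have h1 : E ρ ≤ E ρ * Real.exp (D / ρ ^ 2) :=
    le_mul_of_one_le_right (hE0 ρ hρ) (Real.one_le_exp (by positivity))
  have h2 := (hEY ρ hρ).trans (h1.trans (hanti ρ hρ))
  calc Complex.normSq (liouville u ρ)
      = 2 / σ ^ 2 * (σ ^ 2 / 2 * Complex.normSq (liouville u ρ)) := by field_simp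
    _ ≤ _ := by gcongr

/-- The amplitude of the incoming component of an oscillatory solution. -/
noncomputable def incoming (σ : ℝ) (u v : ℝ → ℂ) (ρ : ℝ) : ℂ :=
  (liouvilleDeriv u v ρ + Complex.I * σ * liouville u ρ) * Complex.exp (-(Complex.I * σ * ρ))

/-- The free oscillation cancels and only the centrifugal term of order `ρ⁻²` is left. It is
integrable for a bounded transform, so the amplitude converges. -/
lemma IsRadialSol.hasDerivAt_incoming (h : IsBesselSol q k u v) (hq : q ^ 2 = -(σ : ℂ) ^ 2)
    {ρ : ℝ} (hρ : 0 < ρ) :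
    HasDerivAt (incoming σ u v) ((((k : ℝ) ^ 2 - 1 / 4) / ρ ^ 2 : ℝ) * liouville u ρ *
      Complex.exp (-(Complex.I * σ * ρ))) ρ := by
  have h1 : HasDerivAt (fun x : ℝ => Complex.exp (-(Complex.I * σ * x)))
      (Complex.exp (-(Complex.I * σ * ρ)) * -(Complex.I * σ * 1)) ρ :=
    ((Complex.ofRealCLM.hasDerivAt (x := ρ)).const_mul (Complex.I * (σ : ℂ))).neg.cexp
  refine (((h.hasDerivAt_liouvilleDeriv hq hρ).add
    ((h.hasDerivAt_liouville hρ).const_mul (Complex.I * σ))).mul h1).congr_deriv ?_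
  rw [liouvilleFreq]
  push_cast
  simp only [Pi.add_apply]
  linear_combination (-(σ : ℂ) ^ 2 * liouville u ρ * Complex.exp (-(Complex.I * σ * ρ))) *
    Complex.I_sq

lemma IsRadialSol.exists_tendsto_incoming (h : IsBesselSol q k u v) (hq : q ^ 2 = -(σ : ℂ) ^ 2)
    (hσ : σ ≠ 0) (hk : k ≠ 0) : ∃ L : ℂ, Tendsto (incoming σ u v) atTop (𝓝 L) := by
  obtain ⟨R, B, hR, hB⟩ := h.exists_liouville_bound hq hσ hk
  set ν := (k : ℝ) ^ 2 - 1 / 4 with hν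
  have hν0 : 0 < ν := by linarith [sq_sub_quarter_pos hk]
  refine ⟨_, MeasureTheory.tendsto_limUnder_of_hasDerivAt_of_integrableOn_Ioi
    (fun x hx => h.hasDerivAt_incoming hq (hR.trans hx)) ?_⟩
  have hint := (integrableOn_Ioi_rpow_of_lt (by norm_num : (-2 : ℝ) < -1) hR).const_mul (ν * B)
  refine MeasureTheory.Integrable.mono' hint ?_ ?_
  · refine ContinuousOn.aestronglyMeasurable ?_ measurableSet_Ioi
    have hY : ContinuousOn (liouville u) (Ioi R) := fun x hx =>
      (h.hasDerivAt_liouville (hR.trans hx)).continuousAt.continuousWithinAt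
    refine ((Complex.continuous_ofReal.comp_continuousOn ?_).mul hY).mul (by fun_prop)
    exact continuousOn_const.div (by fun_prop) fun x hx => (pow_pos (hR.trans hx) 2).ne'
  · refine MeasureTheory.ae_restrict_of_forall_mem measurableSet_Ioi fun x hx => ?_
    have hx0 : 0 < x := hR.trans hx
    have h1 : ‖Complex.exp (-(Complex.I * σ * x))‖ = 1 := by
      rw [show -(Complex.I * (σ : ℂ) * x) = ((-(σ * x) : ℝ) : ℂ) * Complex.I by push_cast; ring]
      exact Complex.norm_exp_ofReal_mul_I _
    rw [norm_mul, norm_mul, h1, mul_one, Complex.norm_real, Real.norm_eq_abs,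
      abs_of_pos (by positivity), Real.rpow_neg hx0.le]
    have h2 := hB x (le_of_lt hx)
    calc ν / x ^ 2 * ‖liouville u x‖ ≤ ν / x ^ 2 * B := by gcongr
      _ = ν * B * (x ^ (2 : ℝ))⁻¹ := by norm_cast; ring

/-- Up to a term of order `1 / ρ`, the radiation expression is the incoming amplitude times a phase.
-/
lemma radiating_eq {ρ : ℝ} (hρ : 0 < ρ) :
    (Real.sqrt ρ : ℂ) * (v ρ / (ρ : ℝ) + Complex.I * σ * u ρ) =
      incoming σ u v ρ * Complex.exp (Complex.I * σ * ρ) - liouville u ρ / (2 * (ρ : ℝ)) := by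
  have h1 : (Real.sqrt ρ : ℂ) ≠ 0 := Complex.ofReal_ne_zero.2 (Real.sqrt_pos.2 hρ).ne'
  have h2 : (ρ : ℂ) = (Real.sqrt ρ : ℂ) ^ 2 := by
    rw [← Complex.ofReal_pow, Real.sq_sqrt hρ.le]
  have h3 : Complex.exp (-(Complex.I * σ * ρ)) * Complex.exp (Complex.I * σ * ρ) = 1 := by
    rw [← Complex.exp_add, neg_add_cancel, Complex.exp_zero]
  rw [incoming, mul_assoc (_ + _), h3, mul_one, liouvilleDeriv, liouville, h2]
  field_simp
  ring

/-- On the imaginary axis there is a radiating solution. -/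
lemma exists_radiating_bessel_of_imag (hσ : σ ≠ 0) (hk : k ≠ 0) :
    ∃ u v, IsBesselSol (Complex.I * σ) k u v ∧ IsNontrivial 0 u v ∧
      IsRadiating (Complex.I * σ) u v := by
  have hq : (Complex.I * (σ : ℂ)) ^ 2 = -(σ : ℂ) ^ 2 := by rw [mul_pow, Complex.I_sq]; ring
  have E := isRadialEq_bessel (Complex.I * σ) k
  obtain ⟨u₁, v₁, u₂, v₂, H⟩ := exists_isFundamental E.continuousOn_coeff E.coeff_pos
    E.continuousOn_potential
  obtain ⟨L₁, hL₁⟩ := H.sol₁.exists_tendsto_incoming hq hσ hk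
  obtain ⟨L₂, hL₂⟩ := H.sol₂.exists_tendsto_incoming hq hσ hk
  -- Vanishing of the limiting incoming amplitude is one linear condition on a two-dimensional space
  -- of solutions.
  obtain ⟨c₁, c₂, hc, hc0⟩ : ∃ c₁ c₂ : ℂ, ¬(c₁ = 0 ∧ c₂ = 0) ∧ c₁ * L₁ + c₂ * L₂ = 0 := by
    by_cases h : L₂ = 0 ∧ L₁ = 0
    · exact ⟨1, 0, by simp, by simp [h.2]⟩
    · exact ⟨L₂, -L₁, by simpa using h, by ring⟩
  have hs := H.sol₁.comb H.sol₂ c₁ c₂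
  refine ⟨_, _, hs, H.isNontrivial_comb hc, ?_⟩
  obtain ⟨R, B, hR, hB⟩ := hs.exists_liouville_bound hq hσ hk
  set U := fun r => c₁ * u₁ r + c₂ * u₂ r
  set W := fun r => c₁ * v₁ r + c₂ * v₂ r
  have hinc : Tendsto (incoming σ U W) atTop (𝓝 0) := by
    have := (hL₁.const_mul c₁).add (hL₂.const_mul c₂)
    rw [hc0] at this
    refine this.congr fun ρ => ?_
    simp only [incoming, liouville, liouvilleDeriv, U, W]
    ring
  rw [IsRadiating, tendsto_zero_iff_norm_tendsto_zero]
  have h2 : Tendsto (fun ρ : ℝ => ‖incoming σ U W ρ‖ + B / (2 * ρ)) atTop (𝓝 0) := by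
    have h3 : Tendsto (fun ρ : ℝ => B / (2 * ρ)) atTop (𝓝 0) :=
      tendsto_const_nhds.div_atTop (tendsto_id.const_mul_atTop two_pos)
    simpa using hinc.norm.add h3
  refine tendsto_of_tendsto_of_tendsto_of_le_of_le' tendsto_const_nhds h2
    (Eventually.of_forall fun _ => norm_nonneg _) ?_
  filter_upwards [eventually_ge_atTop R] with ρ hρ
  have hρ0 : 0 < ρ := hR.trans_le hρ
  rw [radiating_eq hρ0]
  have h1 : ‖Complex.exp (Complex.I * σ * ρ)‖ = 1 := by
    rw [show Complex.I * (σ : ℂ) * ρ = ((σ * ρ : ℝ) : ℂ) * Complex.I by push_cast; ring]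
    exact Complex.norm_exp_ofReal_mul_I _
  refine (norm_sub_le _ _).trans (add_le_add ?_ ?_)
  · rw [norm_mul, h1, mul_one]
  · rw [norm_div, norm_mul, Complex.norm_real, Real.norm_eq_abs, abs_of_pos hρ0, Complex.norm_ofNat]
    have := hB ρ hρ
    gcongr

/-- The decaying power at `q = 0`. -/
lemma isBesselSol_inv_pow (k : ℤ) :
    IsBesselSol 0 k (fun ρ => ((ρ : ℂ) ^ k.natAbs)⁻¹)
      (fun ρ => -(k.natAbs : ℂ) * ((ρ : ℂ) ^ k.natAbs)⁻¹) := by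
  have hk : (k : ℂ) ^ 2 = (k.natAbs : ℂ) ^ 2 := by
    rw [← Int.cast_natCast k.natAbs, ← Int.cast_pow, ← Int.cast_pow, Int.natAbs_sq]
  have hd : ∀ ρ ∈ Ioi (0 : ℝ), HasDerivAt (fun ρ : ℝ => ((ρ : ℂ) ^ k.natAbs)⁻¹)
      (-(k.natAbs : ℂ) * ((ρ : ℂ) ^ k.natAbs)⁻¹ / (ρ : ℝ)) ρ := by
    intro ρ hρ
    have hρ0 : (ρ : ℂ) ≠ 0 := Complex.ofReal_ne_zero.2 (mem_Ioi.1 hρ).ne'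
    have h1 := ((Complex.ofRealCLM.hasDerivAt (x := ρ)).pow k.natAbs).inv (pow_ne_zero _ hρ0)
    refine h1.congr_deriv ?_
    rcases Nat.eq_zero_or_pos k.natAbs with h0 | h0
    · simp [h0]
    · have : (ρ : ℂ) ^ k.natAbs = ρ ^ (k.natAbs - 1) * ρ := by
        rw [← pow_succ, Nat.sub_add_cancel h0]
      simp only [Complex.ofRealCLM_apply, Complex.ofReal_one, mul_one, Pi.pow_apply]
      rw [this]
      have := pow_ne_zero (k.natAbs - 1) hρ0
      field_simp
  refine ⟨hd, fun ρ hρ => ((hd ρ hρ).const_mul (-(k.natAbs : ℂ))).congr_deriv ?_⟩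
  rw [besselPotential, hk]
  ring

/-- The threshold momentum `q = 0` gives an Euler equation, and its decaying power `ρ ^ (-|k|)`
satisfies the radiation condition. -/
lemma exists_radiating_bessel_of_zero (hk : k ≠ 0) :
    ∃ u v, IsBesselSol 0 k u v ∧ IsNontrivial 0 u v ∧ IsRadiating 0 u v := by
  refine ⟨_, _, isBesselSol_inv_pow k, fun ρ hρ h => ?_, ?_⟩
  · have : (ρ : ℂ) ≠ 0 := Complex.ofReal_ne_zero.2 (mem_Ioi.1 hρ).ne'
    exact inv_ne_zero (pow_ne_zero _ this) h.1
  · have hk1 : 1 ≤ k.natAbs := Nat.one_le_iff_ne_zero.2 (Int.natAbs_ne_zero.2 hk)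
    rw [IsRadiating, tendsto_zero_iff_norm_tendsto_zero]
    have h1 : Tendsto (fun ρ : ℝ => (k.natAbs : ℝ) / ρ) atTop (𝓝 0) :=
      tendsto_const_nhds.div_atTop tendsto_id
    refine tendsto_of_tendsto_of_tendsto_of_le_of_le' tendsto_const_nhds h1
      (Eventually.of_forall fun _ => norm_nonneg _) ?_
    filter_upwards [eventually_ge_atTop 1] with ρ hρ
    have hρ0 : 0 < ρ := by linarith
    rw [zero_mul, add_zero, norm_mul, norm_div, norm_mul, norm_neg, norm_inv, norm_pow,
      Complex.norm_real, Complex.norm_real, Real.norm_eq_abs, Real.norm_eq_abs, abs_of_pos hρ0,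
      abs_of_nonneg (Real.sqrt_nonneg _), Complex.norm_natCast]
    have h2 : Real.sqrt ρ ≤ ρ ^ k.natAbs := by
      calc Real.sqrt ρ ≤ ρ := Real.sqrt_le_iff.2 ⟨hρ0.le, by nlinarith⟩
        _ ≤ ρ ^ k.natAbs := le_self_pow₀ hρ (by omega)
    have h3 : Real.sqrt ρ * (ρ ^ k.natAbs)⁻¹ ≤ 1 := by
      rw [← div_eq_mul_inv]
      exact div_le_one_of_le₀ h2 (by positivity)
    calc Real.sqrt ρ * ((k.natAbs : ℝ) * (ρ ^ k.natAbs)⁻¹ / ρ)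
        = Real.sqrt ρ * (ρ ^ k.natAbs)⁻¹ * (k.natAbs / ρ) := by ring
      _ ≤ 1 * (k.natAbs / ρ) := by gcongr
      _ = _ := one_mul _

end Oscillatory

/-! ### Solutions that are bounded on the axis and radiating -/

section Uniqueness

variable {q : ℂ} {k : ℤ} {u v : ℝ → ℂ} {σ : ℝ}

lemma besselPotential_re (q : ℂ) (k : ℤ) (ρ : ℝ) :
    (besselPotential q k ρ).re = (q ^ 2).re * ρ ^ 2 + (k : ℝ) ^ 2 := by
  have : besselPotential q k ρ = q ^ 2 * ((ρ ^ 2 : ℝ) : ℂ) + (((k : ℝ) ^ 2 : ℝ) : ℂ) := by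
    rw [besselPotential]; push_cast; rfl
  rw [this, Complex.add_re, Complex.re_mul_ofReal, Complex.ofReal_re]

lemma besselPotential_im (q : ℂ) (k : ℤ) (ρ : ℝ) :
    (besselPotential q k ρ).im = (q ^ 2).im * ρ ^ 2 := by
  have : besselPotential q k ρ = q ^ 2 * ((ρ ^ 2 : ℝ) : ℂ) + (((k : ℝ) ^ 2 : ℝ) : ℂ) := by
    rw [besselPotential]; push_cast; rfl
  rw [this, Complex.add_im, Complex.im_mul_ofReal, Complex.ofReal_im, add_zero]

/-- Near the axis the real part of the potential is non-negative. -/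
lemma exists_besselPotential_re_nonneg (hk : k = 0 → 0 < (q ^ 2).re) :
    ∃ b : ℝ, 0 < b ∧ ∀ ρ ∈ Ioc 0 b, 0 ≤ (besselPotential q k ρ).re := by
  by_cases h0 : k = 0
  · refine ⟨1, one_pos, fun ρ hρ => ?_⟩
    rw [besselPotential_re]
    have := hk h0
    positivity
  · have hk1 : (1 : ℝ) ≤ (k : ℝ) ^ 2 := by linarith [sq_sub_quarter_pos h0]
    refine ⟨1 / (1 + |(q ^ 2).re|), by positivity, fun ρ hρ => ?_⟩
    rw [besselPotential_re]
    have h1 : ρ * (1 + |(q ^ 2).re|) ≤ 1 := by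
      rw [← le_div_iff₀ (by positivity)]; exact hρ.2
    have h2 := neg_abs_le (q ^ 2).re
    have h3 : 0 ≤ |(q ^ 2).re| := abs_nonneg _
    have h4 : ρ ≤ 1 := by nlinarith [hρ.1]
    have h5 : |(q ^ 2).re| * ρ ^ 2 ≤ 1 := by nlinarith [hρ.1, mul_nonneg h3 hρ.1.le]
    nlinarith [sq_nonneg ρ]

/-- The flux in direction `q̄` of a solution that is bounded on the axis is non-negative. -/
lemma IsRadialSol.re_conj_mul_flux_nonneg (h : IsBesselSol q k u v) (hq : 0 ≤ q.re) (hq0 : q ≠ 0)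
    (hk : k = 0 → 0 < (q ^ 2).re) {C : ℝ} (hC : ∀ᶠ ρ in 𝓝[>] (0 : ℝ), ‖u ρ‖ ≤ C) :
    ∀ ρ ∈ Ioi (0 : ℝ), 0 ≤ ((starRingEnd ℂ) q * flux u v ρ).re := by
  obtain ⟨b, hb, hV⟩ := exists_besselPotential_re_nonneg (q := q) hk
  have hj := h.re_flux_nonneg_of_bounded (fun _ hr => hr) divergesAt_id hV hC
  intro s hs
  by_contra! hneg
  obtain ⟨d, hd, hdC⟩ := mem_nhdsGT_iff_exists_Ioc_subset.1 hC
  set e := min s (min b d) with he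
  have he0 : 0 < e := lt_min hs (lt_min hb hd)
  set c := -((starRingEnd ℂ) q * flux u v s).re with hc
  have hc0 : 0 < c := by linarith
  have hqn : 0 < ‖q‖ := norm_pos_iff.2 hq0
  -- A negative flux in direction `q̄` persists towards the axis. As `u` is bounded, `|v|` is then
  -- bounded below there, so the real flux has derivative at least a constant over `ρ` and tends to
  -- `-∞` at the axis, against its non-negativity.
  have hvlow : ∀ ρ ∈ Ioc 0 e, (c / (‖q‖ * (|C| + 1))) ^ 2 ≤ Complex.normSq (v ρ) := by
    intro ρ hρ
    have h1 := h.re_conj_mul_flux_le hq hρ.1 (hρ.2.trans (min_le_left _ _))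
    have h2 := (neg_le_abs _).trans
      (Complex.abs_re_le_norm ((starRingEnd ℂ) q * flux u v ρ))
    rw [flux, norm_mul, norm_mul, RCLike.norm_conj, RCLike.norm_conj] at h2
    have h3 : ‖u ρ‖ ≤ C := hdC ⟨hρ.1, hρ.2.trans ((min_le_right _ _).trans (min_le_right _ _))⟩
    have h4 : ‖u ρ‖ ≤ |C| + 1 := h3.trans ((le_abs_self C).trans (by linarith))
    have h5 : c ≤ ‖q‖ * (|C| + 1) * ‖v ρ‖ := by
      calc c ≤ ‖q‖ * (‖u ρ‖ * ‖v ρ‖) := by rw [hc]; rw [flux] at h1; linarith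
        _ ≤ ‖q‖ * ((|C| + 1) * ‖v ρ‖) := by gcongr
        _ = _ := by ring
    rw [Complex.normSq_eq_norm_sq]
    gcongr
    rw [div_le_iff₀ (by positivity)]
    linarith
  have hlim := divergesAt_id.tendsto_atBot (g := fun ρ => (flux u v ρ).re)
    (c := (c / (‖q‖ * (|C| + 1))) ^ 2) he0 (by positivity)
    (fun ρ hρ => (h.hasDerivAt_flux hρ.1).complex_re) (fun ρ hρ => by
      rw [Complex.div_ofReal_re, Complex.add_re, Complex.ofReal_re, Complex.re_mul_ofReal]
      have h1 := hvlow ρ hρ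
      have h2 := mul_nonneg
        (hV ρ ⟨hρ.1, hρ.2.trans ((min_le_right _ _).trans (min_le_left _ _))⟩)
        (Complex.normSq_nonneg (u ρ))
      exact div_le_div_of_nonneg_right (by linarith) hρ.1.le)
  obtain ⟨ρ, h1, h2⟩ := ((hlim.eventually (eventually_lt_atBot 0)).and (Ioc_mem_nhdsGT hb)).exists
  linarith [hj ρ h2]

/-- The only solution that is bounded on the axis and radiating is zero. -/
theorem IsRadialSol.eq_zero_of_bounded_of_radiating (h : IsBesselSol q k u v) (hq : 0 ≤ q.re)
    (hk : k = 0 → 0 < (q ^ 2).re) {C : ℝ} (hC : ∀ᶠ ρ in 𝓝[>] (0 : ℝ), ‖u ρ‖ ≤ C)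
    (hrad : IsRadiating q u v) : ∀ ρ ∈ Ioi (0 : ℝ), u ρ = 0 := by
  have E := isRadialEq_bessel q k
  by_cases hq0 : q = 0
  · subst hq0
    have hk0 : k ≠ 0 := fun h0 => by simpa using hk h0
    set K := k.natAbs with hK
    have hK1 : 1 ≤ K := Nat.one_le_iff_ne_zero.2 (Int.natAbs_ne_zero.2 hk0)
    have hKc : (K : ℂ) ≠ 0 := Nat.cast_ne_zero.2 (by omega)
    -- For `q = 0` the combinations `v + K u` and `v - K u` are multiples of `ρ ^ K` and `ρ ^ (-K)`.
    -- Boundedness at the axis kills the second, the radiation condition the first.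
    have hW : ∀ ρ ∈ Ioi (0 : ℝ), v ρ + K * u ρ = (v 1 + K * u 1) * (ρ : ℂ) ^ K := by
      intro ρ hρ
      have h1 := h.wronskian_const (isBesselSol_inv_pow k) isOpen_Ioi isPreconnected_Ioi hρ
        (mem_Ioi.2 one_pos)
      have h2 : (ρ : ℂ) ^ K ≠ 0 := pow_ne_zero _ (Complex.ofReal_ne_zero.2 (mem_Ioi.1 hρ).ne')
      simp only [← hK, Complex.ofReal_one, one_pow, inv_one] at h1
      field_simp at h1
      linear_combination -h1
    set A := v 1 + K * u 1 with hA
    -- the function `(v - K u) ρ ^ K` is constant and tends to zero on the axis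
    have hconst : ∀ ρ ∈ Ioi (0 : ℝ),
        HasDerivAt (fun ρ : ℝ => (v ρ - K * u ρ) * (ρ : ℂ) ^ K) 0 ρ := by
      intro ρ hρ
      have hρ0 : (ρ : ℂ) ≠ 0 := Complex.ofReal_ne_zero.2 (mem_Ioi.1 hρ).ne'
      have hkk : (k : ℂ) ^ 2 = (K : ℂ) ^ 2 := by
        rw [hK, ← Int.cast_natCast k.natAbs, ← Int.cast_pow, ← Int.cast_pow, Int.natAbs_sq]
      have h1 := ((h.snd ρ hρ).sub ((h.fst ρ hρ).const_mul (K : ℂ))).mul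
        ((Complex.ofRealCLM.hasDerivAt (x := ρ)).pow K)
      refine h1.congr_deriv ?_
      have hp : (ρ : ℂ) ^ K = ρ ^ (K - 1) * ρ := by rw [← pow_succ, Nat.sub_add_cancel hK1]
      simp only [Complex.ofRealCLM_apply, Complex.ofReal_one, mul_one, Pi.pow_apply, Pi.sub_apply]
      rw [besselPotential, hkk, hp]
      field_simp
      ring
    have hB : ∀ ρ ∈ Ioi (0 : ℝ), (v ρ - K * u ρ) * (ρ : ℂ) ^ K = v 1 - K * u 1 := by
      intro ρ hρ
      have := isOpen_Ioi.is_const_of_deriv_eq_zero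
        (f := fun ρ : ℝ => (v ρ - K * u ρ) * (ρ : ℂ) ^ K) isPreconnected_Ioi
        (fun x hx => (hconst x hx).differentiableAt.differentiableWithinAt)
        (fun x hx => (hconst x hx).deriv) hρ (mem_Ioi.2 (one_pos : (0 : ℝ) < 1))
      simpa using this
    have hpow0 : Tendsto (fun ρ : ℝ => ρ ^ K) (𝓝[>] 0) (𝓝 0) := by
      have : Tendsto (fun ρ : ℝ => ρ ^ K) (𝓝 0) (𝓝 (0 ^ K)) := (continuous_pow K).tendsto 0
      rw [zero_pow (by omega)] at this
      exact this.mono_left nhdsWithin_le_nhds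
    have hB0 : v 1 - K * u 1 = 0 := by
      have hlim : Tendsto (fun ρ : ℝ => (‖A‖ * ρ ^ K + 2 * K * C) * ρ ^ K) (𝓝[>] 0) (𝓝 0) := by
        have := ((hpow0.const_mul ‖A‖).add_const (2 * K * C)).mul hpow0
        simpa using this
      refine norm_le_zero_iff.1 (ge_of_tendsto hlim ?_)
      filter_upwards [hC, self_mem_nhdsWithin] with ρ h1 hρ
      have hρ0 : 0 < ρ := hρ
      rw [← hB ρ hρ, show v ρ - K * u ρ = A * (ρ : ℂ) ^ K - 2 * K * u ρ by
        rw [← hW ρ hρ]; ring, norm_mul, norm_pow, Complex.norm_real, Real.norm_eq_abs,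
        abs_of_pos hρ0]
      gcongr
      refine (norm_sub_le _ _).trans ?_
      rw [norm_mul, norm_mul, norm_mul, norm_pow, Complex.norm_real, Real.norm_eq_abs,
        abs_of_pos hρ0, Complex.norm_natCast, Complex.norm_ofNat]
      gcongr
    have hv : ∀ ρ ∈ Ioi (0 : ℝ), v ρ = A / 2 * (ρ : ℂ) ^ K := by
      intro ρ hρ
      have h1 := hB ρ hρ
      rw [hB0, mul_eq_zero] at h1
      have h2 : (ρ : ℂ) ^ K ≠ 0 := pow_ne_zero _ (Complex.ofReal_ne_zero.2 (mem_Ioi.1 hρ).ne')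
      have h3 := h1.resolve_right h2
      linear_combination (1 / 2) * hW ρ hρ + (1 / 2) * h3
    have hA0 : A = 0 := by
      rw [IsRadiating, tendsto_zero_iff_norm_tendsto_zero] at hrad
      have h1 : ‖A / 2‖ ≤ 0 := by
        refine ge_of_tendsto hrad ?_
        filter_upwards [eventually_ge_atTop 1] with ρ hρ
        have hρ0 : 0 < ρ := by linarith
        rw [zero_mul, add_zero, hv ρ hρ0, norm_mul, norm_div (_ * _) (ρ : ℂ), norm_mul (A / 2),
          norm_pow, Complex.norm_real, Complex.norm_real, Real.norm_eq_abs, Real.norm_eq_abs,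
          abs_of_pos hρ0, abs_of_nonneg (Real.sqrt_nonneg _)]
        have h2 : 1 ≤ Real.sqrt ρ := Real.one_le_sqrt.2 hρ
        have h3 : ρ ≤ ρ ^ K := le_self_pow₀ hρ (by omega)
        have h4 : 1 ≤ ρ ^ K / ρ := (one_le_div hρ0).2 h3
        calc ‖A / 2‖ ≤ ‖A / 2‖ * (Real.sqrt ρ * (ρ ^ K / ρ)) :=
              le_mul_of_one_le_right (norm_nonneg _) (one_le_mul_of_one_le_of_one_le h2 h4)
          _ = _ := by ring
      have h5 := norm_le_zero_iff.1 h1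
      simpa using h5
    intro ρ hρ
    have h1 := hW ρ hρ
    rw [hv ρ hρ, hA0] at h1
    simpa [hKc] using h1
  have hg := h.re_conj_mul_flux_nonneg hq hq0 hk hC
  have hrad2 : Tendsto (fun ρ => Complex.normSq (v ρ) / ρ +
      ρ * (Complex.normSq q * Complex.normSq (u ρ)) +
        2 * ((starRingEnd ℂ) q * flux u v ρ).re) atTop (𝓝 0) := by
    have h1 : Tendsto (fun ρ : ℝ => Complex.normSq
        ((Real.sqrt ρ : ℂ) * (v ρ / (ρ : ℝ) + q * u ρ))) atTop (𝓝 (Complex.normSq 0)) :=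
      (Complex.continuous_normSq.tendsto 0).comp hrad
    rw [map_zero] at h1
    refine h1.congr' ?_
    filter_upwards [eventually_gt_atTop 0] with ρ hρ
    exact normSq_radiating _ _ _ hρ
  have hnn := fun z => Complex.normSq_nonneg z
  -- The three terms of the radiation norm are non-negative and their sum tends to zero. The flux is
  -- one of them up to the factor 2 and is non-decreasing, so it vanishes identically.
  have hg0 : ∀ ρ ∈ Ioi (0 : ℝ), ((starRingEnd ℂ) q * flux u v ρ).re = 0 := by
    intro ρ hρ
    refine le_antisymm (ge_of_tendsto hrad2 ?_) (hg ρ hρ)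
    filter_upwards [eventually_ge_atTop ρ] with x hx
    have hx0 : 0 < x := lt_of_lt_of_le hρ hx
    have h1 := h.re_conj_mul_flux_le hq hρ hx
    have h2 : 0 ≤ Complex.normSq (v x) / x := div_nonneg (hnn _) hx0.le
    have h3 : 0 ≤ x * (Complex.normSq q * Complex.normSq (u x)) :=
      mul_nonneg hx0.le (mul_nonneg (hnn _) (hnn _))
    have h4 := hg x hx0
    linarith
  rcases hq.eq_or_lt with hre | hre
  · -- `q` is imaginary
    have hk0 : k ≠ 0 := fun h0 => by
      have h1 := hk h0
      rw [sq, Complex.mul_re, ← hre] at h1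
      nlinarith [sq_nonneg q.im]
    have hqI : q = Complex.I * (q.im : ℂ) := by
      apply Complex.ext <;> simp [← hre]
    have hσ : q.im ≠ 0 := fun h0 => hq0 (by rw [hqI, h0]; simp)
    have hq2 : q ^ 2 = -(q.im : ℂ) ^ 2 := by
      conv_lhs => rw [hqI]
      rw [mul_pow, Complex.I_sq]; ring
    have hvlim : Tendsto (fun ρ => Complex.normSq (v ρ) / ρ) atTop (𝓝 0) := by
      refine tendsto_of_tendsto_of_tendsto_of_le_of_le' tendsto_const_nhds hrad2 ?_ ?_
      all_goals
        filter_upwards [eventually_gt_atTop 0] with x hx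
        have h3 : 0 ≤ x * (Complex.normSq q * Complex.normSq (u x)) :=
          mul_nonneg hx.le (mul_nonneg (hnn _) (hnn _))
        have h2 : 0 ≤ Complex.normSq (v x) / x := div_nonneg (hnn _) hx.le
        have h4 := hg x hx
        linarith
    have hulim : Tendsto (fun ρ => Complex.normSq (liouville u ρ)) atTop (𝓝 0) := by
      have h1 := hrad2.const_mul (Complex.normSq q)⁻¹
      rw [mul_zero] at h1
      have hqp : 0 < Complex.normSq q := Complex.normSq_pos.2 hq0
      refine tendsto_of_tendsto_of_tendsto_of_le_of_le' tendsto_const_nhds h1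
        (Eventually.of_forall fun _ => hnn _) ?_
      filter_upwards [eventually_gt_atTop 0] with x hx
      have h2 : 0 ≤ Complex.normSq (v x) / x := div_nonneg (hnn _) hx.le
      have h4 := hg x hx
      rw [liouville, Complex.normSq_mul, Complex.normSq_ofReal, Real.mul_self_sqrt hx.le,
        inv_mul_eq_div, le_div_iff₀ hqp]
      linarith
    -- The energy is non-decreasing and tends to zero, so it is non-positive. At a radius of
    -- positive frequency it is a sum of squares, and therefore `u` and `v` both vanish there.
    have hElim : Tendsto (liouvilleEnergy q.im k u v) atTop (𝓝 0) := by
      have hD : Tendsto (fun ρ => Complex.normSq (liouvilleDeriv u v ρ)) atTop (𝓝 0) := by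
        have h1 : Tendsto (fun ρ => 2 * (Complex.normSq (v ρ) / ρ) +
            Complex.normSq (liouville u ρ)) atTop (𝓝 0) := by
          simpa using (hvlim.const_mul 2).add hulim
        refine tendsto_of_tendsto_of_tendsto_of_le_of_le' tendsto_const_nhds h1
          (Eventually.of_forall fun _ => hnn _) ?_
        filter_upwards [eventually_ge_atTop 1] with x hx
        have hx0 : 0 < x := by linarith
        rw [liouvilleDeriv, liouville, Complex.normSq_div, Complex.normSq_mul,
          Complex.normSq_ofReal, Real.mul_self_sqrt hx0.le, div_le_iff₀ hx0]
        have h2 : Complex.normSq (v x + u x / 2) ≤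
            2 * Complex.normSq (v x) + Complex.normSq (u x) := by
          have e1 := norm_add_le (v x) (u x / 2)
          rw [norm_div, Complex.norm_ofNat] at e1
          simp only [Complex.normSq_eq_norm_sq]
          nlinarith [norm_nonneg (v x + u x / 2), sq_nonneg (‖v x‖ - ‖u x‖ / 2), norm_nonneg (u x),
            norm_nonneg (v x)]
        have h3 : (2 * (Complex.normSq (v x) / x) + x * Complex.normSq (u x)) * x =
            2 * Complex.normSq (v x) + x ^ 2 * Complex.normSq (u x) := by field_simp
        rw [h3]
        have h4 : 1 ≤ x ^ 2 := one_le_pow₀ hx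
        nlinarith [hnn (u x)]
      have h1 := hD.add ((tendsto_liouvilleFreq q.im k).mul hulim)
      rw [mul_zero, add_zero] at h1
      exact h1
    have hE0 : ∀ ρ ∈ Ioi (0 : ℝ), liouvilleEnergy q.im k u v ρ ≤ 0 := fun ρ hρ => by
      refine ge_of_tendsto hElim ?_
      filter_upwards [eventually_ge_atTop ρ] with x hx
      exact h.liouvilleEnergy_le hq2 hk0 hρ hx
    have hσ2 : 0 < q.im ^ 2 := by positivity
    obtain ⟨x, hx1, hx0⟩ := (((tendsto_liouvilleFreq q.im k).eventually
      (lt_mem_nhds hσ2)).and (eventually_gt_atTop 0)).exists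
    have h1 := hE0 x hx0
    have h2 := mul_nonneg hx1.le (hnn (liouville u x))
    rw [liouvilleEnergy] at h1
    have h3 : Complex.normSq (liouvilleDeriv u v x) = 0 :=
      le_antisymm (by linarith) (hnn _)
    have h4 : liouvilleFreq q.im k x * Complex.normSq (liouville u x) = 0 :=
      le_antisymm (by linarith [hnn (liouvilleDeriv u v x)]) h2
    have hs : (Real.sqrt x : ℂ) ≠ 0 := Complex.ofReal_ne_zero.2 (Real.sqrt_pos.2 hx0).ne'
    have hu0 : u x = 0 := by
      have h5 := Complex.normSq_eq_zero.1 ((mul_eq_zero.1 h4).resolve_left hx1.ne')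
      exact (mul_eq_zero.1 h5).resolve_left hs
    have hv0 : v x = 0 := by
      have h5 := (div_eq_zero_iff.1 (Complex.normSq_eq_zero.1 h3)).resolve_right hs
      simpa [hu0] using h5
    exact fun ρ hρ => (h.eq_zero E.continuousOn_coeff E.coeff_pos E.continuousOn_potential hx0
      hu0 hv0 hρ).1
  -- For `Re q > 0` the derivative of the vanishing flux is a non-negative combination of `|v|²` and
  -- `|u|²`, with positive weight on `|u|²`.
  · intro ρ hρ
    have hρ0 : 0 < ρ := hρ
    have h1 := (h.hasDerivAt_re_mul_flux ((starRingEnd ℂ) q) hρ).unique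
      ((hasDerivAt_const ρ (0 : ℝ)).congr_of_eventuallyEq (by
        filter_upwards [Ioi_mem_nhds hρ0] with x hx using hg0 x hx))
    rw [conj_mul_besselPotential_re, Complex.conj_re, div_eq_zero_iff] at h1
    have h2 := h1.resolve_right hρ0.ne'
    have hqp : 0 < Complex.normSq q := Complex.normSq_pos.2 hq0
    have h3 : 0 ≤ q.re * Complex.normSq (v ρ) := mul_nonneg hre.le (hnn _)
    have h4 : 0 < q.re * (Complex.normSq q * ρ ^ 2 + (k : ℝ) ^ 2) := by positivity
    have h5 := mul_nonneg h4.le (hnn (u ρ))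
    have h6 : q.re * (Complex.normSq q * ρ ^ 2 + (k : ℝ) ^ 2) * Complex.normSq (u ρ) = 0 :=
      le_antisymm (by linarith) h5
    exact Complex.normSq_eq_zero.1 ((mul_eq_zero.1 h6).resolve_left h4.ne')

/-- A radiating solution exists for every momentum. -/
theorem exists_radiating_bessel (hq : 0 ≤ q.re) (hk : k = 0 → 0 < (q ^ 2).re) :
    ∃ u v, IsBesselSol q k u v ∧ IsNontrivial 0 u v ∧ IsRadiating q u v ∧
      (0 < q.re → (∀ ρ ∈ Ioi (0 : ℝ), ((starRingEnd ℂ) q * flux u v ρ).re ≤ 0) ∧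
        Tendsto (flux u v) atTop (𝓝 0)) := by
  rcases hq.eq_or_lt with hre | hre
  · have hk0 : k ≠ 0 := fun h0 => by
      have h1 := hk h0
      rw [sq, Complex.mul_re, ← hre] at h1
      nlinarith [sq_nonneg q.im]
    have hqI : q = Complex.I * (q.im : ℂ) := by
      apply Complex.ext <;> simp [← hre]
    by_cases hσ : q.im = 0
    · have hq0 : q = 0 := by rw [hqI, hσ]; simp
      subst hq0
      obtain ⟨u, v, h1, h2, h3⟩ := exists_radiating_bessel_of_zero hk0
      exact ⟨u, v, h1, h2, h3, fun h4 => absurd h4 (by simp)⟩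
    · obtain ⟨u, v, h1, h2, h3⟩ := exists_radiating_bessel_of_imag hσ hk0
      rw [← hqI] at h1 h3
      exact ⟨u, v, h1, h2, h3, fun h4 => absurd hre h4.ne⟩
  · obtain ⟨u, v, h1, h2, h3, h4⟩ := exists_decaying_bessel (k := k) hre
    refine ⟨u, v, h1, h2, isRadiating_of_tendsto h4, fun _ => ⟨h3, ?_⟩⟩
    rw [tendsto_zero_iff_norm_tendsto_zero]
    refine tendsto_of_tendsto_of_tendsto_of_le_of_le' tendsto_const_nhds h4
      (Eventually.of_forall fun _ => norm_nonneg _) ?_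
    filter_upwards [eventually_gt_atTop 0] with ρ hρ
    rw [flux, norm_mul, RCLike.norm_conj]
    have e1 : (‖v ρ‖ / Real.sqrt ρ) ^ 2 = Complex.normSq (v ρ) / ρ := by
      rw [div_pow, Real.sq_sqrt hρ.le, Complex.normSq_eq_norm_sq]
    have e2 : (Real.sqrt ρ * ‖u ρ‖) ^ 2 = ρ * Complex.normSq (u ρ) := by
      rw [mul_pow, Real.sq_sqrt hρ.le, Complex.normSq_eq_norm_sq]
    have e3 : (‖v ρ‖ / Real.sqrt ρ) * (Real.sqrt ρ * ‖u ρ‖) = ‖u ρ‖ * ‖v ρ‖ := by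
      have := (Real.sqrt_pos.2 hρ).ne'
      field_simp
    rw [← e1, ← e2, ← e3]
    have e4 : 0 ≤ ‖v ρ‖ / Real.sqrt ρ := by positivity
    have e5 : 0 ≤ Real.sqrt ρ * ‖u ρ‖ := by positivity
    nlinarith [sq_nonneg (‖v ρ‖ / Real.sqrt ρ - Real.sqrt ρ * ‖u ρ‖), mul_nonneg e4 e5]

end Uniqueness

/-! ### Radial Green's functions of rotating Minkowski spacetime -/

lemma IsRadialSol.congr_coeff {p p' : ℝ → ℝ} {V u v : ℝ → ℂ} {S : Set ℝ}
    (h : IsRadialSol p V S u v) (hp : ∀ r ∈ S, p r = p' r) : IsRadialSol p' V S u v :=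
  ⟨fun r hr => hp r hr ▸ h.fst r hr, fun r hr => hp r hr ▸ h.snd r hr⟩

/-- Two solutions with vanishing Wronskian are proportional. -/
lemma IsRadialSol.exists_eq_mul {p : ℝ → ℝ} {V u v x y : ℝ → ℂ} {a s : ℝ} (E : IsRadialEq p V a)
    (hu : IsRadialSol p V (Ioi a) u v) (hx : IsRadialSol p V (Ioi a) x y)
    (hx0 : IsNontrivial a x y) (hs : a < s) (hW : v s * x s - u s * y s = 0) :
    ∃ c : ℂ, ∀ r ∈ Ioi a, u r = c * x r ∧ v r = c * y r := by
  have key : ∀ c : ℂ, u s = c * x s → v s = c * y s →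
      ∀ r ∈ Ioi a, u r = c * x r ∧ v r = c * y r := by
    intro c h1 h2 r hr
    have := (hu.comb hx 1 (-c)).eq_zero E.continuousOn_coeff E.coeff_pos E.continuousOn_potential hs
      (by rw [h1]; ring) (by rw [h2]; ring) hr
    exact ⟨by linear_combination this.1, by linear_combination this.2⟩
  by_cases h0 : x s = 0
  · have hy : y s ≠ 0 := fun h1 => hx0 s hs ⟨h0, h1⟩
    refine ⟨v s / y s, key _ ?_ (by field_simp)⟩
    have h1 : u s * y s = 0 := by rw [h0] at hW; linear_combination -hW
    rw [h0, mul_zero, (mul_eq_zero.1 h1).resolve_right hy]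
  · refine ⟨u s / x s, key _ (by field_simp) ?_⟩
    field_simp
    linear_combination hW

lemma isSection_minkowski (Ω : ℝ) :
    IsSection (fun _ => 1) (fun _ => 1) (fun ρ => ρ ^ 2) (fun _ => Ω) 0 :=
  ⟨contDiffOn_const, contDiffOn_const, (contDiff_id.pow 2).contDiffOn, contDiffOn_const,
    fun _ _ => one_pos, fun _ _ => one_pos, fun _ hr => pow_pos hr 2⟩

/-- The coefficient of the radial equation of Minkowski spacetime. -/
noncomputable abbrev minkowskiCoeff : ℝ → ℝ :=
  radialCoeff (fun _ => 1) (fun _ => 1) (fun ρ => ρ ^ 2)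

lemma minkowskiCoeff_eq {ρ : ℝ} (hρ : ρ ∈ Ioi (0 : ℝ)) : minkowskiCoeff ρ = ρ := by
  rw [minkowskiCoeff, radialCoeff, Real.sqrt_sq (le_of_lt hρ), Real.sqrt_one, one_mul, div_one]

/-- The potential of the radial equation of rotating Minkowski spacetime. -/
noncomputable abbrev minkowskiPotential (Ω m ω : ℝ) (k : ℤ) : ℝ → ℂ :=
  radialPotential (fun _ => 1) (fun ρ => ρ ^ 2) (fun _ => Ω) m ω k

section Minkowski

variable {Ω m ω : ℝ} {k : ℤ} {q : ℂ}

lemma minkowskiPotential_eq (hq : q ^ 2 = ((ω : ℝ) + Complex.I * k * Ω) ^ 2 + (m : ℂ) ^ 2) :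
    minkowskiPotential Ω m ω k = besselPotential q k := by
  funext ρ
  rw [minkowskiPotential, radialPotential, besselPotential, hq]
  push_cast
  ring

lemma isBesselSol_iff (hq : q ^ 2 = ((ω : ℝ) + Complex.I * k * Ω) ^ 2 + (m : ℂ) ^ 2)
    {u v : ℝ → ℂ} :
    IsRadialSol minkowskiCoeff (minkowskiPotential Ω m ω k) (Ioi 0) u v ↔ IsBesselSol q k u v := by
  rw [minkowskiPotential_eq hq]
  exact ⟨fun h => h.congr_coeff fun r hr => minkowskiCoeff_eq hr,
    fun h => h.congr_coeff fun r hr => (minkowskiCoeff_eq hr).symm⟩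

/-- Rotation does not affect axisymmetric modes: for `k = 0` the squared momentum is `ω² + m²`. The
positive mass excludes a vanishing or imaginary momentum. -/
lemma sq_re_pos_of_eq_zero (hm : 0 < m)
    (hq : q ^ 2 = ((ω : ℝ) + Complex.I * k * Ω) ^ 2 + (m : ℂ) ^ 2) (hk : k = 0) :
    0 < (q ^ 2).re := by
  have : q ^ 2 = ((ω ^ 2 + m ^ 2 : ℝ) : ℂ) := by rw [hq, hk]; push_cast; ring
  rw [this, Complex.ofReal_re]
  positivity

/-- The pair of solutions from which the radial Green's function is built. -/
structure IsMinkowskiPair (q : ℂ) (Ω m ω : ℝ) (k : ℤ) (u v x y : ℝ → ℂ) (W : ℂ) : Prop extends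
    IsGreenPair minkowskiCoeff (minkowskiPotential Ω m ω k) 0 u v x y W where
  regular : ∃ C : ℝ, ∀ᶠ ρ in 𝓝[>] (0 : ℝ), ‖u ρ‖ ≤ C
  radiating : IsRadiating q x y
  flux_nonpos : 0 < q.re → ∀ ρ ∈ Ioi (0 : ℝ), ((starRingEnd ℂ) q * flux x y ρ).re ≤ 0
  tendsto_flux : 0 < q.re → Tendsto (flux x y) atTop (𝓝 0)

lemma IsGreenPair.isNontrivial_fst {p : ℝ → ℝ} {V u v x y : ℝ → ℂ} {a : ℝ} {W : ℂ}
    (h : IsGreenPair p V a u v x y W) : IsNontrivial a u v := fun r hr h0 =>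
  h.ne_zero (by rw [← h.wronskian r hr, h0.1, h0.2]; ring)

lemma IsGreenPair.isNontrivial_snd {p : ℝ → ℝ} {V u v x y : ℝ → ℂ} {a : ℝ} {W : ℂ}
    (h : IsGreenPair p V a u v x y W) : IsNontrivial a x y := fun r hr h0 =>
  h.ne_zero (by rw [← h.wronskian r hr, h0.1, h0.2]; ring)

/-- If the Wronskian vanished, the two solutions would be proportional and the regular one would
also be radiating; uniqueness then forces it to be zero. -/
theorem exists_isMinkowskiPair (hm : 0 < m) (hre : 0 ≤ q.re)
    (hq : q ^ 2 = ((ω : ℝ) + Complex.I * k * Ω) ^ 2 + (m : ℂ) ^ 2) :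
    ∃ u v x y W, IsMinkowskiPair q Ω m ω k u v x y W := by
  have hk := sq_re_pos_of_eq_zero (k := k) hm hq
  have E := isRadialEq_bessel q k
  obtain ⟨b, hb, hV⟩ := exists_besselPotential_re_nonneg (q := q) hk
  obtain ⟨u, v, hu, hu0, hj⟩ := exists_sol_re_flux_nonneg E hb hV
  obtain ⟨x, y, hx, hx0, hxr, hxj⟩ := exists_radiating_bessel hre hk
  have hC : ∀ᶠ ρ in 𝓝[>] (0 : ℝ), ‖u ρ‖ ≤ ‖u b‖ := by
    filter_upwards [Ioc_mem_nhdsGT hb] with ρ hρ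
    exact hu.norm_fst_le hρ.2 (fun s hs => hρ.1.trans_le hs.1) (fun s hs => hρ.1.trans_le hs.1)
      (fun s hs => hj s ⟨hρ.1.trans_le hs.1, hs.2⟩)
  refine ⟨u, v, x, y, v 1 * x 1 - u 1 * y 1, ⟨(isBesselSol_iff hq).2 hu, (isBesselSol_iff hq).2 hx,
    fun r hr => ?_, fun hW => ?_⟩, ⟨_, hC⟩, hxr, fun h => (hxj h).1, fun h => (hxj h).2⟩
  · have := hu.wronskian_const hx isOpen_Ioi isPreconnected_Ioi hr
      (mem_Ioi.2 (one_pos : (0 : ℝ) < 1))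
    linear_combination -this
  · obtain ⟨c, hc⟩ := hu.exists_eq_mul E hx hx0 one_pos hW
    have hrad : IsRadiating q u v := by
      have := hxr.const_mul c
      rw [mul_zero] at this
      refine this.congr' ?_
      filter_upwards [eventually_gt_atTop 0] with ρ hρ
      rw [(hc ρ hρ).1, (hc ρ hρ).2]
      ring
    have hz := hu.eq_zero_of_bounded_of_radiating hre hk hC hrad
    have hone : (1 : ℝ) ∈ Ioi (0 : ℝ) := mem_Ioi.2 one_pos
    refine hu0 1 hone ⟨hz 1 hone, hu.snd_eq_zero_of_eventually hone one_ne_zero ?_⟩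
    filter_upwards [Ioi_mem_nhds one_pos] with ρ hρ using hz ρ hρ

section Green

variable {T : ℝ} {n : ℤ} {Q : ℤ → ℤ → ℂ}

lemma IsMinkowskiPair.isMinkowskiRadialGreen {u v x y : ℝ → ℂ} {W : ℂ}
    (h : IsMinkowskiPair (Q n k) Ω m (2 * Real.pi * T * n) k u v x y W) :
    IsMinkowskiRadialGreen T Ω m Q n k (greenKernel u x W) := by
  have H := isSection_minkowski Ω
  have E := H.isRadialEq m (2 * Real.pi * T * n) k
  refine ⟨H.isModeGreen isOpen_Ioi Subset.rfl (isRadialGreenFn_greenKernel isOpen_Ioi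
    E.continuousOn_coeff E.coeff_pos h.fst h.snd h.wronskian h.ne_zero), fun ρ' hρ' => ?_,
    fun ρ' hρ' => ?_⟩
  · obtain ⟨C, hC⟩ := h.regular
    refine ⟨C * ‖x ρ' / W‖, ?_⟩
    filter_upwards [hC, Ioo_mem_nhdsGT (mem_Ioi.1 hρ')] with ρ h1 h2
    rw [greenKernel_of_le h2.2.le, norm_mul]
    gcongr
  · have h1 := h.radiating.const_mul (u ρ' / W)
    rw [mul_zero] at h1
    refine h1.congr' ?_
    filter_upwards [eventually_gt_atTop ρ'] with ρ hρ
    have hρ0 : ρ ∈ Ioi (0 : ℝ) := lt_trans hρ' hρ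
    rw [(h.snd.hasDerivAt_greenKernel_of_gt hρ0 hρ).deriv, greenKernel_of_ge hρ.le,
      minkowskiCoeff_eq hρ0]
    ring

theorem IsMinkowskiRadialGreen.unique (hm : 0 < m) (hQ : IsMomentum T Ω m Q) {G G' : ℝ → ℝ → ℂ}
    (hG : IsMinkowskiRadialGreen T Ω m Q n k G) (hG' : IsMinkowskiRadialGreen T Ω m Q n k G') :
    ∀ s ∈ Ioi (0 : ℝ), ∀ s' ∈ Ioi (0 : ℝ), G' s s' = G s s' := by
  intro s hs s' hs'
  have H := isSection_minkowski Ω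
  have E := H.isRadialEq m (2 * Real.pi * T * n) k
  obtain ⟨u₁, v₁, u₂, v₂, F⟩ := exists_isFundamental E.continuousOn_coeff E.coeff_pos
    E.continuousOn_potential
  have g := H.isRadialGreenFn isOpen_Ioi Subset.rfl hG.green
  have g' := H.isRadialGreenFn isOpen_Ioi Subset.rfl hG'.green
  obtain ⟨c₁, c₂, hc⟩ := g.exists_sub_eq g' isOpen_Ioi ordConnected_Ioi Subset.rfl
    E.continuousOn_coeff E.coeff_pos F hs'
  obtain ⟨C, hC⟩ := hG.regular s' hs'
  obtain ⟨C', hC'⟩ := hG'.regular s' hs'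
  have hcomb := (isBesselSol_iff (hQ n k).1).1 (F.sol₁.comb F.sol₂ c₁ c₂)
  have h0 := hcomb.eq_zero_of_bounded_of_radiating (hQ n k).2
    (sq_re_pos_of_eq_zero hm (hQ n k).1) (C := C' + C) (by
      filter_upwards [hC, hC', self_mem_nhdsWithin] with r h1 h2 hr
      rw [← hc r hr]
      exact (norm_sub_le _ _).trans (add_le_add h2 h1)) (by
      have := (hG'.radiation s' hs').sub (hG.radiation s' hs')
      rw [sub_zero] at this
      refine this.congr' ?_
      filter_upwards [eventually_gt_atTop s'] with r hr
      have hr0 : r ∈ Ioi (0 : ℝ) := lt_trans hs' hr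
      have hd : HasDerivAt (fun r => G' r s' - G r s')
          (deriv (fun r => G' r s') r - deriv (fun r => G r s') r) r :=
        ((g'.sol s' hs').fst r ⟨hr0, hr.ne'⟩).differentiableAt.hasDerivAt.sub
          ((g.sol s' hs').fst r ⟨hr0, hr.ne'⟩).differentiableAt.hasDerivAt
      have he := hd.unique ((hcomb.fst r hr0).congr_of_eventuallyEq (by
        filter_upwards [Ioi_mem_nhds hr0] with t ht using hc t ht))
      rw [← he, ← hc r hr0]
      ring) s hs
  rw [← hc s hs] at h0
  exact sub_eq_zero.1 h0

end Green

end Minkowski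

/-! ### The radiating solution decays where the corotating observers are timelike -/

section Flux

variable {q : ℂ} {k : ℤ} {x y : ℝ → ℂ}

lemma conj_mul_re (z w : ℂ) : ((starRingEnd ℂ) z * w).re = z.re * w.re + z.im * w.im := by
  rw [Complex.mul_re, Complex.conj_re, Complex.conj_im]
  ring

/-- The imaginary part of the flux is conserved if the potential is real. -/
lemma IsRadialSol.im_flux_eq (h : IsBesselSol q k x y) (hq : (q ^ 2).im = 0) {r s : ℝ}
    (hr : r ∈ Ioi (0 : ℝ)) (hs : s ∈ Ioi (0 : ℝ)) : (flux x y r).im = (flux x y s).im := by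
  have hd : ∀ s ∈ Ioi (0 : ℝ), HasDerivAt (fun s => (flux x y s).im) 0 s := fun s hs => by
    refine (h.hasDerivAt_flux hs).complex_im.congr_deriv ?_
    rw [Complex.div_ofReal_im, Complex.add_im, Complex.ofReal_im, Complex.im_mul_ofReal,
      besselPotential_im, hq]
    simp
  exact isOpen_Ioi.is_const_of_deriv_eq_zero isPreconnected_Ioi
    (fun x hx => (hd x hx).differentiableAt.differentiableWithinAt)
    (fun x hx => (hd x hx).deriv) hr hs

/-- For imaginary momentum, the flux of a radiating solution at the turning point is controlled by
the conserved current. -/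
lemma IsRadialSol.re_flux_le_of_radiating (h : IsBesselSol q k x y) (hre : q.re = 0)
    (him : q.im ≠ 0) (hk : k ≠ 0) (hrad : IsRadiating q x y) {ρ : ℝ} (hρ : 0 < ρ)
    (ht : q.im ^ 2 * ρ ^ 2 = (k : ℝ) ^ 2) :
    (flux x y ρ).re ≤ 4 * ρ * |q.im| * |(flux x y ρ).im| := by
  have hnn := fun z => Complex.normSq_nonneg z
  have hqI : q = Complex.I * (q.im : ℂ) := by
    apply Complex.ext <;> simp [hre]
  have hq2 : q ^ 2 = -(q.im : ℂ) ^ 2 := by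
    conv_lhs => rw [hqI]
    rw [mul_pow, Complex.I_sq]; ring
  have hq2im : (q ^ 2).im = 0 := by rw [sq, Complex.mul_im, hre]; ring
  have hconst : ∀ s ∈ Ioi (0 : ℝ), (flux x y s).im = (flux x y ρ).im := fun s hs =>
    h.im_flux_eq hq2im hs hρ
  set J := (flux x y ρ).im with hJ
  have hqn : Complex.normSq q = q.im ^ 2 := by rw [Complex.normSq_apply, hre]; ring
  -- The cross term in the squared radiation condition is the conserved current, so the remaining
  -- quadratic form has a limit given by `J` alone. Twice this form majorises the Liouville energy
  -- at large radius.
  have hlim : Tendsto (fun s => 2 * (Complex.normSq (y s) / s +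
      s * (q.im ^ 2 * Complex.normSq (x s)))) atTop (𝓝 (2 * (0 - 2 * (q.im * J)))) := by
    have h1 : Tendsto (fun s : ℝ => Complex.normSq
        ((Real.sqrt s : ℂ) * (y s / (s : ℝ) + q * x s))) atTop (𝓝 (Complex.normSq 0)) :=
      (Complex.continuous_normSq.tendsto 0).comp hrad
    rw [map_zero] at h1
    refine ((h1.sub_const (2 * (q.im * J))).const_mul 2).congr' ?_
    filter_upwards [eventually_gt_atTop 0] with s hs
    have h2 : ((starRingEnd ℂ) q * ((starRingEnd ℂ) (x s) * y s)).re = q.im * J := by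
      rw [← hconst s hs, conj_mul_re, hre, zero_mul, zero_add, flux]
    rw [normSq_radiating _ _ _ hs, h2, hqn]
    ring
  have hE : liouvilleEnergy q.im k x y ρ ≤ 2 * (0 - 2 * (q.im * J)) := by
    refine ge_of_tendsto hlim ?_
    filter_upwards [eventually_ge_atTop ρ, eventually_ge_atTop (1 / |q.im|)] with s hs1 hs2
    have hs0 : 0 < s := hρ.trans_le hs1
    refine (h.liouvilleEnergy_le hq2 hk hρ hs1).trans ?_
    rw [liouvilleEnergy, liouville, liouvilleDeriv, Complex.normSq_div, Complex.normSq_mul,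
      Complex.normSq_ofReal, Real.mul_self_sqrt hs0.le]
    have e1 : 1 ≤ q.im ^ 2 * s ^ 2 := by
      rw [div_le_iff₀ (abs_pos.2 him)] at hs2
      have := mul_self_le_mul_self zero_le_one hs2
      nlinarith [sq_abs q.im]
    have e2 : Complex.normSq (y s + x s / 2) ≤
        2 * Complex.normSq (y s) + Complex.normSq (x s) := by
      have e1 := norm_add_le (y s) (x s / 2)
      rw [norm_div, Complex.norm_ofNat] at e1
      simp only [Complex.normSq_eq_norm_sq]
      nlinarith [norm_nonneg (y s + x s / 2), sq_nonneg (‖y s‖ - ‖x s‖ / 2), norm_nonneg (x s),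
        norm_nonneg (y s)]
    have e3 : liouvilleFreq q.im k s ≤ q.im ^ 2 := by
      rw [liouvilleFreq]
      have := div_nonneg (by linarith [sq_sub_quarter_pos hk] : 0 ≤ (k : ℝ) ^ 2 - 1 / 4)
        (sq_nonneg s)
      linarith
    have e4 := mul_le_mul_of_nonneg_right e3 (mul_nonneg hs0.le (hnn (x s)))
    have e5 : Complex.normSq (y s + x s / 2) / s ≤
        2 * (Complex.normSq (y s) / s) + s * (q.im ^ 2 * Complex.normSq (x s)) := by
      rw [div_le_iff₀ hs0]
      have : (2 * (Complex.normSq (y s) / s) + s * (q.im ^ 2 * Complex.normSq (x s))) * s =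
          2 * Complex.normSq (y s) + q.im ^ 2 * s ^ 2 * Complex.normSq (x s) := by field_simp
      rw [this]
      nlinarith [mul_le_mul_of_nonneg_right e1 (hnn (x s))]
    linarith
  -- At the turning point `ρ²` times the frequency equals `1 / 4`, so `ρ E` is a definite quadratic
  -- form in `(x, y)` that dominates the real flux.
  have hflux : (flux x y ρ).re ≤ ρ * liouvilleEnergy q.im k x y ρ := by
    have hfreq : ρ ^ 2 * liouvilleFreq q.im k ρ = 1 / 4 := by
      rw [liouvilleFreq]
      field_simp
      linear_combination 4 * ht
    have e1 : ρ * liouvilleEnergy q.im k x y ρ =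
        Complex.normSq (y ρ + x ρ / 2) + 1 / 4 * Complex.normSq (x ρ) := by
      rw [liouvilleEnergy, liouville, liouvilleDeriv, Complex.normSq_div, Complex.normSq_mul,
        Complex.normSq_ofReal, Real.mul_self_sqrt hρ.le, ← hfreq]
      field_simp
    rw [e1, flux, conj_mul_re, Complex.normSq_apply, Complex.normSq_apply]
    simp only [Complex.add_re, Complex.add_im, Complex.div_ofNat_re, Complex.div_ofNat_im]
    nlinarith [sq_nonneg (y ρ).re, sq_nonneg (y ρ).im, sq_nonneg (x ρ).re, sq_nonneg (x ρ).im]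
  have hfin : -(q.im * J) ≤ |q.im| * |J| := by
    rw [← abs_mul]; exact neg_le_abs _
  nlinarith [mul_le_mul_of_nonneg_left hE hρ.le, mul_le_mul_of_nonneg_left hfin hρ.le]

end Flux

section Decay

variable {Ω m κ β γ : ℝ}

lemma minkowskiPotential_re_nonneg (ω : ℝ) (k : ℤ) {ρ : ℝ} (hρ : ρ ^ 2 * Ω ^ 2 ≤ 1) :
    0 ≤ (minkowskiPotential Ω m ω k ρ).re := by
  rw [radialPotential_re]
  have : 0 ≤ (1 ^ 2 - ρ ^ 2 * Ω ^ 2) * (k : ℝ) ^ 2 := mul_nonneg (by linarith) (sq_nonneg _)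
  positivity

lemma modeNorm_zero : modeNorm 0 = 0 := by simp [modeNorm]

/-- A solution that grows somewhere grows at the rate of the recessive exponential beyond. -/
lemma exists_minkowski_logDeriv (hβ : 0 < β) (hβγ : β < γ) (ht : γ ^ 2 * Ω ^ 2 < 1) (hκ : 0 < κ)
    (m : ℝ) : ∃ K c C Λ : ℝ, 0 ≤ K ∧ 0 < c ∧ 0 < C ∧ 1 ≤ Λ ∧ ∀ p : ℤ × ℤ, Λ ≤ modeNorm p →
      c * modeNorm p ^ 2 ≤ (minkowskiPotential Ω m (κ * p.1) p.2 γ).re ∧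
      ‖minkowskiPotential Ω m (κ * p.1) p.2 γ‖ ≤ C * modeNorm p ^ 2 ∧
      ∀ x y, IsRadialSol minkowskiCoeff (minkowskiPotential Ω m (κ * p.1) p.2) (Ioi 0) x y →
        0 < (flux x y β).re → x γ ≠ 0 ∧
        ‖y γ / x γ - (minkowskiPotential Ω m (κ * p.1) p.2 γ ^ (1 / 2 : ℂ) -
          (minkowskiPotential Ω m (κ * p.1) p.2 γ - (p.2 : ℂ) ^ 2) /
            (2 * minkowskiPotential Ω m (κ * p.1) p.2 γ))‖ ≤ K / modeNorm p := by
  have H := isSection_minkowski Ω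
  have hγ : 0 < γ := hβ.trans hβγ
  have ht' : ∀ r ∈ Icc β γ, r ^ 2 * Ω ^ 2 < 1 := fun r hr => by
    have : r ^ 2 ≤ γ ^ 2 := pow_le_pow_left₀ (hβ.le.trans hr.1) hr.2 2
    nlinarith [sq_nonneg Ω]
  obtain ⟨c, C, V₁, V₂, hc, hb⟩ := H.exists_potentialBounds hβ hβγ.le
    (fun r hr => by simpa using ht' r hr) hκ m
  obtain ⟨P₁, P₂, hP₁, hp⟩ := H.exists_coeff_bounds hβ hβγ.le
  obtain ⟨K, Λ, hK, hΛ, hw⟩ := exists_norm_logDeriv_sub_wkbRate_le (C := C) hβγ hP₁ hp hc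
  have hγI : γ ∈ Icc β γ := ⟨hβγ.le, le_rfl⟩
  refine ⟨K, c, |C| + 1, Λ, hK, hc, by positivity, hΛ, fun p hp' => ?_⟩
  have hp0 : p ≠ 0 := fun h0 => by rw [h0, modeNorm_zero] at hp'; linarith
  have hbp := hb p hp0
  refine ⟨hbp.lower γ hγI, (hbp.upper γ hγI).trans ?_, fun x y hxy hpos => ?_⟩
  · gcongr
    linarith [le_abs_self C]
  set V := minkowskiPotential Ω m (κ * p.1) p.2 with hV
  have hI0 : Icc β γ ⊆ Ioi 0 := fun r hr => hβ.trans_le hr.1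
  -- Positive flux at `β` persists up to `γ`, since `Re V ≥ 0` there. This puts the solution under
  -- the local asymptotics for solutions of growing modulus.
  have hflux : ∀ r ∈ Icc β γ, 0 < (flux x y r).re := fun r hr =>
    hpos.trans_le (hxy.re_flux_le hr.1 (fun s hs => hβ.trans_le hs.1)
      (fun s hs => H.radialCoeff_pos (hβ.trans_le hs.1))
      (fun s hs => minkowskiPotential_re_nonneg _ _ (ht' s ⟨hs.1, hs.2.trans hr.2⟩).le))
  have hx0 : ∀ r ∈ Icc β γ, x r ≠ 0 := fun r hr h0 => by
    have := hflux r hr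
    simp [flux, h0] at this
  have hmain := hw _ hp' V (V₁ p) (V₂ p) x y hbp (hxy.mono hI0) hx0 fun r hr => (hflux r hr).le
  refine ⟨hx0 γ hγI, ?_⟩
  have hV₁ : V₁ p γ = 2 * (V γ - (p.2 : ℂ) ^ 2) := by
    have hd : HasDerivAt V ((((κ * p.1 : ℝ) : ℂ) + Complex.I * p.2 * Ω) ^ 2 * (2 * γ) +
        (m : ℂ) ^ 2 * (2 * γ)) γ := by
      have h1 : HasDerivAt (fun ρ : ℝ => (ρ : ℂ) ^ 2) (2 * (γ : ℂ)) γ := by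
        refine ((Complex.ofRealCLM.hasDerivAt (x := γ)).pow 2).congr_deriv ?_
        simp
      have h2 := ((h1.const_mul ((((κ * p.1 : ℝ) : ℂ) + Complex.I * p.2 * Ω) ^ 2)).add
        (h1.const_mul ((m : ℂ) ^ 2))).add_const ((p.2 : ℂ) ^ 2)
      refine h2.congr_of_eventuallyEq (Eventually.of_forall fun ρ => ?_)
      simp only [hV, minkowskiPotential, radialPotential, Pi.add_apply]
      push_cast
      ring
    have h1 := (hbp.deriv₁ γ hγI).unique hd
    rw [show radialCoeff (fun _ => 1) (fun _ => 1) (fun ρ => ρ ^ 2) γ = γ from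
      minkowskiCoeff_eq hγ, div_eq_iff (Complex.ofReal_ne_zero.2 hγ.ne')] at h1
    rw [h1, hV, minkowskiPotential, radialPotential]
    push_cast
    ring
  have hVγ : V γ ≠ 0 := fun h0 => by
    have h1 := hbp.lower γ hγI
    have h2 : 0 < modeNorm p := by linarith
    have h3 : 0 < c * modeNorm p ^ 2 := by positivity
    rw [show radialPotential (fun _ => 1) (fun ρ => ρ ^ 2) (fun _ => Ω) m (κ * p.1) p.2 γ = V γ
      from rfl, h0, Complex.zero_re] at h1
    linarith
  rw [wkbRate, hV₁, show 2 * (V γ - (p.2 : ℂ) ^ 2) / (4 * V γ) =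
    (V γ - (p.2 : ℂ) ^ 2) / (2 * V γ) by field_simp; ring] at hmain
  exact hmain

/-- Follows from `2 (Re √V)(Im √V) = Im V` and `(V - k²) / (2 V) = 1/2 - k² / (2 V)`. It isolates
the factor `Im V`; the bracket is positive for large modes. -/
lemma wkb_im {V : ℂ} (hV : 0 < V.re) (k : ℤ) :
    (V ^ (1 / 2 : ℂ) - (V - (k : ℂ) ^ 2) / (2 * V)).im =
      V.im / 2 * (1 / (V ^ (1 / 2 : ℂ)).re - (k : ℝ) ^ 2 / Complex.normSq V) := by
  have hV0 : V ≠ 0 := fun h0 => by simp [h0] at hV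
  set S := V ^ (1 / 2 : ℂ) with hS
  have hSV : S ^ 2 = V := cpow_half_sq V
  have hSre : 0 < S.re := lt_of_lt_of_le (Real.sqrt_pos.2 hV)
    (sqrt_re_le_cpow_half_re (Real.sq_sqrt hV.le).le)
  have h1 : V.im = 2 * S.re * S.im := by rw [← hSV, sq, Complex.mul_im]; ring
  have h2 : (V - (k : ℂ) ^ 2) / (2 * V) =
      ((1 / 2 : ℝ) : ℂ) - (((k : ℝ) ^ 2 / 2 : ℝ) : ℂ) * V⁻¹ := by
    push_cast; field_simp
  rw [h2, Complex.sub_im, Complex.sub_im, Complex.im_ofReal_mul, Complex.ofReal_im, Complex.inv_im]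
  have h3 : S.im = V.im / 2 * (1 / S.re) := by rw [h1]; field_simp
  rw [h3]
  ring

lemma wkb_re {V : ℂ} (hV : 0 < V.re) (k : ℤ) :
    (V ^ (1 / 2 : ℂ)).re - 1 / 2 ≤ (V ^ (1 / 2 : ℂ) - (V - (k : ℂ) ^ 2) / (2 * V)).re := by
  have hV0 : V ≠ 0 := fun h0 => by simp [h0] at hV
  have h2 : (V - (k : ℂ) ^ 2) / (2 * V) =
      ((1 / 2 : ℝ) : ℂ) - (((k : ℝ) ^ 2 / 2 : ℝ) : ℂ) * V⁻¹ := by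
    push_cast; field_simp
  rw [h2, Complex.sub_re, Complex.sub_re, Complex.re_ofReal_mul, Complex.ofReal_re, Complex.inv_re]
  have := div_nonneg hV.le (Complex.normSq_nonneg V)
  nlinarith [sq_nonneg (k : ℝ)]

lemma flux_eq_normSq_mul {x y : ℝ → ℂ} {r : ℝ} (h : x r ≠ 0) :
    flux x y r = (Complex.normSq (x r) : ℂ) * (y r / x r) := by
  rw [flux, Complex.normSq_eq_conj_mul_self]
  field_simp

/-- Off the coordinate axes `|n|` and `|k|` are at least `1`. This makes `Im V`, which is
proportional to `n k`, at least linear in the mode size. -/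
lemma modeNorm_le_two_mul {p : ℤ × ℤ} (h₁ : p.1 ≠ 0) (h₂ : p.2 ≠ 0) :
    modeNorm p ≤ 2 * (|(p.1 : ℝ)| * |(p.2 : ℝ)|) := by
  have e1 : (1 : ℝ) ≤ |(p.1 : ℝ)| := by exact_mod_cast Int.one_le_abs h₁
  have e2 : (1 : ℝ) ≤ |(p.2 : ℝ)| := by exact_mod_cast Int.one_le_abs h₂
  refine Real.sqrt_le_iff.2 ⟨by positivity, ?_⟩
  rw [← sq_abs (p.1 : ℝ), ← sq_abs (p.2 : ℝ)]
  nlinarith [mul_le_mul e1 e1 zero_le_one (by positivity), sq_nonneg (|(p.1 : ℝ)| * |(p.2 : ℝ)|),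
    mul_nonneg (sub_nonneg.2 (one_le_pow₀ e1 : 1 ≤ |(p.1 : ℝ)| ^ 2))
      (sub_nonneg.2 (one_le_pow₀ e2 : 1 ≤ |(p.2 : ℝ)| ^ 2)),
    (one_le_pow₀ e1 : 1 ≤ |(p.1 : ℝ)| ^ 2), (one_le_pow₀ e2 : 1 ≤ |(p.2 : ℝ)| ^ 2)]

lemma momentum_sq (Ω m ω : ℝ) (k : ℤ) :
    ((ω : ℝ) + Complex.I * k * Ω) ^ 2 + (m : ℂ) ^ 2 =
      ((ω ^ 2 - (k * Ω) ^ 2 + m ^ 2 : ℝ) : ℂ) + ((2 * ω * (k * Ω) : ℝ) : ℂ) * Complex.I := by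
  push_cast
  linear_combination (k * Ω : ℂ) ^ 2 * Complex.I_sq

lemma momentum_sq_re {Ω m ω : ℝ} {k : ℤ} {q : ℂ}
    (hq : q ^ 2 = ((ω : ℝ) + Complex.I * k * Ω) ^ 2 + (m : ℂ) ^ 2) :
    q.re ^ 2 - q.im ^ 2 = ω ^ 2 - (k * Ω) ^ 2 + m ^ 2 := by
  have := congrArg Complex.re hq
  rw [momentum_sq, sq, Complex.mul_re, Complex.add_re, Complex.ofReal_re, Complex.re_ofReal_mul,
    Complex.I_re, mul_zero, add_zero] at this
  linarith

lemma momentum_sq_im {Ω m ω : ℝ} {k : ℤ} {q : ℂ}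
    (hq : q ^ 2 = ((ω : ℝ) + Complex.I * k * Ω) ^ 2 + (m : ℂ) ^ 2) :
    (q ^ 2).im = 2 * ω * (k * Ω) := by
  rw [hq, momentum_sq, Complex.add_im, Complex.ofReal_im, Complex.im_ofReal_mul, Complex.I_im]
  ring

/-- The current of a decaying solution has the sign opposite to that of the potential. -/
lemma IsRadialSol.mul_im_flux_nonpos {q : ℂ} {k : ℤ} {x y : ℝ → ℂ} (h : IsBesselSol q k x y)
    (hlim : Tendsto (flux x y) atTop (𝓝 0)) {s : ℝ} (hs : 0 ≤ s * (q ^ 2).im) {r : ℝ}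
    (hr : 0 < r) : s * (flux x y r).im ≤ 0 := by
  have hlim' : Tendsto (fun r => s * (flux x y r).im) atTop (𝓝 0) := by
    have := ((Complex.continuous_im.tendsto 0).comp hlim).const_mul s
    simpa using this
  refine ge_of_tendsto hlim' ?_
  filter_upwards [eventually_ge_atTop r] with t ht
  refine le_of_hasDerivAt_nonneg (f := fun r => s * (flux x y r).im) ht (fun z hz =>
    (h.hasDerivAt_flux (hr.trans_le hz.1)).complex_im.const_mul s) fun z hz => ?_
  have hz0 : 0 < z := hr.trans_le hz.1
  rw [Complex.div_ofReal_im, Complex.add_im, Complex.ofReal_im, Complex.im_mul_ofReal,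
    besselPotential_im, zero_add]
  have := mul_nonneg hs (mul_nonneg (sq_nonneg z) (Complex.normSq_nonneg (x z)))
  calc 0 ≤ s * (q ^ 2).im * (z ^ 2 * Complex.normSq (x z)) / z := div_nonneg this hz0.le
    _ = _ := by ring

end Decay

section Decay

variable {Ω m κ β γ : ℝ}

/-- If the momentum is real, the radiating solution decays. -/
lemma IsMinkowskiPair.re_flux_nonpos_of_real {q : ℂ} {ω : ℝ} {k : ℤ} {u v x y : ℝ → ℂ} {W : ℂ}
    (h : IsMinkowskiPair q Ω m ω k u v x y W) (hm : 0 < m) (hre : 0 ≤ q.re)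
    (hq : q ^ 2 = ((ω : ℝ) + Complex.I * k * Ω) ^ 2 + (m : ℂ) ^ 2) (hk : (k : ℝ) * Ω = 0)
    (hβ : 0 < β) : (flux x y β).re ≤ 0 := by
  have h1 := momentum_sq_re hq
  have h2 := momentum_sq_im hq
  rw [sq, Complex.mul_im, hk] at h2
  rw [hk] at h1
  have hre' : 0 < q.re := by
    rcases hre.eq_or_lt with h0 | h0
    · rw [← h0] at h1
      nlinarith [sq_nonneg q.im, sq_nonneg ω, pow_pos hm 2]
    · exact h0
  have him : q.im = 0 := by
    have : q.re * q.im = 0 := by linarith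
    exact (mul_eq_zero.1 this).resolve_left hre'.ne'
  have h3 := h.flux_nonpos hre' β hβ
  rw [conj_mul_re, him, zero_mul, add_zero] at h3
  exact nonpos_of_mul_nonpos_right h3 hre'

/-- For static modes with imaginary momentum, the growth of the radiating solution is controlled by
its current. -/
lemma IsMinkowskiPair.re_flux_le_of_static {q : ℂ} {k : ℤ} {u v x y : ℝ → ℂ} {W : ℂ}
    (h : IsMinkowskiPair q Ω m 0 k u v x y W)
    (hq : q ^ 2 = ((0 : ℝ) + Complex.I * k * Ω) ^ 2 + (m : ℂ) ^ 2) (hγ : 0 < γ)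
    (ht : γ ^ 2 * Ω ^ 2 < 1) (hmk : m ^ 2 < ((k : ℝ) * Ω) ^ 2) :
    (flux x y γ).re ≤ 4 * |(k : ℝ)| * |(flux x y γ).im| := by
  have hbes := (isBesselSol_iff hq).1 h.snd
  have hq2 : (q ^ 2).im = 0 := by rw [momentum_sq_im hq]; ring
  have hre2 := momentum_sq_re hq
  have hk : k ≠ 0 := fun h0 => by
    rw [h0, Int.cast_zero, zero_mul] at hmk
    nlinarith [sq_nonneg m]
  have hqre : q.re = 0 := by
    rw [sq, Complex.mul_im] at hq2
    have : q.re * q.im = 0 := by linarith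
    rcases mul_eq_zero.1 this with h0 | h0
    · exact h0
    · rw [h0] at hre2
      nlinarith [sq_nonneg q.re]
  rw [hqre] at hre2
  have hqim : q.im ≠ 0 := fun h0 => by rw [h0] at hre2; linarith
  have hqa : 0 < |q.im| := abs_pos.2 hqim
  have hk0 : 0 < |(k : ℝ)| := abs_pos.2 (Int.cast_ne_zero.2 hk)
  set ρ := |(k : ℝ)| / |q.im| with hρ
  have hρ0 : 0 < ρ := by positivity
  have hρq : ρ * |q.im| = |(k : ℝ)| := div_mul_cancel₀ _ hqa.ne'
  have htp : q.im ^ 2 * ρ ^ 2 = (k : ℝ) ^ 2 := by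
    rw [← sq_abs q.im, ← sq_abs (k : ℝ), ← hρq]; ring
  -- The turning point lies beyond `γ`: `|q.im| ≤ |k Ω|` and `γ |Ω| < 1`. Up to it `Re V ≥ 0`, so
  -- the flux at `γ` is at most that at the turning point.
  have hγρ : γ ≤ ρ := by
    rw [hρ, le_div_iff₀ hqa]
    refine (sq_le_sq₀ (by positivity) hk0.le).1 ?_
    rw [mul_pow, sq_abs, sq_abs]
    have e1 : q.im ^ 2 ≤ ((k : ℝ) * Ω) ^ 2 := by linarith [sq_nonneg m]
    calc γ ^ 2 * q.im ^ 2 ≤ γ ^ 2 * ((k : ℝ) * Ω) ^ 2 := by gcongr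
      _ = (γ ^ 2 * Ω ^ 2) * (k : ℝ) ^ 2 := by ring
      _ ≤ 1 * (k : ℝ) ^ 2 := by gcongr
      _ = _ := one_mul _
  have hmono : (flux x y γ).re ≤ (flux x y ρ).re :=
    hbes.re_flux_le hγρ (fun s hs => hγ.trans_le hs.1) (fun s hs => hγ.trans_le hs.1)
      fun s hs => by
        rw [besselPotential_re, sq q, Complex.mul_re, hqre]
        have : s ^ 2 ≤ ρ ^ 2 := pow_le_pow_left₀ (hγ.le.trans hs.1) hs.2 2
        linarith [mul_le_mul_of_nonneg_left this (sq_nonneg q.im)]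
  have hturn := hbes.re_flux_le_of_radiating hqre hqim hk h.radiating hρ0 htp
  rw [hbes.im_flux_eq hq2 hρ0 (mem_Ioi.2 hγ)] at hturn
  refine hmono.trans (hturn.trans (le_of_eq ?_))
  rw [← hρq]; ring

/-- `1 / Re √V` is at least of order `1 / l` while `k² / |V|²` is only of order `l⁻²`. With `Im V`
at least linear in `l`, the imaginary part of the rate stays away from zero. -/
lemma wkb_im_lower {V : ℂ} {k : ℤ} {c C l d s : ℝ} (hc : 0 < c) (hC : 0 < C) (hl : 0 < l)
    (hd : 0 ≤ d) (hlow : c * l ^ 2 ≤ V.re) (hup : ‖V‖ ≤ C * l ^ 2) (hk : (k : ℝ) ^ 2 ≤ l ^ 2)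
    (hlC : 2 * Real.sqrt C / c ^ 2 ≤ l) (hs : d * l ≤ s * V.im) :
    d / (4 * Real.sqrt C) ≤ s * (V ^ (1 / 2 : ℂ) - (V - (k : ℂ) ^ 2) / (2 * V)).im := by
  have hsC : 0 < Real.sqrt C := Real.sqrt_pos.2 hC
  have hVre : 0 < V.re := lt_of_lt_of_le (by positivity) hlow
  have hSpos : 0 < (V ^ (1 / 2 : ℂ)).re := lt_of_lt_of_le (Real.sqrt_pos.2 hVre)
    (sqrt_re_le_cpow_half_re (Real.sq_sqrt hVre.le).le)
  have hSle : (V ^ (1 / 2 : ℂ)).re ≤ Real.sqrt C * l := by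
    refine (Complex.re_le_norm _).trans ?_
    rw [norm_cpow_half]
    refine Real.sqrt_le_iff.2 ⟨by positivity, ?_⟩
    rw [mul_pow, Real.sq_sqrt hC.le]
    exact hup
  have hVn : c ^ 2 * l ^ 4 ≤ Complex.normSq V := by
    rw [Complex.normSq_apply]
    have := mul_self_le_mul_self (by positivity) hlow
    linarith [mul_self_nonneg V.im, (by ring : c * l ^ 2 * (c * l ^ 2) = c ^ 2 * l ^ 4)]
  have hratio : (k : ℝ) ^ 2 / Complex.normSq V ≤ 1 / (2 * (Real.sqrt C * l)) := by
    calc (k : ℝ) ^ 2 / Complex.normSq V ≤ l ^ 2 / (c ^ 2 * l ^ 4) := by gcongr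
      _ = 1 / (c ^ 2 * l * l) := by field_simp
      _ ≤ 1 / (2 * (Real.sqrt C * l)) := by
        rw [div_le_iff₀ (by positivity)] at hlC
        refine one_div_le_one_div_of_le (by positivity) ?_
        linarith [mul_le_mul_of_nonneg_right hlC hl.le]
  have hSinv : 1 / (Real.sqrt C * l) ≤ 1 / (V ^ (1 / 2 : ℂ)).re :=
    one_div_le_one_div_of_le hSpos hSle
  have hdiff : 1 / (2 * (Real.sqrt C * l)) ≤
      1 / (V ^ (1 / 2 : ℂ)).re - (k : ℝ) ^ 2 / Complex.normSq V := by
    have : 1 / (Real.sqrt C * l) = 2 * (1 / (2 * (Real.sqrt C * l))) := by field_simp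
    linarith
  rw [wkb_im hVre]
  calc d / (4 * Real.sqrt C) = d * l / 2 * (1 / (2 * (Real.sqrt C * l))) := by
        field_simp; ring
    _ ≤ s * V.im / 2 * (1 / (V ^ (1 / 2 : ℂ)).re - (k : ℝ) ^ 2 / Complex.normSq V) := by
        gcongr
        exact div_nonneg ((mul_nonneg hd hl.le).trans hs) two_pos.le
    _ = _ := by ring

/-- The modes that are neither static nor real carry a current of definite sign. -/
lemma IsMinkowskiPair.exists_mul_im_flux_nonpos {p : ℤ × ℤ} {q : ℂ} {u v x y : ℝ → ℂ} {W : ℂ}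
    (h : IsMinkowskiPair q Ω m (κ * p.1) p.2 u v x y W) (hκ : 0 < κ) (hre : 0 ≤ q.re)
    (hq : q ^ 2 = ((κ * p.1 : ℝ) + Complex.I * p.2 * Ω) ^ 2 + (m : ℂ) ^ 2) (hγ : 0 < γ)
    (hn : p.1 ≠ 0) (hkΩ : (p.2 : ℝ) * Ω ≠ 0) :
    ∃ s : ℝ, |s| = 1 ∧ s * (flux x y γ).im ≤ 0 ∧
      κ * γ ^ 2 * |Ω| * modeNorm p ≤ s * (minkowskiPotential Ω m (κ * p.1) p.2 γ).im := by
  have him := momentum_sq_im hq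
  have hq2 : (q ^ 2).im ≠ 0 := by
    rw [him]
    exact mul_ne_zero (mul_ne_zero two_ne_zero (mul_ne_zero hκ.ne' (Int.cast_ne_zero.2 hn))) hkΩ
  have hk : p.2 ≠ 0 := fun h0 => hkΩ (by rw [h0]; simp)
  have hqre : 0 < q.re := by
    refine lt_of_le_of_ne hre fun h0 => hq2 ?_
    rw [sq, Complex.mul_im, ← h0]; ring
  obtain ⟨s, hs1, hs2⟩ : ∃ s : ℝ, |s| = 1 ∧ s * (q ^ 2).im = |(q ^ 2).im| := by
    rcases abs_choice (q ^ 2).im with h0 | h0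
    · exact ⟨1, by simp, by rw [h0, one_mul]⟩
    · exact ⟨-1, by simp, by rw [h0, neg_one_mul]⟩
  refine ⟨s, hs1, ((isBesselSol_iff hq).1 h.snd).mul_im_flux_nonpos (h.tendsto_flux hqre)
    (by rw [hs2]; exact abs_nonneg _) hγ, ?_⟩
  rw [minkowskiPotential_eq hq, besselPotential_im, ← mul_assoc, hs2, him, abs_mul, abs_mul,
    abs_mul, abs_mul, abs_two, abs_of_pos hκ]
  calc κ * γ ^ 2 * |Ω| * modeNorm p
      ≤ κ * γ ^ 2 * |Ω| * (2 * (|(p.1 : ℝ)| * |(p.2 : ℝ)|)) := by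
        gcongr
        exact modeNorm_le_two_mul hn hk
    _ = _ := by ring

/-- Up to finitely many modes, the radiating solution decays in the region where `∂_t` is
timelike. -/
theorem exists_minkowski_flux_nonpos (hβ : 0 < β) (ht : β ^ 2 * Ω ^ 2 < 1) (hκ : 0 < κ)
    (hm : 0 < m) : ∃ Λ : ℝ, ∀ p : ℤ × ℤ, Λ ≤ modeNorm p → ∀ (q : ℂ) (u v x y : ℝ → ℂ) (W : ℂ),
      0 ≤ q.re → q ^ 2 = ((κ * p.1 : ℝ) + Complex.I * p.2 * Ω) ^ 2 + (m : ℂ) ^ 2 →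
      IsMinkowskiPair q Ω m (κ * p.1) p.2 u v x y W → (flux x y β).re ≤ 0 := by
  -- Room beyond `β`, still inside the light cylinder, over which a growing solution settles to its
  -- asymptotic rate.
  obtain ⟨γ, hβγ, htγ⟩ : ∃ γ, β < γ ∧ γ ^ 2 * Ω ^ 2 < 1 := by
    have hc : Continuous fun r : ℝ => r ^ 2 * Ω ^ 2 := by fun_prop
    obtain ⟨γ, h1, h2⟩ := (((hc.tendsto β).mono_left nhdsWithin_le_nhds).eventually
      (gt_mem_nhds ht) |>.and (self_mem_nhdsWithin (s := Ioi β))).exists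
    exact ⟨γ, h2, h1⟩
  have hγ : 0 < γ := hβ.trans hβγ
  obtain ⟨K, c, C, Λ, hK, hc, hC, hΛ, hw⟩ := exists_minkowski_logDeriv hβ hβγ htγ hκ m
  have hsC : 0 < Real.sqrt C := Real.sqrt_pos.2 hC
  have hsc : 0 < Real.sqrt c := Real.sqrt_pos.2 hc
  -- The thresholds serve, in order: the local asymptotics, imaginary momentum of the static modes,
  -- the contradiction for static modes, the lower bound on the imaginary part of the rate, and the
  -- contradiction for the other modes. If `Ω = 0` the quotients by zero are harmless, as that case
  -- is settled first.
  refine ⟨max (max Λ ((m + 1) / |Ω|)) (max ((5 * K + 1) / Real.sqrt c)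
    (max (2 * Real.sqrt C / c ^ 2) ((4 * Real.sqrt C * K + 1) / (κ * γ ^ 2 * |Ω|)))),
    fun p hp q u v x y W hre hq h => ?_⟩
  simp only [max_le_iff] at hp
  obtain ⟨⟨hp₁, hp₂⟩, hp₃, hp₄, hp₅⟩ := hp
  by_cases hkΩ : (p.2 : ℝ) * Ω = 0
  · exact h.re_flux_nonpos_of_real hm hre hq hkΩ hβ
  have hΩ' : 0 < |Ω| := abs_pos.2 (right_ne_zero_of_mul hkΩ)
  by_contra! hpos
  obtain ⟨hlow, hup, hsol⟩ := hw p hp₁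
  obtain ⟨hx0, hr⟩ := hsol x y h.snd hpos
  have hl1 : 1 ≤ modeNorm p := hΛ.trans hp₁
  have hl0 : 0 < modeNorm p := by linarith
  have hVre : 0 < (minkowskiPotential Ω m (κ * p.1) p.2 γ).re :=
    lt_of_lt_of_le (by positivity) hlow
  have hflux := flux_eq_normSq_mul (y := y) hx0
  have hxpos : 0 < Complex.normSq (x γ) := Complex.normSq_pos.2 hx0
  have hzre := (Complex.abs_re_le_norm _).trans hr
  have hzim := (Complex.abs_im_le_norm _).trans hr
  rw [Complex.sub_re] at hzre
  rw [Complex.sub_im] at hzim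
  -- For static modes the rate is real, so the imaginary part of `y / x` is at most `K / λ`. The
  -- turning-point estimate then bounds its real part by `4 K`, whereas the rate has real part at
  -- least `√c λ - 1/2`.
  by_cases hn : p.1 = 0
  · have hlk : modeNorm p = |(p.2 : ℝ)| := by
      rw [modeNorm, hn, Int.cast_zero, zero_pow two_ne_zero, zero_add, Real.sqrt_sq_eq_abs]
    have hmk : m ^ 2 < ((p.2 : ℝ) * Ω) ^ 2 := by
      rw [div_le_iff₀ hΩ', hlk, ← abs_mul] at hp₂
      rw [← sq_abs (_ * _)]
      exact pow_lt_pow_left₀ (by linarith) hm.le two_ne_zero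
    have hVim : (minkowskiPotential Ω m (κ * p.1) p.2 γ).im = 0 := by
      rw [radialPotential_im, hn]; simp
    rw [wkb_im hVre, hVim, zero_div, zero_mul, sub_zero] at hzim
    have h5 := wkb_re hVre p.2
    have hSre := sqrt_re_le_cpow_half_re (c := Real.sqrt c * modeNorm p)
      (z := minkowskiPotential Ω m (κ * p.1) p.2 γ) (by
        rw [mul_pow, Real.sq_sqrt hc.le]; exact hlow)
    rw [hn, Int.cast_zero, mul_zero] at h hq
    have h1 := h.re_flux_le_of_static hq hγ htγ hmk
    rw [hflux, Complex.re_ofReal_mul, Complex.im_ofReal_mul, abs_mul, abs_of_pos hxpos,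
      ← hlk] at h1
    have h2 : (y γ / x γ).re ≤ 4 * modeNorm p * |(y γ / x γ).im| := by
      refine le_of_mul_le_mul_left ?_ hxpos
      linarith
    have h3 : 4 * modeNorm p * |(y γ / x γ).im| ≤ 4 * K := by
      calc 4 * modeNorm p * |(y γ / x γ).im| ≤ 4 * modeNorm p * (K / modeNorm p) := by gcongr
        _ = 4 * K := by field_simp
    have h4 : K / modeNorm p ≤ K := div_le_self hK hl1
    have h6 := neg_le_of_abs_le hzre
    rw [div_le_iff₀ hsc] at hp₃
    linarith
  -- Otherwise the current has sign opposite to `Im V`, while the imaginary part of the rate has the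
  -- sign of `Im V` and is bounded away from zero; an error `K / λ` cannot reconcile them.
  · obtain ⟨s, hs1, hcur, hs2⟩ := h.exists_mul_im_flux_nonpos hκ hre hq hγ hn hkΩ
    have hzs : s * (y γ / x γ).im ≤ 0 := by
      rw [hflux, Complex.im_ofReal_mul] at hcur
      by_contra! h0
      linarith [mul_pos hxpos h0]
    have hd0 : 0 < κ * γ ^ 2 * |Ω| := by positivity
    have hk2 : (p.2 : ℝ) ^ 2 ≤ modeNorm p ^ 2 := by
      rw [modeNorm_sq]; linarith [sq_nonneg (p.1 : ℝ)]
    have hwlow := wkb_im_lower hc hC hl0 hd0.le hlow hup hk2 hp₄ hs2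
    rw [← one_mul (|_ - _|), ← hs1, ← abs_mul, mul_sub] at hzim
    have h2 : κ * γ ^ 2 * |Ω| / (4 * Real.sqrt C) ≤ K / modeNorm p := by
      linarith [neg_le_of_abs_le hzim]
    rw [div_le_div_iff₀ (by positivity) hl0] at h2
    rw [div_le_iff₀ hd0] at hp₅
    linarith

end Decay

/-! ### Coincidence expansions -/

lemma IsSection.summable_norm_inv_chi_pow_three {N grr h w : ℝ → ℝ} {a s κ : ℝ}
    (H : IsSection N grr h w a) (hs : a < s) (ht : h s * w s ^ 2 < N s ^ 2) (hκ : 0 < κ) :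
    Summable fun p : ℤ × ℤ => ‖(chi (N s) (h s) (w s) (κ * p.1) p.2 ^ 3)⁻¹‖ := by
  obtain ⟨c, C, hc, -, hb⟩ := H.exists_chi_bounds hs ht hκ
  refine Summable.of_nonneg_of_le (fun _ => norm_nonneg _) (fun p => ?_)
    (summable_inv_modeNorm_pow_three.mul_left (c ^ 3)⁻¹)
  by_cases hp : p = 0
  -- At the origin `χ = 0`, and with inverse `0` the term contributes nothing.
  · have : chi (N s) (h s) (w s) (κ * p.1) p.2 = 0 := by
      rw [hp]
      simp [chi]
    rw [this]
    have := modeNorm_nonneg p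
    simp only [ne_eq, OfNat.ofNat_ne_zero, not_false_eq_true, zero_pow, inv_zero, norm_zero]
    positivity
  · have h1 := (hb p hp).1.trans (Complex.re_le_norm _)
    have h2 : 0 < modeNorm p := lt_of_lt_of_le one_pos (one_le_modeNorm hp)
    rw [norm_inv, norm_pow, ← mul_inv, ← mul_pow]
    gcongr

/-- The coincidence expansion of the radial Green's functions of the black hole. -/
theorem StationaryBlackHole.IsMirror.exists_norm_diag_sub_le {B : StationaryBlackHole} {rM : ℝ}
    (hM : B.IsMirror rM) (m : ℝ) {r : ℝ} (hr : r ∈ Ioo B.rPlus rM) :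
    ∃ K Λ : ℝ, ∀ p : ℤ × ℤ, Λ ≤ modeNorm p → ∀ G, B.IsRadialGreen rM m p.1 p.2 G →
      ‖G r r - 1 / (2 * B.chi r p)‖ ≤ K * ‖(B.chi r p ^ 3)⁻¹‖ := by
  obtain ⟨α, hα, hαr⟩ := exists_between hr.1
  obtain ⟨β, hrβ, hβ⟩ := exists_between hr.2
  obtain ⟨K, Λ, hK⟩ := B.isSection.exists_norm_greenKernel_sub_le hα hαr hrβ
    (fun s hs => hM.2 s ⟨hα.trans_le hs.1, hs.2.trans hβ.le⟩) B.κ_pos m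
  refine ⟨K, Λ, fun p hp G hG => ?_⟩
  obtain ⟨u, v, x, y, W, hpair, hx, hu, hxf⟩ := hM.exists_pair m p.1 p.2
  rw [hM.isRadialGreen_unique (hM.isRadialGreen_greenKernel hpair hx hu) hG r hr r hr]
  exact hK p hp u v x y W hpair
    (fun s hs => hu s ⟨hα.trans_le hs.1, hs.2.trans hr.2.le⟩)
    (fun s hs => hxf s ⟨hr.1.trans_le hs.1, hs.2.trans_lt hβ⟩)

/-- The coincidence expansion of the radial Green's functions of rotating Minkowski spacetime. -/
theorem exists_norm_minkowski_diag_sub_le {T Ω m ρ : ℝ} {Q : ℤ → ℤ → ℂ} (hT : 0 < T) (hm : 0 < m)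
    (hQ : IsMomentum T Ω m Q) (hρ : 0 < ρ) (ht : ρ ^ 2 * Ω ^ 2 < 1) :
    ∃ K Λ : ℝ, ∀ p : ℤ × ℤ, Λ ≤ modeNorm p → ∀ G, IsMinkowskiRadialGreen T Ω m Q p.1 p.2 G →
      ‖G ρ ρ - 1 / (2 * minkowskiChi T Ω ρ p)‖ ≤ K * ‖(minkowskiChi T Ω ρ p ^ 3)⁻¹‖ := by
  have H := isSection_minkowski Ω
  have hκ : 0 < 2 * Real.pi * T := by positivity
  -- The local expansion at `ρ` needs a margin on both sides, with the sign of the flux known up to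
  -- a larger radius `β`.
  obtain ⟨β, hρβ, htβ⟩ : ∃ β, ρ < β ∧ β ^ 2 * Ω ^ 2 < 1 := by
    have hc : Continuous fun r : ℝ => r ^ 2 * Ω ^ 2 := by fun_prop
    obtain ⟨β, h1, h2⟩ := (((hc.tendsto ρ).mono_left nhdsWithin_le_nhds).eventually
      (gt_mem_nhds ht) |>.and (self_mem_nhdsWithin (s := Ioi ρ))).exists
    exact ⟨β, h2, h1⟩
  have hβ0 : 0 < β := hρ.trans hρβ
  obtain ⟨δ, hρδ, hδβ⟩ := exists_between hρβ
  obtain ⟨α, hα, hαρ⟩ := exists_between hρ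
  have htt : ∀ r ∈ Ioc 0 β, r ^ 2 * Ω ^ 2 < 1 := fun r hr => by
    have : r ^ 2 ≤ β ^ 2 := pow_le_pow_left₀ hr.1.le hr.2 2
    exact (mul_le_mul_of_nonneg_right this (sq_nonneg Ω)).trans_lt htβ
  obtain ⟨K, Λ₁, hK⟩ := H.exists_norm_greenKernel_sub_le hα hαρ hρδ
    (fun r hr => by simpa using htt r ⟨hα.trans_le hr.1, hr.2.trans hδβ.le⟩) hκ m
  obtain ⟨Λ₂, hΛ₂⟩ := exists_minkowski_flux_nonpos hβ0 htβ hκ hm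
  refine ⟨K, max Λ₁ Λ₂, fun p hp G hG => ?_⟩
  have hq := hQ p.1 p.2
  obtain ⟨u, v, x, y, W, hpair⟩ := exists_isMinkowskiPair hm hq.2 hq.1
  rw [hpair.isMinkowskiRadialGreen.unique hm hQ hG ρ hρ ρ hρ]
  have hbu := (isBesselSol_iff hq.1).1 hpair.fst
  have hbx := (isBesselSol_iff hq.1).1 hpair.snd
  have hV : ∀ r ∈ Ioc 0 β, 0 ≤ (besselPotential (Q p.1 p.2) p.2 r).re := fun r hr => by
    rw [← minkowskiPotential_eq hq.1]
    exact minkowskiPotential_re_nonneg _ _ (htt r hr).le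
  obtain ⟨C, hC⟩ := hpair.regular
  have hju := hbu.re_flux_nonneg_of_bounded (fun _ h => h) divergesAt_id hV hC
  have hun := hbu.fst_ne_zero (fun _ h => h) hpair.isNontrivial_fst hju
  -- Non-positivity at `β` propagates inwards, the real flux being non-decreasing on the whole of
  -- `(0, β]`.
  have hjx : ∀ r ∈ Ioc 0 β, (flux x y r).re ≤ 0 := fun r hr =>
    (hbx.re_flux_le hr.2 (fun s hs => hr.1.trans_le hs.1) (fun s hs => hr.1.trans_le hs.1)
      fun s hs => hV s ⟨hr.1.trans_le hs.1, hs.2⟩).trans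
      (hΛ₂ p ((le_max_right _ _).trans hp) _ u v x y W hq.2 hq.1 hpair)
  have hxn := hbx.fst_ne_zero' (fun _ h => h) hpair.isNontrivial_snd hjx
  exact hK p ((le_max_left _ _).trans hp) u v x y W hpair.toIsGreenPair
    (fun r hr => have h := ⟨hα.trans_le hr.1, hr.2.trans hρβ.le⟩; ⟨hun r h, hju r h⟩)
    (fun r hr => have h : r ∈ Ioo 0 β := ⟨hρ.trans_le hr.1, hr.2.trans_lt hδβ⟩
      ⟨hxn r h, hjx r ⟨h.1, h.2.le⟩⟩)

/-! ### Comparison of the two mode sums -/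

lemma cpow_half_sq_mul {t : ℝ} (ht : 0 < t) (z : ℂ) :
    ((t : ℂ) ^ 2 * z) ^ (1 / 2 : ℂ) = t * z ^ (1 / 2 : ℂ) := by
  by_cases hz : z = 0
  · simp [hz]
  · have ht' : (t : ℂ) ≠ 0 := Complex.ofReal_ne_zero.2 ht.ne'
    rw [Complex.cpow_def_of_ne_zero (mul_ne_zero (pow_ne_zero 2 ht') hz),
      Complex.cpow_def_of_ne_zero hz, ← Complex.ofReal_pow, Complex.log_ofReal_mul (by positivity) hz,
      Real.log_pow, add_mul, Complex.exp_add]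
    congr 1
    rw [show ((2 : ℕ) * Real.log t : ℝ) * (1 / 2 : ℂ) = ((Real.log t : ℝ) : ℂ) by push_cast; ring,
      ← Complex.ofReal_exp, Real.exp_log ht]

/-- Scaling by the lapse: the squared Minkowski radius `h / N²` makes the two radicands proportional
with positive factor `N²`, which passes through the principal root. -/
lemma chi_eq_mul_chi {N h : ℝ} (hN : 0 < N) (w ω : ℝ) (k : ℤ) :
    chi N h w ω k = N * chi 1 (h / N ^ 2) w ω k := by
  have hN' : (N : ℂ) ≠ 0 := Complex.ofReal_ne_zero.2 hN.ne'
  rw [chi, chi, ← cpow_half_sq_mul hN]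
  congr 1
  push_cast
  field_simp

lemma isBigO_sub_of_norm_le {ι : Type*} {l : Filter ι} {f g e : ι → ℂ} {K : ℝ} (c : ℂ)
    (h : ∀ᶠ i in l, ‖f i - g i‖ ≤ K * ‖e i‖) :
    (fun i => c * f i - c * g i) =O[l] e := by
  refine IsBigO.of_bound (‖c‖ * K) (h.mono fun i hi => ?_)
  rw [← mul_sub, norm_mul, mul_assoc]
  gcongr

lemma modeKernel_angular (ω : ℝ) (k : ℤ) (G : ℝ → ℝ → ℂ) (r θ : ℝ) :
    modeKernel ω k G ![0, r, 0] ![0, r, θ] = Complex.exp (((-(k * θ) : ℝ) : ℂ) * Complex.I) * G r r := by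
  simp only [modeKernel, Matrix.cons_val_zero, Matrix.cons_val_one, Matrix.cons_val]
  rw [sub_self, mul_zero, Complex.exp_zero, one_mul]
  congr 2
  push_cast
  ring

lemma modeKernel_coincident (ω : ℝ) (k : ℤ) (G : ℝ → ℝ → ℂ) (r : ℝ) :
    modeKernel ω k G ![0, r, 0] ![0, r, 0] = G r r := by
  rw [modeKernel_angular]
  simp

theorem theorem4p1
    (B : StationaryBlackHole) (rM : ℝ) (hM : B.IsMirror rM)
    (m : ℝ) (hm : 0 ≤ m) (mM : ℝ) (hmM : 0 < mM)
    (r : ℝ) (hr : r ∈ Set.Ioo B.rPlus rM)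
    (γ TM ΩM ρ : ℝ)
    (hγ : γ = B.lapse r) (hT : TM = B.κ / (2 * Real.pi)) (hΩ : ΩM = B.shift r + B.ΩH)
    (hρ : ρ = γ⁻¹ * Real.sqrt (B.gθθ r))
    (q : ℤ → ℤ → ℂ) (hq : IsMomentum TM ΩM mM q) :
    -- the radial Green's functions exist and are unique
    (∀ n k : ℤ, ∃ G, B.IsRadialGreen rM m n k G ∧ ∀ G', B.IsRadialGreen rM m n k G' →
      ∀ s ∈ Set.Ioo B.rPlus rM, ∀ s' ∈ Set.Ioo B.rPlus rM, G' s s' = G s s') ∧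
    (∀ n k : ℤ, ∃ G, IsMinkowskiRadialGreen TM ΩM mM q n k G ∧
      ∀ G', IsMinkowskiRadialGreen TM ΩM mM q n k G' →
      ∀ s ∈ Set.Ioi (0 : ℝ), ∀ s' ∈ Set.Ioi (0 : ℝ), G' s s' = G s s') ∧
    ∀ GBH GM : ℤ → ℤ → ℝ → ℝ → ℂ,
      (∀ n k, B.IsRadialGreen rM m n k (GBH n k)) →
      (∀ n k, IsMinkowskiRadialGreen TM ΩM mM q n k (GM n k)) →
      -- asymptotic expansions of the summands at coincidence, for large quantum numbers
      ((fun p : ℤ × ℤ => B.summand GBH p.1 p.2 ![0, r, 0] ![0, r, 0] -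
          ((B.κ / (4 * Real.pi ^ 2) : ℝ) : ℂ) * (1 / (2 * B.chi r p)))
        =O[Filter.cofinite] fun p => (B.chi r p ^ 3)⁻¹) ∧
      ((fun p : ℤ × ℤ => minkowskiSummand TM GM p.1 p.2 ![0, ρ, 0] ![0, ρ, 0] -
          ((TM / (2 * Real.pi) : ℝ) : ℂ) * (1 / (2 * minkowskiChi TM ΩM ρ p)))
        =O[Filter.cofinite] fun p => (minkowskiChi TM ΩM ρ p ^ 3)⁻¹) ∧
      -- the leading terms cancel, and the order of the remainders is summable
      (∀ p : ℤ × ℤ, ((B.κ / (4 * Real.pi ^ 2) : ℝ) : ℂ) * (1 / (2 * B.chi r p)) =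
        (γ : ℂ)⁻¹ *
          (((TM / (2 * Real.pi) : ℝ) : ℂ) * (1 / (2 * minkowskiChi TM ΩM ρ p)))) ∧
      Summable (fun p : ℤ × ℤ => ‖(B.chi r p ^ 3)⁻¹‖) ∧
      -- the double sum converges for every angular separation, also at coincidence, and its
      -- coincidence limit is the finite sum of the coincident summands
      (∀ θ : ℝ, Summable fun p : ℤ × ℤ => B.summand GBH p.1 p.2 ![0, r, 0] ![0, r, θ] -
          (γ : ℂ)⁻¹ * minkowskiSummand TM GM p.1 p.2 ![0, ρ, 0] ![0, ρ, θ]) ∧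
      Filter.Tendsto
        (fun θ : ℝ => ∑' p : ℤ × ℤ, (B.summand GBH p.1 p.2 ![0, r, 0] ![0, r, θ] -
          (γ : ℂ)⁻¹ * minkowskiSummand TM GM p.1 p.2 ![0, ρ, 0] ![0, ρ, θ]))
        (nhdsWithin 0 (Set.Ioi 0))
        (nhds (∑' p : ℤ × ℤ, (B.summand GBH p.1 p.2 ![0, r, 0] ![0, r, 0] -
          (γ : ℂ)⁻¹ * minkowskiSummand TM GM p.1 p.2 ![0, ρ, 0] ![0, ρ, 0]))) := by
  subst hγ hT hΩ hρ
  have hN := B.lapse_pos r hr.1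
  have hh := B.gθθ_pos r hr.1
  have htime := hM.2 r ⟨hr.1, hr.2.le⟩
  have hT0 : 0 < B.κ / (2 * Real.pi) := div_pos B.κ_pos (by positivity)
  have hκT : 2 * Real.pi * (B.κ / (2 * Real.pi)) = B.κ := by field_simp
  have hρ0 : 0 < (B.lapse r)⁻¹ * Real.sqrt (B.gθθ r) :=
    mul_pos (inv_pos.2 hN) (Real.sqrt_pos.2 hh)
  have hρsq : ((B.lapse r)⁻¹ * Real.sqrt (B.gθθ r)) ^ 2 = B.gθθ r / B.lapse r ^ 2 := by
    rw [mul_pow, Real.sq_sqrt hh.le]; field_simp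
  have htρ : ((B.lapse r)⁻¹ * Real.sqrt (B.gθθ r)) ^ 2 * (B.shift r + B.ΩH) ^ 2 < 1 := by
    rw [hρsq, div_mul_eq_mul_div, div_lt_one (by positivity)]
    exact htime
  set T := B.κ / (2 * Real.pi) with hTdef
  set ρ := (B.lapse r)⁻¹ * Real.sqrt (B.gθθ r) with hρdef
  refine ⟨fun n k => ?_, fun n k => ?_, fun GBH GM hBH hGM => ?_⟩
  · obtain ⟨u, v, x, y, W, hpair, hx, hu, -⟩ := hM.exists_pair m n k
    have hG := hM.isRadialGreen_greenKernel hpair hx hu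
    exact ⟨_, hG, fun G' hG' => hM.isRadialGreen_unique hG hG'⟩
  · obtain ⟨u, v, x, y, W, hpair⟩ := exists_isMinkowskiPair hmM (hq n k).2 (hq n k).1
    exact ⟨_, hpair.isMinkowskiRadialGreen, fun G' hG' =>
      hpair.isMinkowskiRadialGreen.unique hmM hq hG'⟩
  have hN' : (B.lapse r : ℂ) ≠ 0 := Complex.ofReal_ne_zero.2 hN.ne'
  -- The choices of temperature, angular velocity and radius make this proportionality exact for
  -- every mode.
  have hchi : ∀ p, B.chi r p = B.lapse r * minkowskiChi T (B.shift r + B.ΩH) ρ p := fun p => by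
    rw [StationaryBlackHole.chi, chi_eq_mul_chi hN, minkowskiChi, hρsq, hκT]
  have hcoef : T / (2 * Real.pi) = B.κ / (4 * Real.pi ^ 2) := by
    rw [hTdef, div_div]; congr 1; ring
  have hlead : ∀ p : ℤ × ℤ, ((B.κ / (4 * Real.pi ^ 2) : ℝ) : ℂ) * (1 / (2 * B.chi r p)) =
      (B.lapse r : ℂ)⁻¹ * (((T / (2 * Real.pi) : ℝ) : ℂ) *
        (1 / (2 * minkowskiChi T (B.shift r + B.ΩH) ρ p))) := fun p => by
    rw [hcoef, hchi, one_div, one_div, mul_inv, mul_inv, mul_inv]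
    ring
  obtain ⟨K, Λ, hK⟩ := hM.exists_norm_diag_sub_le m hr
  obtain ⟨K', Λ', hK'⟩ := exists_norm_minkowski_diag_sub_le hT0 hmM hq hρ0 htρ
  have hO : (fun p : ℤ × ℤ => B.summand GBH p.1 p.2 ![0, r, 0] ![0, r, 0] -
      ((B.κ / (4 * Real.pi ^ 2) : ℝ) : ℂ) * (1 / (2 * B.chi r p)))
        =O[Filter.cofinite] fun p => (B.chi r p ^ 3)⁻¹ := by
    simp only [StationaryBlackHole.summand, modeKernel_coincident]
    refine isBigO_sub_of_norm_le (K := K) _ ?_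
    filter_upwards [tendsto_modeNorm_cofinite.eventually_ge_atTop Λ] with p hp
    exact hK p hp _ (hBH p.1 p.2)
  have hO' : (fun p : ℤ × ℤ => minkowskiSummand T GM p.1 p.2 ![0, ρ, 0] ![0, ρ, 0] -
      ((T / (2 * Real.pi) : ℝ) : ℂ) * (1 / (2 * minkowskiChi T (B.shift r + B.ΩH) ρ p)))
        =O[Filter.cofinite] fun p => (minkowskiChi T (B.shift r + B.ΩH) ρ p ^ 3)⁻¹ := by
    simp only [minkowskiSummand, modeKernel_coincident]
    refine isBigO_sub_of_norm_le (K := K') _ ?_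
    filter_upwards [tendsto_modeNorm_cofinite.eventually_ge_atTop Λ'] with p hp
    exact hK' p hp _ (hGM p.1 p.2)
  have hsum : Summable fun p : ℤ × ℤ => ‖(B.chi r p ^ 3)⁻¹‖ :=
    B.isSection.summable_norm_inv_chi_pow_three hr.1 htime B.κ_pos
  set D : ℤ × ℤ → ℂ := fun p => B.summand GBH p.1 p.2 ![0, r, 0] ![0, r, 0] -
    (B.lapse r : ℂ)⁻¹ * minkowskiSummand T GM p.1 p.2 ![0, ρ, 0] ![0, ρ, 0] with hD
  have hDO : D =O[Filter.cofinite] fun p => (B.chi r p ^ 3)⁻¹ := by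
    have h1 : (fun p => (minkowskiChi T (B.shift r + B.ΩH) ρ p ^ 3)⁻¹) =O[Filter.cofinite]
        fun p => (B.chi r p ^ 3)⁻¹ := by
      refine IsBigO.of_bound (B.lapse r ^ 3) (Eventually.of_forall fun p => le_of_eq ?_)
      rw [hchi, mul_pow, mul_inv, norm_mul, norm_inv ((B.lapse r : ℂ) ^ 3), norm_pow,
        Complex.norm_real, Real.norm_eq_abs, abs_of_pos hN, ← mul_assoc,
        mul_inv_cancel₀ (by positivity), one_mul]
    refine (hO.sub ((hO'.trans h1).const_mul_left (B.lapse r : ℂ)⁻¹)).congr_left fun p => ?_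
    rw [hlead, hD]
    ring
  have hDs : Summable fun p => ‖D p‖ := summable_of_isBigO hsum hDO.norm_norm
  -- The two spacetimes share the angular phase, so separation in `θ` only rotates the coincident
  -- difference of each mode.
  have hterm : ∀ (θ : ℝ) (p : ℤ × ℤ), B.summand GBH p.1 p.2 ![0, r, 0] ![0, r, θ] -
      (B.lapse r : ℂ)⁻¹ * minkowskiSummand T GM p.1 p.2 ![0, ρ, 0] ![0, ρ, θ] =
        Complex.exp (((-(p.2 * θ) : ℝ) : ℂ) * Complex.I) * D p := fun θ p => by
    rw [hD]
    simp only [StationaryBlackHole.summand, minkowskiSummand]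
    rw [modeKernel_coincident, modeKernel_coincident, modeKernel_angular, modeKernel_angular]
    ring
  have hnorm : ∀ (p : ℤ × ℤ) (θ : ℝ),
      ‖Complex.exp (((-(p.2 * θ) : ℝ) : ℂ) * Complex.I) * D p‖ ≤ ‖D p‖ := fun p θ => by
    rw [norm_mul, Complex.norm_exp_ofReal_mul_I, one_mul]
  refine ⟨hO, hO', hlead, hsum, fun θ => ?_, ?_⟩
  · simp only [hterm]
    exact Summable.of_norm_bounded hDs fun p => hnorm p θ
  · simp only [hterm]
    -- The coincident differences form a summable majorant independent of `θ`, so the sum converges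
    -- uniformly to a continuous function.
    have hcont : Continuous fun θ : ℝ =>
        ∑' p : ℤ × ℤ, Complex.exp (((-(p.2 * θ) : ℝ) : ℂ) * Complex.I) * D p :=
      continuous_tsum (fun p => by fun_prop) hDs hnorm
    have h0 := (hcont.tendsto 0).mono_left (nhdsWithin_le_nhds (s := Set.Ioi 0))
    simpa using h0
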